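/- **Setting.** For laws $P,Q$ on a measurable space put $\delta(P\|Q)(\epsilon)=\sup_S\,(Q(S)-e^{\epsilon}P(S))$, $\epsilon\in\mathbb R$ (supremum over measurable $S$). An algorithm $A$ (database $\mapsto$ law of the output) is $(\epsilon,\delta)$-DP if $\Pr[A(D)\in S]\le e^{\epsilon}\Pr[A(D')\in S]+\delta$ for all neighbouring $D,D'$ and all measurable $S$; neighbouring is a symmetric relation. Let $\mathcal M_1,\dots,\mathcal M_k$ ($k\ge1$) be DP algorithms, $\mathcal M_i$ seeing the database and the outputs of $\mathcal M_1,\dots,\mathcal M_{i-1}$, with privacy curves $\delta_{\mathcal M_i}$: for all fixed previous outputs and every $\epsilon\ge0$, $\mathcal M_i$ is $(\epsilon,\delta_{\mathcal M_i}(\epsilon))$-DP. Let $(X_i,Y_i)$ be privacy loss random variables (PRVs) for $\delta_{\mathcal M_i}$: random variables in $[-\infty,\infty]$ with $\delta(X_i\|Y_i)=\delta_{\mathcal M_i}$ on $\mathbb R$, with $\mathbb E[\varphi(Y_i)]=\mathbb E[\varphi(X_i)e^{X_i}]$ for all measurable $\varphi:[-\infty,\infty]\to[0,1]$ with $\varphi(\pm\infty)=0$,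 and $\Pr[Y_i=-\infty]=\Pr[X_i=\infty]=0$. As neighbouring is symmetric, the curve is taken to be the same in both orders, $\delta(Y_i\|X_i)=\delta_{\mathcal M_i}$; and $\Pr[Y_i=\infty]=0$. Let $\mathcal M$ be the adaptive composition of $\mathcal M_1,\dots,\mathcal M_k$ and $\delta_{\mathcal M}=\delta_{\mathcal M_1}\otimes\cdots\otimes\delta_{\mathcal M_k}=\delta((X_1,\dots,X_k)\|(Y_1,\dots,Y_k))$ (independent components). For a real random variable $V$ let $\delta_V(\epsilon)=\mathbb E[(1-e^{\epsilon-V})_+]$, and let $Y=\sum_iY_i$ with independent $Y_i$. **Algorithm.** Given a mesh size $h>0$ and $L=\frac h2+nh$ with an integer $n\ge1$, $\mathsf{DiscretizePRV}(Y_i,L,h)$ computes $q_j=\mathrm{CDF}_{Y_i}(jh+\frac h2)-\mathrm{CDF}_{Y_i}(jh-\frac h2)$ for $-n\le j\le n$, divides $q$ by its sum, puts $\mu=\mathbb E[Y_i\mid|Y_i|\le L]-\sum_jjh\,q_j$, and returns the variable $\widetilde Y_i$ that equals $jh+\mu$ with probability $q_j$. $\mathsf{ComposePRV}$ returns $\widetilde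 Y=\widetilde Y_1\oplus_L\cdots\oplus_L\widetilde Y_k$ (independent summands), where $\oplus_L$ is addition modulo $2L$ with values in $(-L,L]$, and $\delta_{\widetilde Y}(\cdot)$. **Theorem.** Let $\epsilon_{\mathrm{error}}>0$, $0<\delta_{\mathrm{error}}<12$, $h=\epsilon_{\mathrm{error}}\big/\sqrt{\tfrac k2\log\tfrac{12}{\delta_{\mathrm{error}}}}$, and let $L\ge2+\epsilon_{\mathrm{error}}$, $L=\frac h2+nh$ with an integer $n\ge1$, be such that $$\sum_{i=1}^k\delta_{\mathcal M_i}(L-2)\le\frac{\delta_{\mathrm{error}}}8\quad\text{and}\quad\delta_{\mathcal M}(L-2-\epsilon_{\mathrm{error}})\le\frac{\delta_{\mathrm{error}}}4 .$$ 1. $\delta_{\mathcal M}$ is the privacy curve of the adaptive composition: $\mathcal M$ is $(\epsilon,\delta_{\mathcal M}(\epsilon))$-DP for every $\epsilon\in\mathbb R$, and there are algorithms $\mathcal N_1,\dots,\mathcal N_k$ with the privacy curves $\delta_{\mathcal M_1},\dots,\delta_{\mathcal M_k}$, on a set of two neighbouring databases $D,D'$, whose composition $\mathcal N$ satisfies $\delta(\mathcal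 N(D)\|\mathcal N(D'))=\delta_{\mathcal M}$. 2. For every $\epsilon\in\mathbb R$, the output $\widetilde Y$ of $\mathsf{ComposePRV}$ satisfies $$\delta_{\widetilde Y}(\epsilon+\epsilon_{\mathrm{error}})-\delta_{\mathrm{error}}\le\delta_Y(\epsilon)=\delta_{\mathcal M}(\epsilon)\le\delta_{\widetilde Y}(\epsilon-\epsilon_{\mathrm{error}})+\delta_{\mathrm{error}} .$$ 3. If $\delta_{\mathrm{error}}\le1$, $\mathsf{ComposePRV}$ takes $O\big(b\,\tfrac Lh\log\tfrac Lh\big)$ time, where $b$ is the number of distinct algorithms (i.e. PRVs) among $\mathcal M_1,\dots,\mathcal M_k$. That is, there are one fixed program and one absolute constant for all inputs. The program works on arrays of integers and of exact complex numbers, with unit cost for each arithmetic operation, $\exp$, rounding down, test and array access, and for each query to the CDF of an input PRV $Y_i$ or to its truncated mean $\mathbb E[Y_i\mid|Y_i|\le L]$. Its input is $n$, $h$, $b$, access to the $b$ distinct PRVs, and their multiplicities. It outputs the support and the probabilities of $\widetilde Y$, in increasing order, and tables $A,B$ with $\delta_{\widetilde Y}(\epsilon)=A_j-e^{\epsilon}B_j$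 for every $\epsilon\in\mathbb R$, where $j$ is the number of points of the grid $\mu+(h\mathbb Z\cap[-L,L])$, $\mu\in(-\frac h2,\frac h2]$, of $\widetilde Y$ that are $\le\epsilon$. -/

import Mathlib

open MeasureTheory ProbabilityTheory
open scoped ENNReal

namespace DPCompose

noncomputable section

universe u v

/-! ## Differential privacy, privacy curves, adaptive composition -/

/-- The randomized algorithm `A` (database ↦ law of the output) is `(ε, δ)`-DP for the
neighbouring relation `Nb`. -/
def IsDP {𝒟 : Type u} {Ω : Type v} [MeasurableSpace Ω] (Nb : 𝒟 → 𝒟 → Prop)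
    (A : 𝒟 → Measure Ω) (ε δ : ℝ) : Prop :=
  ∀ D D', Nb D D' → ∀ S, MeasurableSet S →
    (A D).real S ≤ Real.exp ε * (A D').real S + δ

/-- The privacy curve `δ(P||Q)(ε) = sup_S Q(S) - e^ε P(S)` of two laws. -/
def privacyCurve {Ω : Type v} [MeasurableSpace Ω] (P Q : Measure Ω) (ε : ℝ) : ℝ :=
  ⨆ S : {S : Set Ω // MeasurableSet S}, (Q.real S - Real.exp ε * P.real S)

/-- The tuples `(ω₀, …, ω_{n-1})` of the first `n` outputs, `ω_i ∈ Ω i`. -/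
def Hist (Ω : ℕ → Type v) : ℕ → Type v
  | 0 => PUnit
  | n + 1 => Hist Ω n × Ω n

instance instMeasurableSpaceHist (Ω : ℕ → Type v) [∀ i, MeasurableSpace (Ω i)] :
    ∀ n, MeasurableSpace (Hist Ω n)
  | 0 => (⊤ : MeasurableSpace PUnit)
  | n + 1 =>
    letI := instMeasurableSpaceHist Ω n
    inferInstanceAs (MeasurableSpace (Hist Ω n × Ω n))

/-- The law of all outputs of the first `n` algorithms on a fixed database, when the `i`-th one
sees all previous outputs and then draws its own output from the kernel `K i`. -/
def composeLaw {Ω : ℕ → Type v} [∀ i, MeasurableSpace (Ω i)]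
    (K : ∀ i, Kernel (Hist Ω i) (Ω i)) : ∀ n, Measure (Hist Ω n)
  | 0 => Measure.dirac PUnit.unit
  | n + 1 => (composeLaw K n).compProd (K n)

/-- The law of `(ω₀, …, ω_{n-1})` with independent `ω_i ∼ P i`. -/
def prodLaw {Ω : ℕ → Type v} [∀ i, MeasurableSpace (Ω i)]
    (P : ∀ i, Measure (Ω i)) : ∀ n, Measure (Hist Ω n)
  | 0 => Measure.dirac PUnit.unit
  | n + 1 => (prodLaw P n).prod (P n)

/-- The composition `δ₀ ⊗ ⋯ ⊗ δ_{k-1}` of the privacy curves `δ_i = δ(X_i||Y_i)`, namely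
`δ((X₀, …, X_{k-1}) || (Y₀, …, Y_{k-1}))` with independent components. -/
def composedCurve {Ω : ℕ → Type v} [∀ i, MeasurableSpace (Ω i)]
    (X Y : ∀ i, Measure (Ω i)) (k : ℕ) (ε : ℝ) : ℝ :=
  privacyCurve (prodLaw X k) (prodLaw Y k) ε

/-- The first `k` of the algorithms `M i D y` (`D` the database, `y` the previous outputs) have
the privacy curves `δ i`, for each fixed value of the previous outputs. -/
def HaveCurves {𝒟 : Type u} (Nb : 𝒟 → 𝒟 → Prop) {Ω : ℕ → Type v} [∀ i, MeasurableSpace (Ω i)]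
    (M : ∀ i, 𝒟 → Kernel (Hist Ω i) (Ω i)) (k : ℕ) (δ : ℕ → ℝ → ℝ) : Prop :=
  ∀ i < k, ∀ (y : Hist Ω i) (ε : ℝ), 0 ≤ ε → IsDP Nb (fun D => M i D y) ε (δ i ε)

/-! ## Privacy loss random variables -/

/-- `X, Y` are the laws of privacy loss random variables for the curve `δ`; `density` is the
condition `Y(t) = e^t X(t)` for `t ∈ ℝ`. -/
structure IsPRV (X Y : Measure EReal) (δ : ℝ → ℝ) : Prop where
  curve : ∀ ε, privacyCurve X Y ε = δ ε
  density : ∀ φ : EReal → ℝ≥0∞, Measurable φ → (∀ x, φ x ≤ 1) → φ ⊤ = 0 → φ ⊥ = 0 →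
    ∫⁻ y, φ y ∂Y = ∫⁻ x, φ x * ENNReal.ofReal (Real.exp x.toReal) ∂X
  bot : Y {⊥} = 0
  top : X {⊤} = 0

/-- `δ_Y(ε) = E[(1 - e^{ε - Y})₊]` for a real random variable `Y` with law `ν`. -/
def deltaOf (ν : Measure ℝ) (ε : ℝ) : ℝ :=
  ∫ y, max (1 - Real.exp (ε - y)) 0 ∂ν

/-- The law of `Y₀ + ⋯ + Y_{k-1}` with independent `Y_i ∼ ν i`. -/
def sumLaw (ν : ℕ → Measure ℝ) : ℕ → Measure ℝ
  | 0 => Measure.dirac 0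
  | k + 1 => ((sumLaw ν k).prod (ν k)).map (fun p => p.1 + p.2)

/-- The law of a (finite) extended real random variable, as a law on `ℝ`. -/
def realLaw (Y : Measure EReal) : Measure ℝ := Y.map EReal.toReal

/-! ## The algorithms `DiscretizePRV` and `ComposePRV` -/

/-- `CDF_Y(t)`. -/
def cdfOf (Y : Measure EReal) (t : ℝ) : ℝ := Y.real (Set.Iic (t : EReal))

/-- `E[Y^L]`, with `Y^L` the variable `Y` conditioned on `|Y| ≤ L`. -/
def truncMean (Y : Measure EReal) (L : ℝ) : ℝ :=
  ∫ y, y.toReal ∂(Y[|Set.Icc (-(L : EReal)) (L : EReal)])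

/-- `CDF_Y(ih + h/2) - CDF_Y(ih - h/2)`. -/
def rawWeight (Y : Measure EReal) (h : ℝ) (i : ℤ) : ℝ :=
  cdfOf Y (i * h + h / 2) - cdfOf Y (i * h - h / 2)

/-- The normalized weights `q_i`, `-n ≤ i ≤ n`. -/
def weight (Y : Measure EReal) (n : ℕ) (h : ℝ) (i : ℤ) : ℝ :=
  rawWeight Y h i / ∑ j ∈ Finset.Icc (-(n : ℤ)) n, rawWeight Y h j

/-- The shift `μ = E[Y^L] - ∑ i h q_i`. -/
def shift (Y : Measure EReal) (L : ℝ) (n : ℕ) (h : ℝ) : ℝ :=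
  truncMean Y L - ∑ i ∈ Finset.Icc (-(n : ℤ)) n, (i * h) * weight Y n h i

/-- The law of the output of `DiscretizePRV(Y, L, h)`, where `L = h / 2 + n h`:
the value `i h + μ` is taken with probability `q_i`, for `-n ≤ i ≤ n`. -/
def discretizePRV (Y : Measure EReal) (L : ℝ) (n : ℕ) (h : ℝ) : Measure ℝ :=
  ∑ i ∈ Finset.Icc (-(n : ℤ)) n,
    ENNReal.ofReal (weight Y n h i) • Measure.dirac (i * h + shift Y L n h)

/-- `x (mod 2L)`: the representative of `x` modulo `2L` in `(-L, L]`. -/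
def circMod (L x : ℝ) : ℝ := x - 2 * L * ⌈(x - L) / (2 * L)⌉

/-- Circular addition `x ⊕_L y`. -/
def circAdd (L x y : ℝ) : ℝ := circMod L (x + y)

/-- The law of `Y₀ ⊕_L ⋯ ⊕_L Y_{k-1}` with independent `Y_i ∼ ν i`. -/
def circSumLaw (L : ℝ) (ν : ℕ → Measure ℝ) : ℕ → Measure ℝ
  | 0 => Measure.dirac 0
  | k + 1 => ((circSumLaw L ν k).prod (ν k)).map (fun p => circAdd L p.1 p.2)

/-- The law of the output `Ỹ` of `ComposePRV` on `Y₀, …, Y_{k-1}` with truncation parameter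
`L = h / 2 + n h` and mesh size `h`. -/
def composePRV (Y : ℕ → Measure EReal) (k : ℕ) (L : ℝ) (n : ℕ) (h : ℝ) : Measure ℝ :=
  circSumLaw L (fun i => discretizePRV (Y i) L n h) k

/-! ## A machine model with a step count

Programs work on integer arrays and on arrays of exact complex numbers.  Every arithmetic
operation, array access, query to the input distributions and test costs one step. -/

/-- The access to the input distributions: the values of the CDF of the `j`-th distribution, and
its mean after conditioning on `[-L, L]`. -/
structure Oracle where
  cdf : ℤ → ℝ → ℝ
  mean : ℤ → ℝ → ℝ

/-- The memory: `int a i` and `num a i` are the entries with index `i` of the `a`-th arrays. -/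
structure Memory where
  int : ℕ → ℤ → ℤ
  num : ℕ → ℤ → ℂ

/-- Integer expressions; a scalar variable is an entry of an array. -/
inductive IntExpr where
  | const (c : ℤ)
  | get (a : ℕ) (i : IntExpr)
  | add (e f : IntExpr)
  | sub (e f : IntExpr)
  | mul (e f : IntExpr)
  | div (e f : IntExpr)
  | mod (e f : IntExpr)

/-- Numerical expressions. -/
inductive NumExpr where
  | const (c : ℚ)
  | pi
  | imag
  | ofInt (e : IntExpr)
  | get (a : ℕ) (i : IntExpr)
  | add (e f : NumExpr)
  | sub (e f : NumExpr)
  | mul (e f : NumExpr)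
  | div (e f : NumExpr)
  | exp (e : NumExpr)
  | cdf (j : IntExpr) (t : NumExpr)
  | mean (j : IntExpr) (L : NumExpr)

/-- Programs. -/
inductive Program where
  | setInt (a : ℕ) (i e : IntExpr)
  | setNum (a : ℕ) (i : IntExpr) (e : NumExpr)
  /-- store the integer `⌊Re e⌋` -/
  | setFloor (a : ℕ) (i : IntExpr) (e : NumExpr)
  | seq (p q : Program)
  /-- if `e ≤ f` then `p` else `q` -/
  | ite (e f : IntExpr) (p q : Program)
  /-- for `x = 0, …, e - 1` do `p`, with the counter `x` kept in entry `0` of the integer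
  array `a`; the bound `e` is evaluated once, at the start -/
  | loop (a : ℕ) (e : IntExpr) (p : Program)

/-- The value of an integer expression (`div` and `mod` are division with remainder). -/
def IntExpr.eval (s : Memory) : IntExpr → ℤ
  | const c => c
  | get a i => s.int a (i.eval s)
  | add e f => e.eval s + f.eval s
  | sub e f => e.eval s - f.eval s
  | mul e f => e.eval s * f.eval s
  | div e f => e.eval s / f.eval s
  | mod e f => e.eval s % f.eval s

/-- The number of operations in an integer expression. -/
def IntExpr.cost : IntExpr → ℕ
  | const _ => 1
  | get _ i => i.cost + 1
  | add e f => e.cost + f.cost + 1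
  | sub e f => e.cost + f.cost + 1
  | mul e f => e.cost + f.cost + 1
  | div e f => e.cost + f.cost + 1
  | mod e f => e.cost + f.cost + 1

/-- The value of a numerical expression. -/
def NumExpr.eval (O : Oracle) (s : Memory) : NumExpr → ℂ
  | const c => (c : ℂ)
  | pi => (Real.pi : ℂ)
  | imag => Complex.I
  | ofInt e => (e.eval s : ℂ)
  | get a i => s.num a (i.eval s)
  | add e f => e.eval O s + f.eval O s
  | sub e f => e.eval O s - f.eval O s
  | mul e f => e.eval O s * f.eval O s
  | div e f => e.eval O s / f.eval O s
  | exp e => Complex.exp (e.eval O s)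
  | cdf j t => (O.cdf (j.eval s) (t.eval O s).re : ℂ)
  | mean j L => (O.mean (j.eval s) (L.eval O s).re : ℂ)

/-- The number of operations in a numerical expression. -/
def NumExpr.cost : NumExpr → ℕ
  | const _ => 1
  | pi => 1
  | imag => 1
  | ofInt e => e.cost + 1
  | get _ i => i.cost + 1
  | add e f => e.cost + f.cost + 1
  | sub e f => e.cost + f.cost + 1
  | mul e f => e.cost + f.cost + 1
  | div e f => e.cost + f.cost + 1
  | exp e => e.cost + 1
  | cdf j t => j.cost + t.cost + 1
  | mean j L => j.cost + L.cost + 1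

/-- Write one entry of an integer array. -/
def Memory.putInt (s : Memory) (a : ℕ) (i x : ℤ) : Memory :=
  { s with int := Function.update s.int a (Function.update (s.int a) i x) }

/-- Write one entry of a numerical array. -/
def Memory.putNum (s : Memory) (a : ℕ) (i : ℤ) (z : ℂ) : Memory :=
  { s with num := Function.update s.num a (Function.update (s.num a) i z) }

/-- Running a program: the final memory and the number of steps. -/
def Program.run (O : Oracle) : Program → Memory → Memory × ℕ
  | setInt a i e, s => (s.putInt a (i.eval s) (e.eval s), i.cost + e.cost + 1)
  | setNum a i e, s => (s.putNum a (i.eval s) (e.eval O s), i.cost + e.cost + 1)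
  | setFloor a i e, s => (s.putInt a (i.eval s) ⌊(e.eval O s).re⌋, i.cost + e.cost + 1)
  | seq p q, s =>
    let r := p.run O s
    let r' := q.run O r.1
    (r'.1, r.2 + r'.2)
  | ite e f p q, s =>
    let r := if e.eval s ≤ f.eval s then p.run O s else q.run O s
    (r.1, r.2 + e.cost + f.cost + 1)
  | loop a e p, s =>
    Nat.rec (s, e.cost + 1)
      (fun x r =>
        let r' := p.run O (r.1.putInt a 0 (x : ℤ))
        (r'.1, r.2 + r'.2 + 1))
      (e.eval s).toNat

/-- The oracle for the distributions `Z 0, Z 1, …`. -/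
def oracleOf (Z : ℕ → Measure EReal) : Oracle where
  cdf j t := cdfOf (Z j.toNat) t
  mean j L := truncMean (Z j.toNat) L

/-- The memory at the start: `n` and `b` in the integer array `0`, the multiplicities
`m 0, …, m (b - 1)` in the integer array `1`, and `h` in the numerical array `0`. -/
def inputMemory (n b : ℕ) (m : ℕ → ℕ) (h : ℝ) : Memory where
  int a i :=
    if a = 0 ∧ i = 0 then (n : ℤ)
    else if a = 0 ∧ i = 1 then (b : ℤ)
    else if a = 1 ∧ 0 ≤ i ∧ i < b then (m i.toNat : ℤ)
    else 0
  num a i := if a = 0 ∧ i = 0 then (h : ℂ) else 0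

/-- The memory `s` holds the law `ν` and its curve `δ_ν`: the points `y j` of the shifted grid and
their probabilities `p j` are in the numerical arrays `1` and `2`, and the arrays `3` and `4` hold
numbers `A j`, `B j` such that `δ_ν(ε) = A j - e^ε B j` for every `ε`, where `j` is the number of
grid points that are at most `ε`. -/
def HoldsOutput (s : Memory) (n : ℕ) (h : ℝ) (ν : Measure ℝ) : Prop :=
  ∃ (μ : ℝ) (y p A B : ℕ → ℝ),
    μ ∈ Set.Ioc (-(h / 2)) (h / 2) ∧
    (∀ j : ℕ, y j = μ + ((j : ℝ) - n) * h) ∧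
    (∀ j < 2 * n + 1, 0 ≤ p j ∧ s.num 1 j = (y j : ℂ) ∧ s.num 2 j = (p j : ℂ)) ∧
    (∀ j ≤ 2 * n + 1, s.num 3 j = (A j : ℂ) ∧ s.num 4 j = (B j : ℂ)) ∧
    ν = ∑ j ∈ Finset.range (2 * n + 1), ENNReal.ofReal (p j) • Measure.dirac (y j) ∧
    ∀ ε : ℝ, ∀ j : ℕ, j = Set.ncard {l : ℕ | l < 2 * n + 1 ∧ y l ≤ ε} →
      deltaOf ν ε = A j - Real.exp ε * B j

end

end DPCompose

open DPCompose MeasureTheory ProbabilityTheory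

open MeasureTheory ProbabilityTheory
open scoped ENNReal

namespace DPCompose

noncomputable section

/-! ## Privacy curves -/

section Curve

variable {Ω Ω' : Type*} [MeasurableSpace Ω] [MeasurableSpace Ω']

/-! Composition. Bounding a pair `(P, Q)` by the curve of `(X, Y)` at every real `ε` amounts to
bounding every weighted test `a Q(S) - b P(S)` with `a, b ≥ 0` by the Neyman–Pearson test for `(X,
Y)` (`CurveLE.weighted`). In an adaptive step the history `ω` contributes such weights, namely its
density `q ω` and `e^ε p ω`. Hence the kernels at `ω` may be replaced by a fixed dominating pair for
each `ω` separately, and one measurable set collects all the optimal tests (`CurveLE.compProd`).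
Induction gives the product pair. The definition of DP only speaks of `ε ≥ 0`; negative `ε` come
from the reversed order by taking complements (`curveLE_of_nonneg`). The bound is attained by
mechanisms that ignore the history and output `X i` or `Y i`.

Accuracy. Symmetry of the curve excludes an atom of `X i` at `-∞`, so `X i = e^{-t} Y i`. Losses add
over independent factors, and the composed curve is the expected hinge `(1 - e^{ε - Y})₊` of the sum
(`deltaOf_sumLaw_eq_composedCurve`). To compare with the algorithm, each `Y i` is conditioned on
`(-L, L]`, which costs a tail in total variation, and is then rounded on the same probability space.
The shift in the discretization preserves the truncated mean, so apart from a small bias the total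
displacement is a centred sum of independent errors, each in an interval of length `h`. Hoeffding
bounds it by `εerr` except with probability `δerr / 6`. The displacement is absorbed by moving `ε`,
the bias by the Lipschitz hinge, and reduction modulo `2L` only matters when the sum is near or
beyond `±L`. All tails are bounded by values of privacy curves (`IsLoss.tail`, `deltaOf_compare`,
`deltaOf_composePRV`).

Running time. The output lives on `2n + 1` points with `2L = (2n + 1) h`, so circular convolution
becomes multiplication of discrete Fourier transforms of length `2n + 1`. These are computed by
Bluestein's formula from radix-two transforms. A PRV of multiplicity `m` enters through an `m`-th
power obtained by repeated squaring, whence a factor `b` instead of `k`. Fourier inversion recovers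
the probabilities (`composePRV_real_singleton`), and suffix sums give the curve. -/

theorem privacyCurve_bddAbove (P Q : Measure Ω) [IsProbabilityMeasure Q] (ε : ℝ) :
    BddAbove (Set.range fun S : {S : Set Ω // MeasurableSet S} =>
      Q.real S - Real.exp ε * P.real S) := by
  refine ⟨1, ?_⟩
  rintro _ ⟨S, rfl⟩
  have h1 : Q.real (S : Set Ω) ≤ 1 := measureReal_le_one
  have h2 : 0 ≤ Real.exp ε * P.real (S : Set Ω) := by positivity
  dsimp only
  linarith

theorem le_privacyCurve (P Q : Measure Ω) [IsProbabilityMeasure Q] (ε : ℝ) {S : Set Ω}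
    (hS : MeasurableSet S) : Q.real S - Real.exp ε * P.real S ≤ privacyCurve P Q ε :=
  le_ciSup (privacyCurve_bddAbove P Q ε) ⟨S, hS⟩

theorem privacyCurve_le {P Q : Measure Ω} {ε c : ℝ}
    (h : ∀ S, MeasurableSet S → Q.real S - Real.exp ε * P.real S ≤ c) :
    privacyCurve P Q ε ≤ c := by
  have : Nonempty {S : Set Ω // MeasurableSet S} := ⟨⟨∅, MeasurableSet.empty⟩⟩
  exact ciSup_le fun S => h S S.2

theorem privacyCurve_nonneg (P Q : Measure Ω) [IsProbabilityMeasure Q] (ε : ℝ) :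
    0 ≤ privacyCurve P Q ε := by
  simpa using le_privacyCurve P Q ε MeasurableSet.empty

/-- The curve of the pair `(P, Q)` is at most the curve of the pair `(X, Y)`. -/
def CurveLE (P Q : Measure Ω) (X Y : Measure Ω') : Prop :=
  ∀ (ε : ℝ) (S : Set Ω), MeasurableSet S →
    Q.real S - Real.exp ε * P.real S ≤ privacyCurve X Y ε

theorem CurveLE.privacyCurve_le {P Q : Measure Ω} {X Y : Measure Ω'} (h : CurveLE P Q X Y)
    (ε : ℝ) : privacyCurve P Q ε ≤ privacyCurve X Y ε :=
  DPCompose.privacyCurve_le fun S hS => h ε S hS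

/-- Bounds for nonnegative parameters in both orders give bounds for all parameters. -/
theorem curveLE_of_nonneg {P Q : Measure Ω} {X Y : Measure Ω'}
    [IsProbabilityMeasure P] [IsProbabilityMeasure Q] [IsProbabilityMeasure X]
    [IsProbabilityMeasure Y]
    (h₁ : ∀ ε, 0 ≤ ε → ∀ S, MeasurableSet S →
      Q.real S ≤ Real.exp ε * P.real S + privacyCurve X Y ε)
    (h₂ : ∀ ε, 0 ≤ ε → ∀ S, MeasurableSet S →
      P.real S ≤ Real.exp ε * Q.real S + privacyCurve Y X ε) :
    CurveLE P Q X Y := by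
  intro ε S hS
  rcases le_total 0 ε with hε | hε
  · linarith [h₁ ε hε S hS]
  have e1 : Real.exp ε * Real.exp (-ε) = 1 := by rw [← Real.exp_add]; simp
  have hpos := Real.exp_pos ε
  -- For negative `ε`, the complement is tested in the reversed order at `-ε`. Complements also
  -- bound the reversed curve at `-ε` by `e^{-ε} (δ(ε) + e^ε - 1)`, with `δ` the curve of `(X, Y)`.
  have a1 := h₂ (-ε) (by linarith) Sᶜ hS.compl
  rw [probReal_compl_eq_one_sub hS, probReal_compl_eq_one_sub hS] at a1
  have a2 : privacyCurve Y X (-ε) ≤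
      Real.exp (-ε) * (privacyCurve X Y ε + Real.exp ε - 1) := by
    refine privacyCurve_le fun T hT => ?_
    have := le_privacyCurve X Y ε hT.compl
    rw [probReal_compl_eq_one_sub hT, probReal_compl_eq_one_sub hT] at this
    have h3 : X.real T - Real.exp (-ε) * Y.real T =
        Real.exp (-ε) * (Real.exp ε * X.real T - Y.real T) := by
      linear_combination (-X.real T) * e1
    rw [h3]
    exact mul_le_mul_of_nonneg_left (by linarith) (Real.exp_pos _).le
  have a3 : Real.exp ε * (1 - P.real S) ≤ Real.exp ε * (Real.exp (-ε) * (1 - Q.real S) +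
      Real.exp (-ε) * (privacyCurve X Y ε + Real.exp ε - 1)) := by
    gcongr; linarith
  have a4 : Real.exp ε * (Real.exp (-ε) * (1 - Q.real S) +
      Real.exp (-ε) * (privacyCurve X Y ε + Real.exp ε - 1)) =
      (1 - Q.real S) + (privacyCurve X Y ε + Real.exp ε - 1) := by
    linear_combination ((1 - Q.real S) + (privacyCurve X Y ε + Real.exp ε - 1)) * e1
  nlinarith

/-- The Radon–Nikodym derivative with respect to the sum of two measures, as a real function. -/
def dens (ρ P : Measure Ω) (ω : Ω) : ℝ := (P.rnDeriv ρ ω).toReal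

theorem measurable_dens (ρ P : Measure Ω) : Measurable (dens ρ P) :=
  (Measure.measurable_rnDeriv _ _).ennreal_toReal

theorem dens_nonneg (ρ P : Measure Ω) (ω : Ω) : 0 ≤ dens ρ P ω := ENNReal.toReal_nonneg

theorem integrable_dens (ρ P : Measure Ω) [IsFiniteMeasure P] : Integrable (dens ρ P) ρ :=
  Measure.integrable_toReal_rnDeriv

/-- Some weighted Neyman–Pearson test dominates all tests for a pair with smaller curve. -/
theorem CurveLE.weighted {P Q : Measure Ω} {X Y : Measure Ω'}
    [IsProbabilityMeasure P] [IsProbabilityMeasure Q] [IsProbabilityMeasure X]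
    [IsProbabilityMeasure Y] (h : CurveLE P Q X Y) {a b : ℝ} (ha : 0 ≤ a) (hb : 0 ≤ b)
    {S : Set Ω} (hS : MeasurableSet S) :
    a * Q.real S - b * P.real S ≤
      a * Y.real {t | 0 ≤ a * dens (X + Y) Y t - b * dens (X + Y) X t} -
      b * X.real {t | 0 ≤ a * dens (X + Y) Y t - b * dens (X + Y) X t} := by
  have hX : X ≪ X + Y := Measure.AbsolutelyContinuous.rfl.add_right Y
  have hY : Y ≪ X + Y := by
    rw [add_comm]; exact Measure.AbsolutelyContinuous.rfl.add_right X
  set x := dens (X + Y) X with hx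
  set y := dens (X + Y) Y with hy
  have ix : Integrable x (X + Y) := integrable_dens _ _
  have iy : Integrable y (X + Y) := integrable_dens _ _
  have val : ∀ V : Set Ω', a * Y.real V - b * X.real V =
      ∫ t in V, (a * y t - b * x t) ∂(X + Y) := by
    intro V
    rw [integral_sub (iy.integrableOn.const_mul _) (ix.integrableOn.const_mul _),
      integral_const_mul, integral_const_mul]
    congr 2
    · exact (Measure.setIntegral_toReal_rnDeriv hY V).symm
    · exact (Measure.setIntegral_toReal_rnDeriv hX V).symm
  have mf : Measurable fun t => a * y t - b * x t :=
    ((measurable_dens _ _).const_mul _).sub ((measurable_dens _ _).const_mul _)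
  -- Neyman–Pearson: among all sets, the integral of a function is largest over the set where it is
  -- nonnegative.
  have np : ∀ V : Set Ω', MeasurableSet V → a * Y.real V - b * X.real V ≤
      a * Y.real {t | 0 ≤ a * y t - b * x t} - b * X.real {t | 0 ≤ a * y t - b * x t} := by
    intro V hV
    rw [val, val]
    exact setIntegral_le_nonneg hV mf.stronglyMeasurable
      ((iy.const_mul _).sub (ix.const_mul _))
  rcases ha.eq_or_lt with rfl | ha
  · refine le_trans ?_ (np ∅ MeasurableSet.empty)
    simp only [zero_mul, zero_sub, measureReal_empty, mul_zero, sub_self]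
    have : 0 ≤ b * P.real S := by positivity
    linarith
  rcases hb.eq_or_lt with rfl | hb
  · refine le_trans ?_ (np Set.univ MeasurableSet.univ)
    simp only [zero_mul, sub_zero, probReal_univ, mul_one]
    have : Q.real S ≤ 1 := measureReal_le_one
    nlinarith
  -- With both weights positive, division by `a` yields the curve at `ε = log (b / a)`. A zero
  -- weight has no such `ε`; the empty set and the whole space served there.
  have he : Real.exp (Real.log (b / a)) = b / a := Real.exp_log (by positivity)
  have h1 := h (Real.log (b / a)) S hS
  have h2 : privacyCurve X Y (Real.log (b / a)) ≤ a⁻¹ *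
      (a * Y.real {t | 0 ≤ a * y t - b * x t} - b * X.real {t | 0 ≤ a * y t - b * x t}) := by
    refine DPCompose.privacyCurve_le fun T hT => ?_
    have e : Y.real T - Real.exp (Real.log (b / a)) * X.real T =
        a⁻¹ * (a * Y.real T - b * X.real T) := by
      rw [he]; field_simp
    rw [e]
    have := np T hT
    gcongr
  calc a * Q.real S - b * P.real S = a * (Q.real S - Real.exp (Real.log (b / a)) * P.real S) := by
        rw [he]; field_simp
    _ ≤ a * (a⁻¹ *
      (a * Y.real {t | 0 ≤ a * y t - b * x t} - b * X.real {t | 0 ≤ a * y t - b * x t})) := by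
        gcongr; linarith
    _ = _ := by rw [mul_inv_cancel_left₀ ha.ne']

/-- A common dominating measure `ρ` writes the laws of both compositions as integrals over the same
histories, so that they can be compared history by history. Integrability holds because the kernels
have mass one. -/
theorem compProd_real_apply (ρ P : Measure Ω) (hP : P ≪ ρ) [IsFiniteMeasure ρ]
    [IsProbabilityMeasure P]
    (κ : Kernel Ω Ω') [IsMarkovKernel κ] {S : Set (Ω × Ω')} (hS : MeasurableSet S) :
    Integrable (fun ω => dens ρ P ω * (κ ω).real (Prod.mk ω ⁻¹' S)) ρ ∧
    (P.compProd κ).real S = ∫ ω, dens ρ P ω * (κ ω).real (Prod.mk ω ⁻¹' S) ∂ρ := by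
  have hm : Measurable fun ω => κ ω (Prod.mk ω ⁻¹' S) :=
    Kernel.measurable_kernel_prodMk_left hS
  constructor
  · refine (integrable_dens ρ P).mono
      ((measurable_dens _ _).mul hm.ennreal_toReal).aestronglyMeasurable
      (Filter.Eventually.of_forall fun ω => ?_)
    rw [norm_mul]
    have : ‖(κ ω).real (Prod.mk ω ⁻¹' S)‖ ≤ 1 := by
      rw [Real.norm_of_nonneg measureReal_nonneg]; exact measureReal_le_one
    exact mul_le_of_le_one_right (norm_nonneg _) this
  · have := integral_toReal_rnDeriv_mul hP (f := fun ω => (κ ω).real (Prod.mk ω ⁻¹' S))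
    unfold dens
    rw [this, measureReal_def, Measure.compProd_apply hS]
    exact (integral_toReal hm.aemeasurable
      (Filter.Eventually.of_forall fun ω => measure_lt_top _ _)).symm

/-- One step of adaptive composition. -/
theorem CurveLE.compProd {Ω'' : Type*} [MeasurableSpace Ω'']
    (P Q : Measure Ω) [IsProbabilityMeasure P] [IsProbabilityMeasure Q]
    (κ η : Kernel Ω Ω') [IsMarkovKernel κ] [IsMarkovKernel η]
    (X Y : Measure Ω'') [IsProbabilityMeasure X] [IsProbabilityMeasure Y]
    (h : ∀ ω, CurveLE (κ ω) (η ω) X Y) :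
    CurveLE (P.compProd κ) (Q.compProd η) (P.prod X) (Q.prod Y) := by
  intro ε S hS
  have hP : P ≪ P + Q := Measure.AbsolutelyContinuous.rfl.add_right Q
  have hQ : Q ≪ P + Q := by
    rw [add_comm]; exact Measure.AbsolutelyContinuous.rfl.add_right P
  set p := dens (P + Q) P with hp
  set q := dens (P + Q) Q with hq
  set x := dens (X + Y) X with hx
  set y := dens (X + Y) Y with hy
  -- The Neyman–Pearson set of the product pair. Its section at `ω` is the optimal test for the
  -- weights `q ω` and `e^ε p ω`, so this single set is optimal for all histories at once.
  let T : Set (Ω × Ω'') := {z | 0 ≤ q z.1 * y z.2 - (Real.exp ε * p z.1) * x z.2}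
  have hT : MeasurableSet T := by
    refine measurableSet_le measurable_const ?_
    exact (((measurable_dens _ _).comp measurable_fst).mul
        ((measurable_dens _ _).comp measurable_snd)).sub
      ((((measurable_dens _ _).comp measurable_fst).const_mul _).mul
        ((measurable_dens _ _).comp measurable_snd))
  refine le_trans ?_ (le_privacyCurve (P.prod X) (Q.prod Y) ε hT)
  rw [← Measure.compProd_const (μ := P), ← Measure.compProd_const (μ := Q)]
  obtain ⟨i1, v1⟩ := compProd_real_apply (P + Q) P hP κ hS
  obtain ⟨i2, v2⟩ := compProd_real_apply (P + Q) Q hQ η hS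
  obtain ⟨i3, v3⟩ := compProd_real_apply (P + Q) P hP (Kernel.const Ω X) hT
  obtain ⟨i4, v4⟩ := compProd_real_apply (P + Q) Q hQ (Kernel.const Ω Y) hT
  rw [v1, v2, v3, v4, ← integral_const_mul, ← integral_const_mul,
    ← integral_sub i2 (i1.const_mul _), ← integral_sub i4 (i3.const_mul _)]
  refine integral_mono (i2.sub (i1.const_mul _)) (i4.sub (i3.const_mul _)) fun ω => ?_
  have := (h ω).weighted (a := q ω) (b := Real.exp ε * p ω) (dens_nonneg _ _ _)
    (mul_nonneg (Real.exp_pos _).le (dens_nonneg _ _ _)) (S := Prod.mk ω ⁻¹' S)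
    (measurable_prodMk_left hS)
  simp only [Kernel.const_apply]
  rw [← mul_assoc, ← mul_assoc]
  exact this

theorem CurveLE.trans {Ω'' : Type*} [MeasurableSpace Ω''] {P Q : Measure Ω} {X Y : Measure Ω'}
    {V W : Measure Ω''} (h : CurveLE P Q X Y) (h' : CurveLE X Y V W) : CurveLE P Q V W :=
  fun ε S hS => (h ε S hS).trans (h'.privacyCurve_le ε)

/-- Post-processing: a test on the image pulls back to a test on the source. -/
theorem curveLE_map {P Q : Measure Ω} [IsProbabilityMeasure Q] {f : Ω → Ω'} (hf : Measurable f) :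
    CurveLE (P.map f) (Q.map f) P Q := by
  intro ε S hS
  rw [map_measureReal_apply hf hS, map_measureReal_apply hf hS]
  exact le_privacyCurve P Q ε (hf hS)

/-- Independent composition is monotone in the first factor. -/
theorem CurveLE.prod_right {Ω'' : Type*} [MeasurableSpace Ω'']
    {P Q : Measure Ω} [IsProbabilityMeasure P] [IsProbabilityMeasure Q]
    {X Y : Measure Ω'} [IsProbabilityMeasure X] [IsProbabilityMeasure Y]
    (V W : Measure Ω'') [IsProbabilityMeasure V] [IsProbabilityMeasure W]
    (h : CurveLE P Q X Y) : CurveLE (P.prod V) (Q.prod W) (X.prod V) (Y.prod W) := by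
  -- In second position the pair to be replaced is a constant kernel, to which `CurveLE.compProd`
  -- applies. Swapping the coordinates is a post-processing in either direction.
  have h1 : CurveLE (V.prod P) (W.prod Q) (V.prod X) (W.prod Y) := by
    rw [← Measure.compProd_const (μ := V) (ν := P), ← Measure.compProd_const (μ := W) (ν := Q)]
    exact CurveLE.compProd V W _ _ X Y fun _ => h
  have h2 : CurveLE (P.prod V) (Q.prod W) (V.prod P) (W.prod Q) := by
    have := curveLE_map (P := V.prod P) (Q := W.prod Q) measurable_swap
    rwa [Measure.prod_swap, Measure.prod_swap] at this
  have h3 : CurveLE (V.prod X) (W.prod Y) (X.prod V) (Y.prod W) := by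
    have := curveLE_map (P := X.prod V) (Q := Y.prod W) measurable_swap
    rwa [Measure.prod_swap, Measure.prod_swap] at this
  exact h2.trans (h1.trans h3)

end Curve

/-! ### Adaptive composition of several mechanisms. -/

section Compose

universe w w'

variable {Ω : ℕ → Type w} [∀ i, MeasurableSpace (Ω i)]
variable {Ω' : ℕ → Type w'} [∀ i, MeasurableSpace (Ω' i)]

instance isProbabilityMeasure_composeLaw (K : ∀ i, Kernel (Hist Ω i) (Ω i))
    [∀ i, IsMarkovKernel (K i)] (n : ℕ) : IsProbabilityMeasure (composeLaw K n) := by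
  induction n with
  | zero => exact Measure.dirac.isProbabilityMeasure
  | succ n ih =>
    change IsProbabilityMeasure ((composeLaw K n).compProd (K n))
    infer_instance

instance isProbabilityMeasure_prodLaw (P : ∀ i, Measure (Ω i))
    [∀ i, IsProbabilityMeasure (P i)] (n : ℕ) : IsProbabilityMeasure (prodLaw P n) := by
  induction n with
  | zero => exact Measure.dirac.isProbabilityMeasure
  | succ n ih =>
    change IsProbabilityMeasure ((prodLaw P n).prod (P n))
    infer_instance

/-- By induction, the last kernels are replaced by independent draws, uniformly in the history. Then
the law of the history is replaced by the product law while the new last factor is kept. -/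
theorem curveLE_composeLaw (κ η : ∀ i, Kernel (Hist Ω i) (Ω i))
    [∀ i, IsMarkovKernel (κ i)] [∀ i, IsMarkovKernel (η i)] (X Y : ∀ i, Measure (Ω' i))
    [∀ i, IsProbabilityMeasure (X i)] [∀ i, IsProbabilityMeasure (Y i)] (k : ℕ)
    (h : ∀ i < k, ∀ y, CurveLE (κ i y) (η i y) (X i) (Y i)) :
    CurveLE (composeLaw κ k) (composeLaw η k) (prodLaw X k) (prodLaw Y k) := by
  induction k with
  | zero =>
    intro ε S _
    -- The space of empty histories is a point, so there are only two events.
    have hS : S = ∅ ∨ S = Set.univ := by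
      by_cases hS : PUnit.unit ∈ S
      · exact Or.inr (Set.eq_univ_of_forall fun x => by cases x; exact hS)
      · exact Or.inl (Set.eq_empty_of_forall_notMem fun x => by cases x; exact hS)
    rcases hS with rfl | rfl
    · rw [measureReal_empty, measureReal_empty, mul_zero, sub_zero]
      exact privacyCurve_nonneg _ _ _
    · have := le_privacyCurve (prodLaw X 0) (prodLaw Y 0) ε MeasurableSet.univ
      rw [probReal_univ, probReal_univ] at this ⊢
      exact this
  | succ k ih =>
    have h1 := CurveLE.compProd (composeLaw κ k) (composeLaw η k) (κ k) (η k) (X k) (Y k)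
      (h k (Nat.lt_succ_self k))
    have h2 := (ih fun i hi => h i (hi.trans (Nat.lt_succ_self k))).prod_right (X k) (Y k)
    exact h1.trans h2

theorem composeLaw_const (P : ∀ i, Measure (Ω i)) [∀ i, IsProbabilityMeasure (P i)] (k : ℕ) :
    composeLaw (fun i => Kernel.const (Hist Ω i) (P i)) k = prodLaw P k := by
  induction k with
  | zero => rfl
  | succ k ih =>
    change (composeLaw _ k).compProd (Kernel.const _ (P k)) = (prodLaw P k).prod (P k)
    rw [ih, Measure.compProd_const]

/-- The composed curve bounds the adaptive composition. -/
theorem isDP_composeLaw {𝒟 : Type*} {Nb : 𝒟 → 𝒟 → Prop} (hNb : ∀ D D', Nb D D' → Nb D' D)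
    (M : ∀ i, 𝒟 → Kernel (Hist Ω i) (Ω i)) [∀ i D, IsMarkovKernel (M i D)] {k : ℕ}
    {δ : ℕ → ℝ → ℝ} (X Y : ∀ i, Measure (Ω' i))
    [∀ i, IsProbabilityMeasure (X i)] [∀ i, IsProbabilityMeasure (Y i)]
    (hM : HaveCurves Nb M k δ)
    (h₁ : ∀ i < k, ∀ ε, privacyCurve (X i) (Y i) ε = δ i ε)
    (h₂ : ∀ i < k, ∀ ε, privacyCurve (Y i) (X i) ε = δ i ε) (ε : ℝ) :
    IsDP Nb (fun D => composeLaw (fun i => M i D) k) ε (composedCurve X Y k ε) := by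
  intro D D' hD S hS
  have := curveLE_composeLaw (fun i => M i D') (fun i => M i D) X Y k
    (fun i hi y => curveLE_of_nonneg
      (fun ε hε S hS => by rw [h₁ i hi]; exact hM i hi y ε hε D D' hD S hS)
      (fun ε hε S hS => by rw [h₂ i hi]; exact hM i hi y ε hε D' D (hNb _ _ hD) S hS)) ε S hS
  unfold composedCurve
  linarith

/-- The mechanism outputs `Y i` or `X i` according to the bit that is the database. The two orders
of neighbours use the two curve identities, one each. -/
theorem haveCurves_const {k : ℕ} {δ : ℕ → ℝ → ℝ} (X Y : ∀ i, Measure (Ω i))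
    [∀ i, IsProbabilityMeasure (X i)] [∀ i, IsProbabilityMeasure (Y i)]
    (h₁ : ∀ i < k, ∀ ε, privacyCurve (X i) (Y i) ε = δ i ε)
    (h₂ : ∀ i < k, ∀ ε, privacyCurve (Y i) (X i) ε = δ i ε) :
    HaveCurves (fun D D' : Bool => D ≠ D')
      (fun i D => Kernel.const (Hist Ω i) (bif D then Y i else X i)) k δ := by
  intro i hi y ε _ D D' hD S hS
  have a := le_privacyCurve (X i) (Y i) ε hS
  have b := le_privacyCurve (Y i) (X i) ε hS
  rw [h₁ i hi] at a
  rw [h₂ i hi] at b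
  cases D <;> cases D' <;>
    simp only [ne_eq, not_true_eq_false, Kernel.const_apply, cond_true, cond_false] at hD ⊢ <;>
    linarith

/-- The composed curve is symmetric if the curves are. -/
theorem composedCurve_comm_le {k : ℕ} (X Y : ∀ i, Measure (Ω i))
    [∀ i, IsProbabilityMeasure (X i)] [∀ i, IsProbabilityMeasure (Y i)]
    (h : ∀ i < k, ∀ ε, privacyCurve (X i) (Y i) ε = privacyCurve (Y i) (X i) ε) (ε : ℝ) :
    composedCurve Y X k ε ≤ composedCurve X Y k ε := by
  have := curveLE_composeLaw (fun i => Kernel.const (Hist Ω i) (Y i))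
    (fun i => Kernel.const (Hist Ω i) (X i)) X Y k
    (fun i hi y ε S hS => by rw [h i hi]; exact le_privacyCurve (Y i) (X i) ε hS)
  rw [composeLaw_const, composeLaw_const] at this
  exact this.privacyCurve_le ε

end Compose

/-! ## Densities and tails of privacy losses -/

section Loss

variable {Ω : Type*} [MeasurableSpace Ω]

/-- `s` is the privacy loss of the pair `(P, Q)`, that is, `P = e^{-s} Q`. -/
def IsLoss (P Q : Measure Ω) (s : Ω → ℝ) : Prop :=
  Measurable s ∧ P = Q.withDensity fun ω => ENNReal.ofReal (Real.exp (-s ω))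

theorem IsLoss.apply {P Q : Measure Ω} {s : Ω → ℝ} (h : IsLoss P Q s) {S : Set Ω}
    (hS : MeasurableSet S) : P S = ∫⁻ ω in S, ENNReal.ofReal (Real.exp (-s ω)) ∂Q := by
  rw [h.2, withDensity_apply _ hS]

theorem IsLoss.measurable_exp {P Q : Measure Ω} {s : Ω → ℝ} (h : IsLoss P Q s) :
    Measurable fun ω => Real.exp (-s ω) := Real.measurable_exp.comp h.1.neg

theorem IsLoss.integrable {P Q : Measure Ω} [IsProbabilityMeasure P] {s : Ω → ℝ}
    (h : IsLoss P Q s) : Integrable (fun ω => Real.exp (-s ω)) Q := by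
  refine ⟨h.measurable_exp.aestronglyMeasurable, ?_⟩
  rw [hasFiniteIntegral_iff_ofReal (Filter.Eventually.of_forall fun ω => (Real.exp_pos _).le),
    ← setLIntegral_univ, ← h.apply MeasurableSet.univ]
  exact measure_lt_top _ _

theorem IsLoss.real_apply {P Q : Measure Ω} {s : Ω → ℝ}
    (h : IsLoss P Q s) {S : Set Ω} (hS : MeasurableSet S) :
    P.real S = ∫ ω in S, Real.exp (-s ω) ∂Q := by
  rw [measureReal_def, h.apply hS, integral_eq_lintegral_of_nonneg_ae
    (Filter.Eventually.of_forall fun ω => (Real.exp_pos _).le)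
    h.measurable_exp.aestronglyMeasurable]

theorem IsLoss.sub_eq {P Q : Measure Ω} [IsProbabilityMeasure P] [IsProbabilityMeasure Q]
    {s : Ω → ℝ} (h : IsLoss P Q s) (ε : ℝ) {S : Set Ω} (hS : MeasurableSet S) :
    Q.real S - Real.exp ε * P.real S = ∫ ω in S, (1 - Real.exp (ε - s ω)) ∂Q := by
  have e : ∀ ω, Real.exp (ε - s ω) = Real.exp ε * Real.exp (-s ω) := fun ω => by
    rw [← Real.exp_add, sub_eq_add_neg]
  simp_rw [e]
  rw [integral_sub (integrable_const _) (h.integrable.integrableOn.const_mul _),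
    integral_const_mul, ← h.real_apply hS]
  simp

theorem max_one_sub_exp_mem (x : ℝ) :
    0 ≤ max (1 - Real.exp x) 0 ∧ max (1 - Real.exp x) 0 ≤ 1 :=
  ⟨le_max_right _ _, max_le (by linarith [Real.exp_pos x]) zero_le_one⟩

theorem integrable_of_mem_unit {Q : Measure Ω} [IsFiniteMeasure Q] {f : Ω → ℝ}
    (hf : Measurable f) (h : ∀ ω, 0 ≤ f ω ∧ f ω ≤ 1) : Integrable f Q :=
  Integrable.of_bound hf.aestronglyMeasurable 1 (Filter.Eventually.of_forall fun ω => by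
    rw [Real.norm_of_nonneg (h ω).1]; exact (h ω).2)

/-- A test difference is the integral of `1 - e^{ε - s}` over the test set. The supremum is
therefore attained where this integrand is nonnegative, and only its positive part remains. -/
theorem IsLoss.privacyCurve_eq {P Q : Measure Ω} [IsProbabilityMeasure P]
    [IsProbabilityMeasure Q] {s : Ω → ℝ} (h : IsLoss P Q s) (ε : ℝ) :
    privacyCurve P Q ε = ∫ ω, max (1 - Real.exp (ε - s ω)) 0 ∂Q := by
  have mf : Measurable fun ω => 1 - Real.exp (ε - s ω) := by
    have := h.1
    fun_prop
  have hi : Integrable (fun ω => 1 - Real.exp (ε - s ω)) Q := by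
    have e : ∀ ω, Real.exp (ε - s ω) = Real.exp ε * Real.exp (-s ω) := fun ω => by
      rw [← Real.exp_add, sub_eq_add_neg]
    simp_rw [e]
    exact (integrable_const _).sub (h.integrable.const_mul _)
  have hS : MeasurableSet {ω | 0 ≤ 1 - Real.exp (ε - s ω)} :=
    measurableSet_le measurable_const mf
  have key : ∫ ω in {ω | 0 ≤ 1 - Real.exp (ε - s ω)}, (1 - Real.exp (ε - s ω)) ∂Q =
      ∫ ω, max (1 - Real.exp (ε - s ω)) 0 ∂Q := by
    rw [← integral_indicator hS]
    congr 1
    funext ω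
    by_cases hω : 0 ≤ 1 - Real.exp (ε - s ω)
    · rw [Set.indicator_of_mem (show ω ∈ {ω | 0 ≤ 1 - Real.exp (ε - s ω)} from hω),
        max_eq_left hω]
    · rw [Set.indicator_of_notMem (show ω ∉ {ω | 0 ≤ 1 - Real.exp (ε - s ω)} from hω),
        max_eq_right (not_le.mp hω).le]
  refine le_antisymm (privacyCurve_le fun S hS' => ?_) ?_
  · rw [h.sub_eq ε hS', ← key]
    exact setIntegral_le_nonneg hS' mf.stronglyMeasurable hi
  · rw [← key, ← h.sub_eq ε hS]
    exact le_privacyCurve P Q ε hS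

theorem measurable_max_one_sub_exp (ε : ℝ) :
    Measurable fun y : ℝ => max (1 - Real.exp (ε - y)) 0 := by fun_prop

theorem deltaOf_map (Q : Measure Ω) {s : Ω → ℝ} (hs : Measurable s) (ε : ℝ) :
    deltaOf (Q.map s) ε = ∫ ω, max (1 - Real.exp (ε - s ω)) 0 ∂Q :=
  integral_map hs.aemeasurable (measurable_max_one_sub_exp ε).aestronglyMeasurable

theorem IsLoss.privacyCurve_eq_deltaOf {P Q : Measure Ω} [IsProbabilityMeasure P]
    [IsProbabilityMeasure Q] {s : Ω → ℝ} (h : IsLoss P Q s) (ε : ℝ) :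
    privacyCurve P Q ε = deltaOf (Q.map s) ε := by
  rw [h.privacyCurve_eq, deltaOf_map Q h.1]

/-- Two-sided tail bound for a privacy loss. -/
theorem IsLoss.tail {P Q : Measure Ω} [IsProbabilityMeasure P] [IsProbabilityMeasure Q]
    {s : Ω → ℝ} (h : IsLoss P Q s) {ε t d : ℝ} (h₁ : privacyCurve P Q ε ≤ d)
    (h₂ : privacyCurve Q P ε ≤ d) :
    (1 - Real.exp (ε - t)) * Q.real {ω | t ≤ s ω} ≤ d ∧
    (1 - Real.exp (ε - t)) * Q.real {ω | s ω ≤ -t} ≤ Real.exp (-t) * d := by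
  have hup : MeasurableSet {ω | t ≤ s ω} := measurableSet_le measurable_const h.1
  have hlo : MeasurableSet {ω | s ω ≤ -t} := measurableSet_le h.1 measurable_const
  have et : Real.exp (ε - t) = Real.exp ε * Real.exp (-t) := by
    rw [← Real.exp_add, sub_eq_add_neg]
  constructor
  · have a := (le_privacyCurve P Q ε hup).trans h₁
    -- On the upper tail `P = e^{-s} Q ≤ e^{-t} Q`, so the curve loses only the fraction `e^{ε - t}`
    -- of the tail. The lower tail uses the same comparison with `P` and `Q` exchanged, which gains
    -- the factor `e^{-t}`.
    have b : P.real {ω | t ≤ s ω} ≤ Real.exp (-t) * Q.real {ω | t ≤ s ω} := by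
      rw [h.real_apply hup]
      have := setIntegral_mono_on (μ := Q) (s := {ω | t ≤ s ω})
        (f := fun ω => Real.exp (-s ω)) (g := fun _ => Real.exp (-t))
        h.integrable.integrableOn (integrable_const _) hup
        (fun ω hω => Real.exp_le_exp.mpr (neg_le_neg hω))
      refine this.trans (le_of_eq ?_)
      rw [setIntegral_const, smul_eq_mul, mul_comm]
    have c := mul_le_mul_of_nonneg_left b (Real.exp_pos ε).le
    rw [et]
    linarith
  · have a := (le_privacyCurve Q P ε hlo).trans h₂
    have b : Real.exp t * Q.real {ω | s ω ≤ -t} ≤ P.real {ω | s ω ≤ -t} := by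
      rw [h.real_apply hlo]
      have := setIntegral_mono_on (μ := Q) (s := {ω | s ω ≤ -t})
        (f := fun _ => Real.exp t) (g := fun ω => Real.exp (-s ω))
        (integrable_const _) h.integrable.integrableOn hlo
        (fun ω hω => Real.exp_le_exp.mpr (by have : s ω ≤ -t := hω; linarith))
      refine le_trans (le_of_eq ?_) this
      rw [setIntegral_const, smul_eq_mul, mul_comm]
    have e2 : Real.exp (-t) * Real.exp t = 1 := by rw [← Real.exp_add]; simp
    have q1 : Q.real {ω | s ω ≤ -t} ≤ Real.exp (-t) * P.real {ω | s ω ≤ -t} := by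
      have := mul_le_mul_of_nonneg_left b (Real.exp_pos (-t)).le
      rwa [← mul_assoc, e2, one_mul] at this
    have q2 := mul_le_mul_of_nonneg_left a (Real.exp_pos (-t)).le
    rw [et]
    linarith

end Loss

/-! ## Privacy loss random variables and their sums -/

/-- The density condition only sees functions that vanish at `±∞`. As `⊤` is null for both laws, it
extends to all events avoiding `⊥`. -/
theorem IsPRV.apply_real {X Y : Measure EReal} {δ : ℝ → ℝ} (h : IsPRV X Y δ)
    (hY : Y {⊤} = 0) {S : Set EReal} (hS : MeasurableSet S) (hb : ⊥ ∉ S) :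
    Y S = ∫⁻ x in S, ENNReal.ofReal (Real.exp x.toReal) ∂X := by
  have hS' : MeasurableSet (S \ {⊤}) := hS.diff (measurableSet_singleton _)
  have e := h.density ((S \ {⊤}).indicator 1) (measurable_one.indicator hS')
    (fun x => Set.indicator_le_self' (fun _ _ => zero_le) x)
    (by simp) (by simp [hb])
  rw [lintegral_indicator_one hS', measure_sdiff_null hY] at e
  rw [e, ← setLIntegral_congr (sdiff_null_ae_eq_self h.top), ← lintegral_indicator hS']
  refine lintegral_congr fun x => ?_
  by_cases hx : x ∈ S \ {⊤}
  · rw [Set.indicator_of_mem hx, Set.indicator_of_mem hx, Pi.one_apply, one_mul]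
  · rw [Set.indicator_of_notMem hx, Set.indicator_of_notMem hx, zero_mul]

/-- An atom of `X` at `-∞` is invisible to `Y`, so it bounds the reversed curve from below at every
`ε`. The forward curve is at most `Y (ε, ∞]`, because `Y ≤ e^ε X` below `ε`, and it tends to zero.
Symmetry of the curve thus forbids the atom. -/
theorem IsPRV.bot_left {X Y : Measure EReal} [IsProbabilityMeasure X] [IsProbabilityMeasure Y]
    {δ : ℝ → ℝ} (h : IsPRV X Y δ) (hY : Y {⊤} = 0)
    (hsymm : ∀ ε, privacyCurve Y X ε = δ ε) : X {⊥} = 0 := by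
  have b1 : ∀ ε : ℝ, X.real {⊥} ≤ Y.real (Set.Ioi (ε : EReal)) := by
    intro ε
    have a1 := le_privacyCurve Y X ε (measurableSet_singleton (⊥ : EReal))
    rw [hsymm, ← h.curve, measureReal_def Y, h.bot, ENNReal.toReal_zero, mul_zero, sub_zero] at a1
    refine a1.trans (privacyCurve_le fun S hS => ?_)
    have c1 : Y.real S ≤ Y.real (Set.Ioi (ε : EReal)) + Y.real (S ∩ Set.Ioc ⊥ (ε : EReal)) := by
      have sub : S ⊆ (Set.Ioi (ε : EReal) ∪ (S ∩ Set.Ioc ⊥ (ε : EReal))) ∪ {⊥} := by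
        intro x hx
        by_cases h1 : x = ⊥
        · exact Or.inr h1
        · by_cases h2 : (ε : EReal) < x
          · exact Or.inl (Or.inl h2)
          · exact Or.inl (Or.inr ⟨hx, bot_lt_iff_ne_bot.mpr h1, not_lt.mp h2⟩)
      have h0 : Y.real {⊥} = 0 := by rw [measureReal_def, h.bot, ENNReal.toReal_zero]
      have := measureReal_mono (μ := Y) sub (measure_ne_top _ _)
      have t1 := measureReal_union_le (μ := Y)
        (Set.Ioi (ε : EReal) ∪ (S ∩ Set.Ioc ⊥ (ε : EReal))) {⊥}
      have t2 := measureReal_union_le (μ := Y) (Set.Ioi (ε : EReal)) (S ∩ Set.Ioc ⊥ (ε : EReal))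
      linarith
    have c2 : Y.real (S ∩ Set.Ioc ⊥ (ε : EReal)) ≤ Real.exp ε * X.real S := by
      have hm : MeasurableSet (S ∩ Set.Ioc ⊥ (ε : EReal)) := hS.inter measurableSet_Ioc
      have c3 : Y (S ∩ Set.Ioc ⊥ (ε : EReal)) ≤ ENNReal.ofReal (Real.exp ε) * X S := by
        rw [h.apply_real hY hm (by simp)]
        calc ∫⁻ x in S ∩ Set.Ioc ⊥ (ε : EReal), ENNReal.ofReal (Real.exp x.toReal) ∂X
            ≤ ∫⁻ _ in S ∩ Set.Ioc ⊥ (ε : EReal), ENNReal.ofReal (Real.exp ε) ∂X := by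
              refine setLIntegral_mono' hm fun x hx => ?_
              refine ENNReal.ofReal_le_ofReal (Real.exp_le_exp.mpr ?_)
              have := EReal.toReal_le_toReal hx.2.2 hx.2.1.ne' (EReal.coe_ne_top ε)
              simpa using this
          _ = ENNReal.ofReal (Real.exp ε) * X (S ∩ Set.Ioc ⊥ (ε : EReal)) := by
              rw [setLIntegral_const]
          _ ≤ _ := by gcongr; exact Set.inter_subset_left
      have := ENNReal.toReal_mono (ENNReal.mul_ne_top ENNReal.ofReal_ne_top (measure_ne_top _ _)) c3
      rwa [ENNReal.toReal_mul, ENNReal.toReal_ofReal (Real.exp_pos _).le] at this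
    linarith
  -- Along `ε = n → ∞` the rays `(n, ∞]` shrink to the null set `{⊤}`.
  have b2 : Filter.Tendsto (fun n : ℕ => Y (Set.Ioi (((n : ℕ) : ℝ) : EReal))) Filter.atTop
      (nhds (Y (⋂ n : ℕ, Set.Ioi (((n : ℕ) : ℝ) : EReal)))) := by
    refine tendsto_measure_iInter_atTop (fun n => measurableSet_Ioi.nullMeasurableSet) ?_
      ⟨0, measure_ne_top _ _⟩
    intro m n hmn
    exact Set.Ioi_subset_Ioi (by exact_mod_cast hmn)
  have b3 : (⋂ n : ℕ, Set.Ioi (((n : ℕ) : ℝ) : EReal)) ⊆ {⊤} := by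
    intro x hx
    rw [Set.mem_iInter] at hx
    by_contra hne
    have hb : x ≠ ⊥ := by rintro rfl; simpa using hx 0
    lift x to ℝ using ⟨hne, hb⟩
    obtain ⟨n, hn⟩ := exists_nat_gt x
    have : ((n : ℝ) : EReal) < x := hx n
    exact absurd (EReal.coe_lt_coe_iff.mp this) (not_lt.mpr hn.le)
  rw [measure_mono_null b3 hY] at b2
  have b4 : X {⊥} ≤ 0 := by
    refine ge_of_tendsto' b2 fun n => ?_
    exact (ENNReal.toReal_le_toReal (measure_ne_top _ _) (measure_ne_top _ _)).mp (b1 n)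
  exact le_antisymm b4 zero_le

/-- Both laws live on the real line, where `Y = e^t X` with a positive finite density, and this
density can be inverted. -/
theorem IsPRV.isLoss {X Y : Measure EReal} [IsProbabilityMeasure X] [IsProbabilityMeasure Y]
    {δ : ℝ → ℝ} (h : IsPRV X Y δ) (hY : Y {⊤} = 0)
    (hsymm : ∀ ε, privacyCurve Y X ε = δ ε) : IsLoss X Y EReal.toReal := by
  refine ⟨measurable_ereal_toReal, ?_⟩
  have hb := h.bot_left hY hsymm
  have m1 : Measurable fun x : EReal => ENNReal.ofReal (Real.exp x.toReal) :=
    (Real.measurable_exp.comp measurable_ereal_toReal).ennreal_ofReal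
  have e : Y = X.withDensity fun x => ENNReal.ofReal (Real.exp x.toReal) := by
    ext S hS
    rw [withDensity_apply _ hS, ← measure_sdiff_null h.bot,
      h.apply_real hY (hS.diff (measurableSet_singleton _)) (by simp),
      setLIntegral_congr (sdiff_null_ae_eq_self hb)]
  have inv := withDensity_inv_same (μ := X) m1
    (Filter.Eventually.of_forall fun x => by
      simpa using Real.exp_pos x.toReal)
    (Filter.Eventually.of_forall fun x => ENNReal.ofReal_ne_top)
  rw [← e] at inv
  rw [← inv]
  congr 1
  funext x
  rw [Real.exp_neg, ENNReal.ofReal_inv_of_pos (Real.exp_pos _)]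

/-- Densities of product measures multiply, so their negative logarithms add. -/
theorem IsLoss.prod {Ω Ω' : Type*} [MeasurableSpace Ω] [MeasurableSpace Ω']
    {P Q : Measure Ω} {X Y : Measure Ω'} [SFinite Q] [SFinite Y] [SFinite P] [SFinite X]
    {s : Ω → ℝ} {t : Ω' → ℝ}
    (h : IsLoss P Q s) (h' : IsLoss X Y t) :
    IsLoss (P.prod X) (Q.prod Y) fun z => s z.1 + t z.2 := by
  refine ⟨(h.1.comp measurable_fst).add (h'.1.comp measurable_snd), ?_⟩
  have h2 := h.2
  have h2' := h'.2
  rw [h2, h2', prod_withDensity h.measurable_exp.ennreal_ofReal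
    h'.measurable_exp.ennreal_ofReal]
  congr 1
  funext z
  rw [neg_add, Real.exp_add, ENNReal.ofReal_mul (Real.exp_pos _).le]

/-- The sum of the real values of a tuple. -/
def histSum : ∀ k, Hist (fun _ => EReal) k → ℝ
  | 0 => fun _ => 0
  | k + 1 => fun z => histSum k z.1 + z.2.toReal

theorem isLoss_prodLaw (X Y : ℕ → Measure EReal) [∀ i, IsProbabilityMeasure (X i)]
    [∀ i, IsProbabilityMeasure (Y i)] (k : ℕ)
    (h : ∀ i < k, IsLoss (X i) (Y i) EReal.toReal) :
    IsLoss (prodLaw X k) (prodLaw Y k) (histSum k) := by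
  induction k with
  | zero =>
    refine ⟨measurable_const, ?_⟩
    change _ = (prodLaw Y 0).withDensity fun _ => ENNReal.ofReal (Real.exp (-0))
    rw [neg_zero, Real.exp_zero, ENNReal.ofReal_one]
    exact withDensity_one.symm
  | succ k ih =>
    exact (ih fun i hi => h i (hi.trans (Nat.lt_succ_self k))).prod (h k (Nat.lt_succ_self k))

instance isProbabilityMeasure_realLaw (Y : Measure EReal) [IsProbabilityMeasure Y] :
    IsProbabilityMeasure (realLaw Y) :=
  Measure.isProbabilityMeasure_map measurable_ereal_toReal.aemeasurable

theorem measurable_fst_add_snd : Measurable fun p : ℝ × ℝ => p.1 + p.2 :=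
  measurable_fst.add measurable_snd

theorem isProbabilityMeasure_sumLaw (ν : ℕ → Measure ℝ) (k : ℕ)
    (h : ∀ i < k, IsProbabilityMeasure (ν i)) : IsProbabilityMeasure (sumLaw ν k) := by
  induction k with
  | zero => exact Measure.dirac.isProbabilityMeasure
  | succ k ih =>
    have := ih fun i hi => h i (hi.trans (Nat.lt_succ_self k))
    have := h k (Nat.lt_succ_self k)
    exact Measure.isProbabilityMeasure_map (measurable_fst.add measurable_snd).aemeasurable

theorem measurable_histSum (k : ℕ) : Measurable (histSum k) := by
  induction k with
  | zero => exact measurable_const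
  | succ k ih =>
    exact (ih.comp measurable_fst).add (measurable_ereal_toReal.comp measurable_snd)

theorem sumLaw_realLaw (Y : ℕ → Measure EReal) [∀ i, IsProbabilityMeasure (Y i)] (k : ℕ) :
    sumLaw (fun i => realLaw (Y i)) k = (prodLaw Y k).map (histSum k) := by
  induction k with
  | zero =>
    change Measure.dirac 0 = (Measure.dirac PUnit.unit : Measure (Hist (fun _ => EReal) 0)).map _
    exact (Measure.map_dirac' (measurable_histSum 0) (PUnit.unit : Hist (fun _ => EReal) 0)).symm
  | succ k ih =>
    change ((sumLaw _ k).prod (realLaw (Y k))).map _ =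
      ((prodLaw Y k).prod (Y k)).map fun z => histSum k z.1 + z.2.toReal
    rw [ih, realLaw, Measure.map_prod_map _ _ (measurable_histSum k) measurable_ereal_toReal,
      Measure.map_map measurable_fst_add_snd
        ((measurable_histSum k).prodMap measurable_ereal_toReal)]
    rfl

theorem deltaOf_sumLaw_eq_composedCurve (X Y : ℕ → Measure EReal)
    [∀ i, IsProbabilityMeasure (X i)] [∀ i, IsProbabilityMeasure (Y i)] (k : ℕ)
    (h : ∀ i < k, IsLoss (X i) (Y i) EReal.toReal) (ε : ℝ) :
    deltaOf (sumLaw (fun i => realLaw (Y i)) k) ε = composedCurve X Y k ε := by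
  rw [sumLaw_realLaw, composedCurve, (isLoss_prodLaw X Y k h).privacyCurve_eq_deltaOf]

/-! ## Circular addition and laws of sums -/

theorem measurable_circMod (L : ℝ) : Measurable (circMod L) := by
  unfold circMod
  fun_prop

theorem circMod_of_mem {L x : ℝ} (h₁ : -L < x) (h₂ : x ≤ L) : circMod L x = x := by
  have hL : 0 < 2 * L := by linarith
  have : ⌈(x - L) / (2 * L)⌉ = 0 := by
    rw [Int.ceil_eq_zero_iff]
    constructor
    · rw [lt_div_iff₀ hL]; linarith
    · rw [div_le_iff₀ hL]; linarith
  simp [circMod, this]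

theorem circMod_sub_int_mul {L : ℝ} (hL : L ≠ 0) (x : ℝ) (m : ℤ) :
    circMod L (x - 2 * L * m) = circMod L x := by
  have : (x - 2 * L * m - L) / (2 * L) = (x - L) / (2 * L) - m := by
    field_simp
    ring
  rw [circMod, this, Int.ceil_sub_intCast, circMod]
  push_cast
  ring

/-- Reducing early changes the argument by a multiple of `2L`, so it is enough to reduce once at the
end. -/
theorem circMod_circMod_add {L : ℝ} (hL : L ≠ 0) (x y : ℝ) :
    circMod L (circMod L x + y) = circMod L (x + y) := by
  rw [← circMod_sub_int_mul hL (x + y) ⌈(x - L) / (2 * L)⌉]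
  congr 1
  rw [circMod]
  ring

theorem isFiniteMeasure_of_univ_le_one {α : Type*} [MeasurableSpace α] {μ : Measure α}
    (h : μ Set.univ ≤ 1) : IsFiniteMeasure μ :=
  ⟨h.trans_lt ENNReal.one_lt_top⟩

/-- Only mass at most one is available in general: the discretized law is the zero measure when all
raw weights vanish, since division by zero gives zero. -/
theorem sumLaw_univ_le (ν : ℕ → Measure ℝ) (k : ℕ) (h : ∀ i < k, ν i Set.univ ≤ 1) :
    sumLaw ν k Set.univ ≤ 1 := by
  induction k with
  | zero => simp [sumLaw]
  | succ k ih =>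
    have h1 := ih fun i hi => h i (hi.trans (Nat.lt_succ_self k))
    have h2 := h k (Nat.lt_succ_self k)
    have := isFiniteMeasure_of_univ_le_one h1
    have := isFiniteMeasure_of_univ_le_one h2
    change (((sumLaw ν k).prod (ν k)).map _) Set.univ ≤ 1
    rw [Measure.map_apply measurable_fst_add_snd MeasurableSet.univ, Set.preimage_univ,
      ← Set.univ_prod_univ, Measure.prod_prod]
    exact mul_le_one' h1 h2

/-- This trades the circular sum for an ordinary one followed by a single reduction. Accuracy and
Fourier analysis can then work with sums of independent variables. -/
theorem circSumLaw_eq_map {L : ℝ} (hL : 0 < L) (ν : ℕ → Measure ℝ) (k : ℕ)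
    (h : ∀ i < k, ν i Set.univ ≤ 1) :
    circSumLaw L ν k = (sumLaw ν k).map (circMod L) := by
  induction k with
  | zero =>
    change Measure.dirac 0 = (Measure.dirac 0).map (circMod L)
    rw [Measure.map_dirac' (measurable_circMod L), circMod_of_mem (by linarith) hL.le]
  | succ k ih =>
    have hk : ∀ i < k, ν i Set.univ ≤ 1 := fun i hi => h i (hi.trans (Nat.lt_succ_self k))
    have := isFiniteMeasure_of_univ_le_one (sumLaw_univ_le ν k hk)
    have := isFiniteMeasure_of_univ_le_one (h k (Nat.lt_succ_self k))
    change ((circSumLaw L ν k).prod (ν k)).map _ =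
      (((sumLaw ν k).prod (ν k)).map _).map (circMod L)
    have hc : Measurable fun p : ℝ × ℝ => circAdd L p.1 p.2 :=
      (measurable_circMod L).comp measurable_fst_add_snd
    have hid : ν k = (ν k).map id := Measure.map_id.symm
    rw [ih hk, hid, Measure.map_prod_map _ _ (measurable_circMod L) measurable_id,
      Measure.map_map hc ((measurable_circMod L).prodMap measurable_id), ← hid,
      Measure.map_map (measurable_circMod L) measurable_fst_add_snd]
    congr 1
    funext p
    exact circMod_circMod_add hL.ne' p.1 p.2

theorem sumLaw_congr {ν ν' : ℕ → Measure ℝ} (k : ℕ) (h : ∀ i < k, ν i = ν' i) :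
    sumLaw ν k = sumLaw ν' k := by
  induction k with
  | zero => rfl
  | succ k ih =>
    change ((sumLaw ν k).prod (ν k)).map _ = ((sumLaw ν' k).prod (ν' k)).map _
    rw [ih fun i hi => h i (hi.trans (Nat.lt_succ_self k)), h k (Nat.lt_succ_self k)]

/-- It realizes the convolution on one probability space, as needed for the coupling and for
Hoeffding's inequality. -/
theorem sumLaw_eq_map_sum {Ω : Type*} [MeasurableSpace Ω] {μ : Measure Ω}
    [IsProbabilityMeasure μ] {Z : ℕ → Ω → ℝ} (hm : ∀ i, Measurable (Z i)) (hZ : iIndepFun Z μ)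
    (k : ℕ) : sumLaw (fun i => μ.map (Z i)) k = μ.map fun ω => ∑ i ∈ Finset.range k, Z i ω := by
  induction k with
  | zero => simp [sumLaw]
  | succ k ih =>
    change ((sumLaw _ k).prod (μ.map (Z k))).map _ = _
    have hs : Measurable fun ω => ∑ i ∈ Finset.range k, Z i ω :=
      Finset.measurable_sum _ fun i _ => hm i
    have hi : IndepFun (fun ω => ∑ i ∈ Finset.range k, Z i ω) (Z k) μ := by
      have := hZ.indepFun_finsetSum_of_notMem hm (s := Finset.range k) (i := k) (by simp)
      convert this using 1
      funext ω
      simp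
    rw [ih, ← (indepFun_iff_map_prod_eq_prod_map_map hs.aemeasurable (hm k).aemeasurable).mp hi,
      Measure.map_map measurable_fst_add_snd (hs.prodMk (hm k))]
    congr 1
    funext ω
    simp [Finset.sum_range_succ]

/-! ## Total variation -/

/-- The expectations of `[0, 1]`-valued functions under `ν` and `ν'` differ by at most `η`. -/
def TVLE (ν ν' : Measure ℝ) (η : ℝ) : Prop :=
  ∀ f : ℝ → ℝ, Measurable f → (∀ x, 0 ≤ f x ∧ f x ≤ 1) →
    |∫ x, f x ∂ν - ∫ x, f x ∂ν'| ≤ η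

theorem integral_mem_unit {Ω : Type*} [MeasurableSpace Ω] {μ : Measure Ω}
    (hμ : μ Set.univ ≤ 1) {f : Ω → ℝ}
    (hf : Measurable f) (h : ∀ x, 0 ≤ f x ∧ f x ≤ 1) : 0 ≤ ∫ x, f x ∂μ ∧ ∫ x, f x ∂μ ≤ 1 := by
  have := isFiniteMeasure_of_univ_le_one hμ
  refine ⟨integral_nonneg fun x => (h x).1, ?_⟩
  have := integral_mono (integrable_of_mem_unit (Q := μ) hf h) (integrable_const (1 : ℝ))
    fun x => (h x).2
  refine this.trans ?_
  simpa [measureReal_def] using ENNReal.toReal_mono ENNReal.one_ne_top hμ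

/-- Hybrid argument: the summands are exchanged one at a time. Averaging a `[0, 1]`-valued test over
one summand leaves a `[0, 1]`-valued test of the other, so the errors simply add. -/
theorem TVLE.sumLaw {ν ν' : ℕ → Measure ℝ} {η : ℕ → ℝ} (k : ℕ)
    (hν : ∀ i < k, IsProbabilityMeasure (ν i)) (hν' : ∀ i < k, IsProbabilityMeasure (ν' i))
    (h : ∀ i < k, TVLE (ν i) (ν' i) (η i)) :
    TVLE (sumLaw ν k) (DPCompose.sumLaw ν' k) (∑ i ∈ Finset.range k, η i) := by
  induction k with
  | zero =>
    intro f _ _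
    simp [DPCompose.sumLaw]
  | succ k ih =>
    intro f hf h01
    have l : ∀ i < k, i < k + 1 := fun i hi => hi.trans (Nat.lt_succ_self k)
    have ih := ih (fun i hi => hν i (l i hi)) (fun i hi => hν' i (l i hi))
      (fun i hi => h i (l i hi))
    have := isProbabilityMeasure_sumLaw ν k fun i hi => hν i (l i hi)
    have := isProbabilityMeasure_sumLaw ν' k fun i hi => hν' i (l i hi)
    have := hν k (Nat.lt_succ_self k)
    have := hν' k (Nat.lt_succ_self k)
    have hfp : Measurable fun p : ℝ × ℝ => f (p.1 + p.2) := hf.comp measurable_fst_add_snd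
    have e : ∀ (S ξ : Measure ℝ) [IsProbabilityMeasure S] [IsProbabilityMeasure ξ],
        ∫ x, f x ∂((S.prod ξ).map fun p => p.1 + p.2) = ∫ x, ∫ y, f (x + y) ∂ξ ∂S := by
      intro S ξ _ _
      rw [integral_map measurable_fst_add_snd.aemeasurable hf.aestronglyMeasurable]
      exact integral_prod _ (integrable_of_mem_unit hfp fun p => h01 _)
    change |∫ x, f x ∂(((DPCompose.sumLaw ν k).prod (ν k)).map _) -
      ∫ x, f x ∂(((DPCompose.sumLaw ν' k).prod (ν' k)).map _)| ≤ _
    rw [e, e]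
    have hg : ∀ (ξ : Measure ℝ) [IsProbabilityMeasure ξ],
        Measurable fun x => ∫ y, f (x + y) ∂ξ := fun ξ _ =>
      (hfp.stronglyMeasurable.integral_prod_right).measurable
    have hg1 : ∀ (ξ : Measure ℝ) [IsProbabilityMeasure ξ] (x : ℝ),
        0 ≤ ∫ y, f (x + y) ∂ξ ∧ ∫ y, f (x + y) ∂ξ ≤ 1 := fun ξ _ x =>
      integral_mem_unit (by simp) (hf.comp (measurable_const_add x)) fun y => h01 _
    have a1 := ih _ (hg (ν' k)) (hg1 (ν' k))
    have a2 : |∫ x, ∫ y, f (x + y) ∂(ν k) ∂(DPCompose.sumLaw ν k) -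
        ∫ x, ∫ y, f (x + y) ∂(ν' k) ∂(DPCompose.sumLaw ν k)| ≤ η k := by
      rw [← integral_sub (integrable_of_mem_unit (hg _) (hg1 _))
        (integrable_of_mem_unit (hg _) (hg1 _))]
      have := norm_integral_le_of_norm_le_const (μ := DPCompose.sumLaw ν k) (C := η k)
        (f := fun x => ∫ y, f (x + y) ∂(ν k) - ∫ y, f (x + y) ∂(ν' k))
        (Filter.Eventually.of_forall fun x =>
          h k (Nat.lt_succ_self k) _ (hf.comp (measurable_const_add x)) fun y => h01 _)
      simpa using this
    rw [Finset.sum_range_succ]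
    calc _ ≤ _ := abs_sub_le _
            (∫ x, ∫ y, f (x + y) ∂(ν' k) ∂(DPCompose.sumLaw ν k)) _
      _ ≤ η k + _ := add_le_add a2 a1
      _ = _ := add_comm _ _

theorem integral_cond {ν : Measure ℝ} {A : Set ℝ} (f : ℝ → ℝ) :
    ∫ x, f x ∂(ν[|A]) = (ν.real A)⁻¹ * ∫ x in A, f x ∂ν := by
  rw [ProbabilityTheory.cond, integral_smul_measure, ENNReal.toReal_inv, smul_eq_mul]
  rfl

/-- With `p` the mass of `A`, the part of the integral outside `A` is at most `1 - p`. Normalization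
raises the part inside by at most `1 - p` too. The two changes have opposite effects on the
difference. -/
theorem tvle_cond {ν : Measure ℝ} [IsProbabilityMeasure ν] {A : Set ℝ} (hA : MeasurableSet A)
    (hp : 0 < ν.real A) : TVLE ν (ν[|A]) (1 - ν.real A) := by
  intro f hf h01
  have hi : Integrable f ν := integrable_of_mem_unit hf h01
  rw [integral_cond, ← integral_add_compl hA hi]
  set p := ν.real A with hp'
  set I := ∫ x in A, f x ∂ν
  have I0 : 0 ≤ I := integral_nonneg fun x => (h01 x).1
  have I1 : I ≤ p := by
    have := integral_mono (μ := ν.restrict A) hi.integrableOn (integrable_const (1 : ℝ))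
      fun x => (h01 x).2
    simpa using this
  have J0 : 0 ≤ ∫ x in Aᶜ, f x ∂ν := integral_nonneg fun x => (h01 x).1
  have J1 : ∫ x in Aᶜ, f x ∂ν ≤ 1 - p := by
    have := integral_mono (μ := ν.restrict Aᶜ) hi.integrableOn (integrable_const (1 : ℝ))
      fun x => (h01 x).2
    simpa [probReal_compl_eq_one_sub hA] using this
  have p1 : p ≤ 1 := measureReal_le_one
  have e : p⁻¹ * I = I + (p⁻¹ - 1) * I := by ring
  have q0 : 0 ≤ p⁻¹ - 1 := sub_nonneg.mpr ((one_le_inv₀ hp).mpr p1)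
  have q1 : (p⁻¹ - 1) * I ≤ 1 - p := by
    calc (p⁻¹ - 1) * I ≤ (p⁻¹ - 1) * p := by gcongr
      _ = 1 - p := by field_simp
  have q2 : 0 ≤ (p⁻¹ - 1) * I := mul_nonneg q0 I0
  rw [abs_le]
  constructor <;> linarith

/-! ## Lipschitz property of the hockey-stick function and Hoeffding's inequality -/

/-- The hinge `x ↦ (1 - e^{-x})₊` is increasing and 1-Lipschitz, by `1 - e^{-b} ≤ b`. -/
theorem max_one_sub_exp_le {ε ε' u v b : ℝ} (hb : 0 ≤ b) (h : v - ε' ≤ u - ε + b) :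
    max (1 - Real.exp (ε' - v)) 0 ≤ max (1 - Real.exp (ε - u)) 0 + b := by
  have h2 := le_max_left (1 - Real.exp (ε - u)) 0
  have h3 := le_max_right (1 - Real.exp (ε - u)) 0
  refine max_le ?_ (by linarith)
  have h1 : Real.exp (ε - u - b) ≤ Real.exp (ε' - v) := Real.exp_le_exp.mpr (by linarith)
  have h4 : Real.exp (ε - u - b) = Real.exp (ε - u) * Real.exp (-b) := by
    rw [← Real.exp_add, sub_eq_add_neg]
  have h5 : 1 - b ≤ Real.exp (-b) := by linarith [Real.add_one_le_exp (-b)]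
  by_cases hx : Real.exp (ε - u) ≤ 1
  · have := Real.exp_pos (ε - u)
    nlinarith [Real.exp_le_one_iff.mpr (neg_nonpos.mpr hb)]
  · have : 1 * Real.exp (-b) ≤ Real.exp (ε - u) * Real.exp (-b) := by
      gcongr
      exact (not_le.mp hx).le
    linarith

/-- A centred variable in an interval of length `h` is sub-Gaussian with parameter `(h / 2)²`. The
factor 2 is the union bound over the two signs. -/
theorem hoeffding_abs {Ω : Type*} [MeasurableSpace Ω] {μ : Measure Ω} [IsProbabilityMeasure μ]
    {W : ℕ → Ω → ℝ} (hm : ∀ i, Measurable (W i)) (hW : iIndepFun W μ) {k : ℕ} {h : ℝ} (hh : 0 < h)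
    (hb : ∀ i < k, ∀ ω, W i ω ∈ Set.Icc (-(h / 2)) (h / 2)) {ε : ℝ} (hε : 0 ≤ ε) :
    μ.real {ω | ε ≤ |∑ i ∈ Finset.range k, (W i ω - ∫ ω', W i ω' ∂μ)|} ≤
      2 * Real.exp (-(2 * ε ^ 2) / (k * h ^ 2)) := by
  have hc : (((‖h / 2 - -(h / 2)‖₊ / 2) ^ 2 : NNReal) : ℝ) = (h / 2) ^ 2 := by
    push_cast
    rw [Real.norm_eq_abs, abs_of_pos (by linarith)]
    ring
  have hexp : -ε ^ 2 / (2 * k * (((‖h / 2 - -(h / 2)‖₊ / 2) ^ 2 : NNReal) : ℝ)) =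
      -(2 * ε ^ 2) / (k * h ^ 2) := by
    rw [hc]
    rcases eq_or_ne (k : ℝ) 0 with h0 | h0
    · simp [h0]
    · field_simp
  have sub : ∀ i < k, HasSubgaussianMGF (fun ω => W i ω - ∫ ω', W i ω' ∂μ)
      ((‖h / 2 - -(h / 2)‖₊ / 2) ^ 2) μ := fun i hi =>
    hasSubgaussianMGF_of_mem_Icc (hm i).aemeasurable (Filter.Eventually.of_forall (hb i hi))
  have ind : iIndepFun (fun i ω => W i ω - ∫ ω', W i ω' ∂μ) μ :=
    hW.comp (fun i x => x - ∫ ω', W i ω' ∂μ) fun i => measurable_id.sub_const _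
  have ind' : iIndepFun (fun i ω => -(W i ω - ∫ ω', W i ω' ∂μ)) μ :=
    hW.comp (fun i x => -(x - ∫ ω', W i ω' ∂μ)) fun i => (measurable_id.sub_const _).neg
  have a1 := HasSubgaussianMGF.measure_sum_range_ge_le_of_iIndepFun ind sub hε
  have a2 := HasSubgaussianMGF.measure_sum_range_ge_le_of_iIndepFun ind'
    (fun i hi => (sub i hi).neg) hε
  rw [hexp] at a1 a2
  calc _ ≤ μ.real ({ω | ε ≤ ∑ i ∈ Finset.range k, (W i ω - ∫ ω', W i ω' ∂μ)} ∪
        {ω | ε ≤ ∑ i ∈ Finset.range k, -(W i ω - ∫ ω', W i ω' ∂μ)}) := by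
        refine measureReal_mono (fun ω hω => ?_) (measure_ne_top _ _)
        rcases le_abs.mp (show ε ≤ |_| from hω) with h' | h'
        · exact Or.inl h'
        · refine Or.inr ?_
          rw [← Finset.sum_neg_distrib] at h'
          exact h'
    _ ≤ _ := measureReal_union_le _ _
    _ ≤ _ := by linarith

/-! ## Rounding to the grid -/

/-- The index `j` with `jh - h/2 < z ≤ jh + h/2`. -/
def roundIdx (h z : ℝ) : ℤ := ⌈z / h - 1 / 2⌉

theorem measurable_roundIdx (h : ℝ) : Measurable (roundIdx h) := by
  unfold roundIdx
  fun_prop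

theorem roundIdx_eq_iff {h : ℝ} (hh : 0 < h) (z : ℝ) (j : ℤ) :
    roundIdx h z = j ↔ j * h - h / 2 < z ∧ z ≤ j * h + h / 2 := by
  rw [roundIdx, Int.ceil_eq_iff]
  have e1 : (j : ℝ) - 1 < z / h - 1 / 2 ↔ j * h - h / 2 < z := by
    rw [show (j : ℝ) - 1 < z / h - 1 / 2 ↔ (j : ℝ) - 1 / 2 < z / h by
      constructor <;> intro <;> linarith, lt_div_iff₀ hh]
    constructor <;> intro <;> linarith
  have e2 : z / h - 1 / 2 ≤ (j : ℝ) ↔ z ≤ j * h + h / 2 := by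
    rw [show z / h - 1 / 2 ≤ (j : ℝ) ↔ z / h ≤ (j : ℝ) + 1 / 2 by
      constructor <;> intro <;> linarith, div_le_iff₀ hh]
    constructor <;> intro <;> linarith
  rw [e1, e2]

theorem sub_roundIdx_mem {h : ℝ} (hh : 0 < h) (z : ℝ) :
    z - roundIdx h z * h ∈ Set.Icc (-(h / 2)) (h / 2) := by
  have := (roundIdx_eq_iff hh z _).mp rfl
  constructor <;> linarith [this.1, this.2]

/-- As `h / 2 + n h` is a cell boundary, the cells with index from `-n` to `n` tile exactly the
half-open window. -/
theorem roundIdx_mem_Icc_iff {h : ℝ} (hh : 0 < h) (n : ℕ) (z : ℝ) :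
    roundIdx h z ∈ Finset.Icc (-(n : ℤ)) n ↔
      z ∈ Set.Ioc (-(h / 2 + n * h)) (h / 2 + n * h) := by
  obtain ⟨h1, h2⟩ := (roundIdx_eq_iff hh z _).mp rfl
  rw [Finset.mem_Icc, Set.mem_Ioc]
  constructor
  · rintro ⟨a, b⟩
    have a' : -(n : ℝ) ≤ roundIdx h z := by exact_mod_cast a
    have b' : (roundIdx h z : ℝ) ≤ n := by exact_mod_cast b
    constructor <;> nlinarith
  · rintro ⟨a, b⟩
    constructor
    · by_contra hc
      have : roundIdx h z + 1 ≤ -(n : ℤ) := by omega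
      have : (roundIdx h z : ℝ) + 1 ≤ -(n : ℝ) := by exact_mod_cast this
      nlinarith
    · by_contra hc
      have : (n : ℤ) + 1 ≤ roundIdx h z := by omega
      have : (n : ℝ) + 1 ≤ roundIdx h z := by exact_mod_cast this
      nlinarith

/-! ### The discretized law as the law of a rounded, truncated loss. -/

section Discretize

variable {Y : Measure EReal}

theorem ae_finite (h₁ : Y {⊤} = 0) (h₂ : Y {⊥} = 0) : ∀ᵐ y ∂Y, y ≠ ⊤ ∧ y ≠ ⊥ := by
  rw [Filter.eventually_and]
  exact ⟨compl_mem_ae_iff.mpr h₁, compl_mem_ae_iff.mpr h₂⟩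

theorem cdfOf_eq (h₁ : Y {⊤} = 0) (h₂ : Y {⊥} = 0) (t : ℝ) :
    cdfOf Y t = (realLaw Y).real (Set.Iic t) := by
  rw [cdfOf, realLaw, map_measureReal_apply measurable_ereal_toReal measurableSet_Iic]
  refine measureReal_congr ?_
  filter_upwards [ae_finite h₁ h₂] with y hy
  lift y to ℝ using hy
  refine propext ?_
  change (y : EReal) ≤ t ↔ (y : EReal).toReal ≤ t
  rw [EReal.coe_le_coe_iff, EReal.toReal_coe]

theorem truncMean_eq (h₁ : Y {⊤} = 0) (h₂ : Y {⊥} = 0) (L : ℝ) :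
    truncMean Y L = ∫ z, z ∂((realLaw Y)[|Set.Icc (-L) L]) := by
  have hA : (Set.Icc (-(L : EReal)) (L : EReal)) =ᵐ[Y] EReal.toReal ⁻¹' (Set.Icc (-L) L) := by
    filter_upwards [ae_finite h₁ h₂] with y hy
    lift y to ℝ using hy
    refine propext ?_
    change (-(L : EReal) ≤ (y : EReal) ∧ (y : EReal) ≤ L) ↔
      (-L ≤ (y : EReal).toReal ∧ (y : EReal).toReal ≤ L)
    rw [← EReal.coe_neg, EReal.coe_le_coe_iff, EReal.coe_le_coe_iff, EReal.toReal_coe]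
  rw [integral_cond, truncMean, ProbabilityTheory.cond, integral_smul_measure,
    ENNReal.toReal_inv, smul_eq_mul, realLaw,
    map_measureReal_apply measurable_ereal_toReal measurableSet_Icc,
    setIntegral_map measurableSet_Icc (by fun_prop) measurable_ereal_toReal.aemeasurable,
    ← measureReal_congr hA, Measure.restrict_congr_set hA]
  rfl

variable [IsProbabilityMeasure Y]

theorem rawWeight_eq (h₁ : Y {⊤} = 0) (h₂ : Y {⊥} = 0) {h : ℝ} (hh : 0 < h) (j : ℤ) :
    rawWeight Y h j = (realLaw Y).real {z | roundIdx h z = j} := by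
  rw [rawWeight, cdfOf_eq h₁ h₂, cdfOf_eq h₁ h₂]
  have e : {z | roundIdx h z = j} = Set.Iic (j * h + h / 2) \ Set.Iic (j * h - h / 2) := by
    ext z
    rw [Set.mem_ofPred_eq, roundIdx_eq_iff hh, Set.mem_sdiff, Set.mem_Iic, Set.mem_Iic, not_le,
      and_comm]
  rw [e, measureReal_sdiff (Set.Iic_subset_Iic.mpr (by linarith)) measurableSet_Iic]

theorem measurableSet_roundIdx (h : ℝ) (j : ℤ) : MeasurableSet {z | roundIdx h z = j} :=
  measurable_roundIdx h (measurableSet_singleton j)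

theorem Ioc_eq_biUnion {h : ℝ} (hh : 0 < h) (n : ℕ) :
    Set.Ioc (-(h / 2 + n * h)) (h / 2 + n * h) =
      ⋃ j ∈ Finset.Icc (-(n : ℤ)) n, {z | roundIdx h z = j} := by
  ext z
  simp only [← roundIdx_mem_Icc_iff hh, Set.mem_iUnion, Set.mem_ofPred_eq, exists_prop,
    exists_eq_right']

theorem sum_rawWeight (h₁ : Y {⊤} = 0) (h₂ : Y {⊥} = 0) {h : ℝ} (hh : 0 < h) (n : ℕ) :
    ∑ j ∈ Finset.Icc (-(n : ℤ)) n, rawWeight Y h j =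
      (realLaw Y).real (Set.Ioc (-(h / 2 + n * h)) (h / 2 + n * h)) := by
  rw [Ioc_eq_biUnion hh, measureReal_biUnion_finset _ fun j _ => measurableSet_roundIdx h j]
  · exact Finset.sum_congr rfl fun j _ => rawWeight_eq h₁ h₂ hh j
  · intro i _ j _ hij
    refine Set.disjoint_left.mpr fun z hz hz' => hij ?_
    rw [← show roundIdx h z = i from hz, ← show roundIdx h z = j from hz']

theorem weight_eq (h₁ : Y {⊤} = 0) (h₂ : Y {⊥} = 0) {h : ℝ} (hh : 0 < h) {n : ℕ} {j : ℤ}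
    (hj : j ∈ Finset.Icc (-(n : ℤ)) n) :
    weight Y n h j = ((realLaw Y)[|Set.Ioc (-(h / 2 + n * h)) (h / 2 + n * h)]).real
      {z | roundIdx h z = j} := by
  rw [weight, sum_rawWeight h₁ h₂ hh, rawWeight_eq h₁ h₂ hh, measureReal_def (_[|_]),
    cond_apply measurableSet_Ioc, ENNReal.toReal_mul, ENNReal.toReal_inv, div_eq_inv_mul]
  congr 3
  refine (Set.inter_eq_right.mpr fun z hz => ?_).symm
  rw [← roundIdx_mem_Icc_iff hh]
  have : roundIdx h z = j := hz
  rwa [this]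

theorem rawWeight_nonneg {h : ℝ} (hh : 0 < h) (j : ℤ) :
    0 ≤ rawWeight Y h j := by
  refine sub_nonneg.mpr (measureReal_mono (Set.Iic_subset_Iic.mpr ?_) (measure_ne_top _ _))
  exact EReal.coe_le_coe_iff.mpr (by linarith)

theorem weight_nonneg {h : ℝ} (hh : 0 < h) (n : ℕ) (j : ℤ) :
    0 ≤ weight Y n h j :=
  div_nonneg (rawWeight_nonneg hh j) (Finset.sum_nonneg fun j _ => rawWeight_nonneg hh j)

theorem sum_weight_le (Y : Measure EReal) (n : ℕ) (h : ℝ) :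
    ∑ j ∈ Finset.Icc (-(n : ℤ)) n, weight Y n h j ≤ 1 := by
  unfold weight
  rw [← Finset.sum_div]
  exact div_self_le_one _

theorem discretizePRV_univ_le {h : ℝ} (hh : 0 < h) (L : ℝ) (n : ℕ) :
    discretizePRV Y L n h Set.univ ≤ 1 := by
  rw [discretizePRV, Measure.finsetSum_apply]
  simp only [Measure.smul_apply, measure_univ, smul_eq_mul, mul_one]
  rw [← ENNReal.ofReal_sum_of_nonneg fun j _ => weight_nonneg hh n j]
  exact ENNReal.ofReal_le_one.mpr (sum_weight_le Y n h)

/-- A sum over the grid is the law of the rounded value. -/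
theorem sum_weight_dirac_eq_map (h₁ : Y {⊤} = 0) (h₂ : Y {⊥} = 0) {h : ℝ} (hh : 0 < h) (n : ℕ)
    (hp : 0 < (realLaw Y).real (Set.Ioc (-(h / 2 + n * h)) (h / 2 + n * h))) (c : ℝ) :
    ∑ i ∈ Finset.Icc (-(n : ℤ)) n, ENNReal.ofReal (weight Y n h i) • Measure.dirac (i * h + c) =
      ((realLaw Y)[|Set.Ioc (-(h / 2 + n * h)) (h / 2 + n * h)]).map
        fun z => roundIdx h z * h + c := by
  have hm : Measurable fun z => (roundIdx h z : ℝ) * h + c := by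
    have := measurable_roundIdx h
    fun_prop
  set A := Set.Ioc (-(h / 2 + n * h)) (h / 2 + n * h) with hA
  set ν := (realLaw Y)[|A] with hν
  have hp0 : realLaw Y A ≠ 0 := fun h0 => by
    rw [measureReal_def, h0, ENNReal.toReal_zero] at hp
    exact lt_irrefl _ hp
  have : IsProbabilityMeasure ν := cond_isProbabilityMeasure hp0
  have hνA : ν Aᶜ = 0 := by
    rw [hν, cond_apply measurableSet_Ioc, Set.inter_compl_self, measure_empty, mul_zero]
  ext S hS
  -- All mass of `ν` lies in the window, which is split into the cells; the rounded value is
  -- constant on each of them.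
  rw [Measure.map_apply hm hS, ← measure_inter_add_sdiff (μ := ν) _ (measurableSet_Ioc : MeasurableSet A),
    measure_mono_null (Set.sdiff_subset_compl _ _) hνA, add_zero, Ioc_eq_biUnion hh,
    Set.inter_iUnion₂, measure_biUnion_finset]
  · rw [Measure.finsetSum_apply]
    refine Finset.sum_congr rfl fun j hj => ?_
    rw [Measure.smul_apply, Measure.dirac_apply' _ hS, smul_eq_mul]
    by_cases hjS : (j : ℝ) * h + c ∈ S
    · rw [Set.indicator_of_mem hjS, Pi.one_apply, mul_one, weight_eq h₁ h₂ hh hj,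
        ofReal_measureReal]
      congr 1
      ext z
      constructor
      · intro hz
        refine ⟨?_, hz⟩
        rw [Set.mem_preimage, show roundIdx h z = j from hz]
        exact hjS
      · exact fun hz => hz.2
    · rw [Set.indicator_of_notMem hjS, mul_zero]
      symm
      convert measure_empty (μ := ν)
      refine Set.eq_empty_of_forall_notMem fun z hz => hjS ?_
      have h1 : (roundIdx h z : ℝ) * h + c ∈ S := hz.1
      rwa [show roundIdx h z = j from hz.2] at h1
  · intro i _ j _ hij
    refine Set.disjoint_left.mpr fun z hz hz' => hij ?_
    rw [← show roundIdx h z = i from hz.2, ← show roundIdx h z = j from hz'.2]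
  · exact fun j _ => (hm hS).inter (measurableSet_roundIdx h j)

/-- The mean of both sides of `sum_weight_dirac_eq_map` for the shift zero. -/
theorem integral_roundIdx (h₁ : Y {⊤} = 0) (h₂ : Y {⊥} = 0) {h : ℝ} (hh : 0 < h) (n : ℕ)
    (hp : 0 < (realLaw Y).real (Set.Ioc (-(h / 2 + n * h)) (h / 2 + n * h))) :
    ∫ z, (roundIdx h z : ℝ) * h ∂((realLaw Y)[|Set.Ioc (-(h / 2 + n * h)) (h / 2 + n * h)]) =
      ∑ i ∈ Finset.Icc (-(n : ℤ)) n, (i * h) * weight Y n h i := by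
  have hm : Measurable fun z => (roundIdx h z : ℝ) * h + 0 := by
    have := measurable_roundIdx h
    fun_prop
  have e := congrArg (fun m => ∫ y, y ∂m) (sum_weight_dirac_eq_map h₁ h₂ hh n hp 0)
  rw [integral_map hm.aemeasurable (by fun_prop), integral_finsetSum_measure
    fun i _ => (integrable_dirac enorm_lt_top).smul_measure ENNReal.ofReal_ne_top] at e
  simp only [add_zero] at e
  rw [← e]
  refine Finset.sum_congr rfl fun i _ => ?_
  rw [integral_smul_measure, integral_dirac, ENNReal.toReal_ofReal (weight_nonneg hh n i),
    smul_eq_mul, mul_comm]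

/-- The means conditioned on `[-L, L]` and on `(-L, L]` are close. -/
theorem abs_integral_cond_sub_le {ν : Measure ℝ} [IsProbabilityMeasure ν] {L : ℝ} (hL : 0 < L)
    (hp : 0 < ν.real (Set.Ioc (-L) L)) :
    |∫ z, z ∂(ν[|Set.Icc (-L) L]) - ∫ z, z ∂(ν[|Set.Ioc (-L) L])| ≤
      2 * L * ν.real {z | z ≤ -L} / ν.real (Set.Ioc (-L) L) := by
  rw [integral_cond, integral_cond]
  have hIcc : Set.Icc (-L) L = {-L} ∪ Set.Ioc (-L) L :=
    (Set.singleton_union ▸ Set.Ioc_insert_left (by linarith)).symm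
  have hd : Disjoint {-L} (Set.Ioc (-L) L) := by simp
  have hi : IntegrableOn (fun z : ℝ => z) (Set.Icc (-L) L) ν := by
    refine Integrable.of_bound (by fun_prop) L ?_
    filter_upwards [ae_restrict_mem measurableSet_Icc] with z hz
    exact abs_le.mpr hz
  rw [hIcc] at hi ⊢
  rw [measureReal_union hd measurableSet_Ioc,
    setIntegral_union hd measurableSet_Ioc (hi.mono_set Set.subset_union_left)
      (hi.mono_set Set.subset_union_right), integral_singleton]
  have ha : ν.real {-L} ≤ ν.real {z | z ≤ -L} :=
    measureReal_mono (fun z hz => le_of_eq hz) (measure_ne_top _ _)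
  have hI : |∫ z in Set.Ioc (-L) L, z ∂ν| ≤ L * ν.real (Set.Ioc (-L) L) := by
    exact norm_setIntegral_le_of_norm_le_const (f := fun z : ℝ => z) (measure_lt_top ν _)
      fun z hz => abs_le.mpr ⟨hz.1.le, hz.2⟩
  set a := ν.real {-L}
  set a' := ν.real {z | z ≤ -L}
  set p := ν.real (Set.Ioc (-L) L)
  set I := ∫ z in Set.Ioc (-L) L, z ∂ν
  have a0 : 0 ≤ a := measureReal_nonneg
  -- The algorithm averages over the closed interval, whereas the cells fill the half-open one. The
  -- atom at `-L` is the only source of difference.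
  have e : (a + p)⁻¹ * (a • -L + I) - p⁻¹ * I = -(a * (L * p + I)) / ((a + p) * p) := by
    have : a + p ≠ 0 := by positivity
    rw [smul_eq_mul]
    field_simp
    ring
  have hI' := abs_le.mp hI
  have hs : 0 ≤ L * p + I := by linarith
  rw [e, abs_div, abs_neg, abs_of_nonneg (by positivity),
    abs_of_pos (show (0 : ℝ) < (a + p) * p by positivity)]
  rw [div_le_div_iff₀ (by positivity) hp]
  calc a * (L * p + I) * p ≤ a' * (2 * L * p) * (a + p) := by
        have h1 : L * p + I ≤ 2 * L * p := by linarith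
        have h2 : p ≤ a + p := by linarith
        gcongr
    _ = _ := by ring

end Discretize

/-! ## Accuracy of the composed discretized losses -/

theorem deltaOf_mem_unit {ν : Measure ℝ} (h : ν Set.univ ≤ 1) (ε : ℝ) :
    0 ≤ deltaOf ν ε ∧ deltaOf ν ε ≤ 1 :=
  integral_mem_unit h (measurable_max_one_sub_exp ε) fun _ => max_one_sub_exp_mem _

theorem integral_indicator_one_real {Ω : Type*} [MeasurableSpace Ω] {μ : Measure Ω} {S : Set Ω}
    (hS : MeasurableSet S) : ∫ ω, S.indicator (fun _ => (1 : ℝ)) ω ∂μ = μ.real S := by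
  rw [integral_indicator hS, setIntegral_const, smul_eq_mul, mul_one]

/-- Comparison of curves of two random variables which are close up to a small bias and with a
small probability of failure, one of them taken modulo `2L`. -/
theorem deltaOf_compare {Ω : Type*} [MeasurableSpace Ω] {μ : Measure Ω} [IsProbabilityMeasure μ]
    {S : Measure ℝ} [IsProbabilityMeasure S] {U V : Ω → ℝ} (hU : Measurable U)
    (hV : Measurable V) {L e b B η ρ τ : ℝ} (hTV : TVLE S (μ.map U) η) (hB : |B| ≤ b)
    (hH : μ.real {ω | e ≤ |V ω - U ω - B|} ≤ ρ)
    (hS : S.real {y | L - e - b ≤ |y|} ≤ τ) (ε : ℝ) :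
    deltaOf ((μ.map V).map (circMod L)) (ε + e) ≤ deltaOf S ε + (τ + η + b + ρ) ∧
    deltaOf S ε ≤ deltaOf ((μ.map V).map (circMod L)) (ε - e) + (τ + η + b + ρ) := by
  have hb : 0 ≤ b := (abs_nonneg B).trans hB
  have mC := measurable_circMod L
  have mg := measurable_max_one_sub_exp
  set t := L - e - b with ht
  set H : Set Ω := {ω | e ≤ |V ω - U ω - B|} with hHdef
  set A : Set ℝ := {y | t ≤ |y|} with hA
  have mH : MeasurableSet H :=
    measurableSet_le measurable_const ((hV.sub hU).sub_const B).norm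
  have mA : MeasurableSet A := measurableSet_le measurable_const measurable_norm
  have eT : ∀ x, deltaOf ((μ.map V).map (circMod L)) x =
      ∫ ω, max (1 - Real.exp (x - circMod L (V ω))) 0 ∂μ := fun x => by
    rw [Measure.map_map mC hV]
    exact deltaOf_map μ (mC.comp hV) x
  have iT : ∀ x, Integrable (fun ω => max (1 - Real.exp (x - circMod L (V ω))) 0) μ := fun x =>
    integrable_of_mem_unit ((mg x).comp (mC.comp hV)) fun _ => max_one_sub_exp_mem _
  have iH : Integrable (fun ω => H.indicator (fun _ => (1 : ℝ)) ω) μ :=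
    (integrable_const (1 : ℝ)).indicator mH
  -- Off both exceptional sets `|V| < t + e + b = L`, so the reduction modulo `2L` is the identity.
  have good : ∀ ω, ω ∉ H → U ω ∉ A → circMod L (V ω) = V ω ∧ |V ω - U ω| ≤ e + b := by
    intro ω h1 h2
    have h1 : |V ω - U ω - B| < e := not_le.mp h1
    have h2 : |U ω| < t := not_le.mp h2
    rw [abs_lt] at h1 h2
    have h3 := abs_le.mp hB
    exact ⟨circMod_of_mem (by linarith) (by linarith), abs_le.mpr ⟨by linarith, by linarith⟩⟩
  have iA : Integrable (fun y => A.indicator (fun _ => (1 : ℝ)) y) S :=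
    (integrable_const (1 : ℝ)).indicator mA
  have m1 : Measurable fun y => A.indicator (fun _ => (1 : ℝ)) y := measurable_const.indicator mA
  have iS : Integrable (fun y => max (1 - Real.exp (ε - y)) 0) S :=
    integrable_of_mem_unit (mg ε) fun _ => max_one_sub_exp_mem _
  have ind01 : ∀ y, 0 ≤ A.indicator (fun _ => (1 : ℝ)) y ∧ A.indicator (fun _ => (1 : ℝ)) y ≤ 1 :=
    fun y => ⟨Set.indicator_nonneg (fun _ _ => zero_le_one) y,
      Set.indicator_le_self' (f := fun _ => (1 : ℝ)) (fun _ _ => zero_le_one) y⟩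
  have indH : ∀ ω, 0 ≤ H.indicator (fun _ => (1 : ℝ)) ω :=
    fun y => Set.indicator_nonneg (fun _ _ => zero_le_one) y
  constructor
  -- The value one on `A` covers any wrap-around. As `f` stays `[0, 1]`-valued, the total variation
  -- bound is used only once.
  · let f : ℝ → ℝ := fun y => max (max (1 - Real.exp (ε - y)) 0) (A.indicator (fun _ => (1 : ℝ)) y)
    have mf : Measurable f := (mg ε).max m1
    have f01 : ∀ y, 0 ≤ f y ∧ f y ≤ 1 := fun y =>
      ⟨le_max_of_le_left (max_one_sub_exp_mem _).1,
        max_le (max_one_sub_exp_mem _).2 (ind01 y).2⟩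
    have iU : Integrable (fun ω => f (U ω)) μ :=
      integrable_of_mem_unit (mf.comp hU) fun _ => f01 _
    have s1 : deltaOf ((μ.map V).map (circMod L)) (ε + e) ≤
        ∫ ω, (f (U ω) + b + H.indicator (fun _ => (1 : ℝ)) ω) ∂μ := by
      rw [eT]
      refine integral_mono (iT _) ((iU.add (integrable_const b)).add iH) fun ω => ?_
      dsimp only
      have hle : max (1 - Real.exp (ε + e - circMod L (V ω))) 0 ≤ 1 := (max_one_sub_exp_mem _).2
      by_cases h1 : ω ∈ H
      · rw [Set.indicator_of_mem h1]
        linarith [(f01 (U ω)).1]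
      by_cases h2 : U ω ∈ A
      · have : 1 ≤ f (U ω) := le_max_of_le_right (by rw [Set.indicator_of_mem h2])
        linarith [indH ω]
      obtain ⟨g1, g2⟩ := good ω h1 h2
      rw [g1]
      have g3 := abs_le.mp g2
      have := max_one_sub_exp_le (ε := ε) (ε' := ε + e) (u := U ω) (v := V ω) hb (by linarith)
      have h4 : max (1 - Real.exp (ε - U ω)) 0 ≤ f (U ω) := le_max_left _ _
      linarith [indH ω]
    have s2 : ∫ ω, (f (U ω) + b + H.indicator (fun _ => (1 : ℝ)) ω) ∂μ =
        ∫ y, f y ∂(μ.map U) + b + μ.real H := by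
      rw [integral_add (f := fun ω => f (U ω) + b) (iU.add (integrable_const b)) iH,
        integral_add iU (integrable_const b), integral_indicator_one_real mH,
        integral_map hU.aemeasurable mf.aestronglyMeasurable]
      simp
    have s3 := (abs_le.mp (hTV f mf f01)).1
    have s4 : ∫ y, f y ∂S ≤ deltaOf S ε + S.real A := by
      rw [deltaOf, ← integral_indicator_one_real mA, ← integral_add iS iA]
      refine integral_mono (integrable_of_mem_unit mf f01) (iS.add iA) fun y => ?_
      exact max_le (le_add_of_nonneg_right (ind01 y).1)
        (le_add_of_nonneg_left (max_one_sub_exp_mem _).1)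
    linarith
  -- For the opposite bound the hinge is dropped on `A`, where the reduced `V` gives no control.
  -- Restoring it costs the mass of `A` under `S`.
  · let f : ℝ → ℝ := fun y => Aᶜ.indicator (fun y => max (1 - Real.exp (ε - y)) 0) y
    have mf : Measurable f := (mg ε).indicator mA.compl
    have f01 : ∀ y, 0 ≤ f y ∧ f y ≤ 1 := fun y =>
      ⟨Set.indicator_nonneg (fun _ _ => (max_one_sub_exp_mem _).1) y,
        (Set.indicator_le_self' (f := fun y => max (1 - Real.exp (ε - y)) 0)
          (fun _ _ => (max_one_sub_exp_mem _).1) y).trans (max_one_sub_exp_mem _).2⟩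
    have iU : Integrable (fun ω => f (U ω)) μ :=
      integrable_of_mem_unit (mf.comp hU) fun _ => f01 _
    have s1 : ∫ ω, f (U ω) ∂μ ≤ ∫ ω, (max (1 - Real.exp (ε - e - circMod L (V ω))) 0 + b +
        H.indicator (fun _ => (1 : ℝ)) ω) ∂μ := by
      refine integral_mono iU (((iT _).add (integrable_const b)).add iH) fun ω => ?_
      dsimp only
      have hge : 0 ≤ max (1 - Real.exp (ε - e - circMod L (V ω))) 0 := (max_one_sub_exp_mem _).1
      by_cases h1 : ω ∈ H
      · rw [Set.indicator_of_mem h1]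
        linarith [(f01 (U ω)).2]
      by_cases h2 : U ω ∈ A
      · have : f (U ω) = 0 := Set.indicator_of_notMem (Set.notMem_compl_iff.mpr h2) _
        linarith [indH ω]
      obtain ⟨g1, g2⟩ := good ω h1 h2
      rw [g1]
      have g3 := abs_le.mp g2
      have := max_one_sub_exp_le (ε := ε - e) (ε' := ε) (u := V ω) (v := U ω) hb (by linarith)
      have h4 : f (U ω) = max (1 - Real.exp (ε - U ω)) 0 := Set.indicator_of_mem h2 _
      linarith [indH ω]
    have s2 : ∫ ω, (max (1 - Real.exp (ε - e - circMod L (V ω))) 0 + b +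
        H.indicator (fun _ => (1 : ℝ)) ω) ∂μ =
        deltaOf ((μ.map V).map (circMod L)) (ε - e) + b + μ.real H := by
      rw [integral_add (f := fun ω => max (1 - Real.exp (ε - e - circMod L (V ω))) 0 + b)
        ((iT _).add (integrable_const b)) iH,
        integral_add (iT _) (integrable_const b), integral_indicator_one_real mH, eT]
      simp
    have s3 := (abs_le.mp (hTV f mf f01)).2
    rw [integral_map hU.aemeasurable mf.aestronglyMeasurable] at s3
    have s4 : deltaOf S ε ≤ ∫ y, f y ∂S + S.real A := by
      have iF : Integrable f S := integrable_of_mem_unit mf f01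
      rw [deltaOf, ← integral_indicator_one_real mA, ← integral_add iF iA]
      refine integral_mono iS (iF.add iA) fun y => ?_
      dsimp only
      by_cases h2 : y ∈ A
      · rw [Set.indicator_of_mem h2]
        linarith [(f01 y).1, (max_one_sub_exp_mem (ε - y)).2]
      · have h4 : f y = max (1 - Real.exp (ε - y)) 0 := Set.indicator_of_mem h2 _
        rw [h4, Set.indicator_of_notMem h2, add_zero]
    linarith

theorem exp_neg_two_le : Real.exp (-2) ≤ 0.1354 := by
  have h1 := Real.exp_one_gt_d9
  have h2 : Real.exp 2 = Real.exp 1 * Real.exp 1 := by rw [← Real.exp_add]; norm_num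
  have h3 : (7.3875 : ℝ) ≤ Real.exp 2 := by rw [h2]; nlinarith
  rw [Real.exp_neg]
  refine (inv_anti₀ (by norm_num) h3).trans (by norm_num)

theorem exp_sub_two_le {b : ℝ} (hb : b ≤ 0.1) : Real.exp (b - 2) ≤ 0.1505 := by
  have h1 : Real.exp (b - 2) ≤ Real.exp (0.1 - 2) := Real.exp_le_exp.mpr (by linarith)
  have h2 : Real.exp (0.1 - 2) = Real.exp 0.1 * Real.exp (-2) := by
    rw [← Real.exp_add, sub_eq_add_neg]
  have h3 : Real.exp 0.1 ≤ 1 / 0.9 := by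
    have := Real.one_sub_le_exp_neg 0.1
    rw [Real.exp_neg] at this
    have h4 := inv_anti₀ (by norm_num) this
    rw [inv_inv] at h4
    refine h4.trans (by norm_num)
  have h5 := exp_neg_two_le
  have h6 := Real.exp_pos (-2)
  nlinarith

/-- The two tails are bounded by `d / (1 - x)` and `x d / (1 - x)`; the extra factor of the lower
one is `e^{-t} ≤ x`. -/
theorem IsLoss.abs_tail {Ω : Type*} [MeasurableSpace Ω] {P Q : Measure Ω}
    [IsProbabilityMeasure P] [IsProbabilityMeasure Q]
    {s : Ω → ℝ} (h : IsLoss P Q s) {ε t d x : ℝ} (h₁ : privacyCurve P Q ε ≤ d)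
    (h₂ : privacyCurve Q P ε ≤ d) (hx : Real.exp (ε - t) ≤ x) (hx' : Real.exp (-t) ≤ x)
    (hx1 : x < 1) : Q.real {ω | t ≤ |s ω|} ≤ (1 + x) / (1 - x) * d := by
  have d0 : 0 ≤ d := (privacyCurve_nonneg P Q ε).trans h₁
  obtain ⟨a1, a2⟩ := h.tail (t := t) h₁ h₂
  have a3 : Q.real {ω | t ≤ |s ω|} ≤ Q.real {ω | t ≤ s ω} + Q.real {ω | s ω ≤ -t} := by
    refine le_trans (measureReal_mono (fun ω hω => ?_) (measure_ne_top _ _))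
      (measureReal_union_le _ _)
    rcases le_abs.mp (show t ≤ |s ω| from hω) with h' | h'
    · exact Or.inl h'
    · exact Or.inr (show s ω ≤ -t by linarith)
  have b1 : (1 - x) * Q.real {ω | t ≤ s ω} ≤ d :=
    le_trans (mul_le_mul_of_nonneg_right (by linarith) measureReal_nonneg) a1
  have b2 : (1 - x) * Q.real {ω | s ω ≤ -t} ≤ x * d :=
    (le_trans (mul_le_mul_of_nonneg_right (by linarith) measureReal_nonneg) a2).trans
      (mul_le_mul_of_nonneg_right hx' d0)
  rw [div_mul_eq_mul_div, le_div_iff₀ (by linarith)]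
  nlinarith

/-- Truncation error and bias of the mean for one privacy loss. -/
theorem truncation_bounds {X Y : Measure EReal} [IsProbabilityMeasure X] [IsProbabilityMeasure Y]
    (h : IsLoss X Y EReal.toReal) (h₁ : Y {⊤} = 0) (h₂ : Y {⊥} = 0) {L d : ℝ} (hL : 2 ≤ L)
    (hd : d ≤ 1 / 8) (hc₁ : privacyCurve X Y (L - 2) ≤ d) (hc₂ : privacyCurve Y X (L - 2) ≤ d) :
    0 < (realLaw Y).real (Set.Ioc (-L) L) ∧
    1 - (realLaw Y).real (Set.Ioc (-L) L) ≤ 1.314 * d ∧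
    |truncMean Y L - ∫ z, z ∂((realLaw Y)[|Set.Ioc (-L) L])| ≤ 0.76 * d := by
  have d0 : 0 ≤ d := (privacyCurve_nonneg X Y _).trans hc₁
  have e2 := exp_neg_two_le
  have eL : Real.exp (L - 2 - L) = Real.exp (-2) := by congr 1; ring
  have eL2 : Real.exp (-L) ≤ 0.1354 := (Real.exp_le_exp.mpr (by linarith)).trans e2
  -- This gives the constant `(1 + 0.1354) / (1 - 0.1354) < 1.314`.
  have t1 := h.abs_tail hc₁ hc₂ (t := L) (x := 0.1354) (by rw [eL]; exact e2) eL2 (by norm_num)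
  have t2 := (h.tail hc₁ hc₂ (t := L)).2
  have m : ∀ S, MeasurableSet S → (realLaw Y).real S = Y.real (EReal.toReal ⁻¹' S) := fun S hS =>
    map_measureReal_apply measurable_ereal_toReal hS
  have c1 : 1 - (realLaw Y).real (Set.Ioc (-L) L) ≤ 1.314 * d := by
    rw [← probReal_compl_eq_one_sub measurableSet_Ioc, m _ measurableSet_Ioc.compl]
    have : Y.real (EReal.toReal ⁻¹' (Set.Ioc (-L) L)ᶜ) ≤ Y.real {ω | L ≤ |EReal.toReal ω|} := by
      refine measureReal_mono (fun ω hω => ?_) (measure_ne_top _ _)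
      have hω : ¬ (-L < ω.toReal ∧ ω.toReal ≤ L) := hω
      change L ≤ |ω.toReal|
      by_contra hlt
      have := abs_lt.mp (not_le.mp hlt)
      exact hω ⟨this.1, this.2.le⟩
    refine this.trans (t1.trans ?_)
    gcongr
    norm_num
  -- Here `d ≤ 1 / 8` enters: `1 - 1.314 / 8 > 0.8357`.
  have p0 : 0.8357 ≤ (realLaw Y).real (Set.Ioc (-L) L) := by linarith
  refine ⟨by linarith, c1, ?_⟩
  rw [truncMean_eq h₁ h₂]
  refine (abs_integral_cond_sub_le (by linarith) (by linarith)).trans ?_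
  rw [m {z | z ≤ -L} measurableSet_Iic, div_le_iff₀ (by linarith)]
  change 2 * L * Y.real {ω | ω.toReal ≤ -L} ≤ _
  rw [eL] at t2
  set a := Y.real {ω | ω.toReal ≤ -L}
  have a0 : 0 ≤ a := measureReal_nonneg
  -- The endpoint mass is multiplied by the length `2L`. The decay of the lower tail compensates,
  -- since `L e^{-L}` is largest at `L = 2` on the range `L ≥ 2`.
  have hLe : L * Real.exp (-L) ≤ 2 * Real.exp (-2) := by
    have : Real.exp (-2) = Real.exp (L - 2) * Real.exp (-L) := by
      rw [← Real.exp_add]; congr 1; ring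
    rw [this, ← mul_assoc]
    gcongr
    linarith [Real.add_one_le_exp (L - 2)]
  have a1 : 0.8646 * a ≤ Real.exp (-L) * d := le_trans (by nlinarith) t2
  have a2 : L * (0.8646 * a) ≤ 2 * 0.1354 * d := by
    calc L * (0.8646 * a) ≤ L * (Real.exp (-L) * d) := by gcongr
      _ = (L * Real.exp (-L)) * d := by ring
      _ ≤ (2 * Real.exp (-2)) * d := by gcongr
      _ ≤ _ := by gcongr
  -- The margin is `4 · 0.1354 / 0.8646 < 0.76 · 0.8357`.
  have a3 : 0.76 * d * 0.8357 ≤ 0.76 * d * (realLaw Y).real (Set.Ioc (-L) L) := by gcongr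
  linarith

/-- The mesh size is chosen to make the Hoeffding exponent equal to `-log (12 / δerr)`. -/
theorem hoeffding_mesh {k : ℕ} {εerr δerr h : ℝ} (hk : 0 < k) (hε : 0 < εerr) (hδ : 0 < δerr)
    (hδ' : δerr < 12) (hh : h = εerr / Real.sqrt ((k : ℝ) / 2 * Real.log (12 / δerr))) :
    0 < h ∧ 2 * Real.exp (-(2 * εerr ^ 2) / (k * h ^ 2)) = δerr / 6 := by
  have hlog : 0 < Real.log (12 / δerr) := Real.log_pos (by rw [lt_div_iff₀ hδ]; linarith)
  have hk' : (0 : ℝ) < k := by exact_mod_cast hk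
  have hpos : 0 < (k : ℝ) / 2 * Real.log (12 / δerr) := by positivity
  have hs := Real.sqrt_pos.mpr hpos
  refine ⟨by rw [hh]; positivity, ?_⟩
  have : -(2 * εerr ^ 2) / (k * h ^ 2) = -Real.log (12 / δerr) := by
    rw [hh, div_pow, Real.sq_sqrt hpos.le]
    field_simp
  rw [this, Real.exp_neg, Real.exp_log (by positivity)]
  field_simp
  norm_num

/-- The laws are compared through a coupling of truncated values with their roundings. Truncation,
bias, Hoeffding failure and wrap-around each take a share of `δerr`. -/
theorem deltaOf_composePRV {k : ℕ} {εerr δerr : ℝ} (hk : 0 < k) (hε : 0 < εerr) (hδ : 0 < δerr)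
    (hδ' : δerr < 12) {X Y : ℕ → Measure EReal} [∀ i, IsProbabilityMeasure (X i)]
    [∀ i, IsProbabilityMeasure (Y i)] {δ : ℕ → ℝ → ℝ}
    (hloss : ∀ i < k, IsLoss (X i) (Y i) EReal.toReal)
    (htop : ∀ i < k, Y i {⊤} = 0) (hbot : ∀ i < k, Y i {⊥} = 0)
    (hc₁ : ∀ i < k, ∀ ε, privacyCurve (X i) (Y i) ε = δ i ε)
    (hc₂ : ∀ i < k, ∀ ε, privacyCurve (Y i) (X i) ε = δ i ε)
    {n : ℕ} {h L : ℝ} (hh : h = εerr / Real.sqrt ((k : ℝ) / 2 * Real.log (12 / δerr)))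
    (hL : L = h / 2 + n * h) (hL2 : 2 + εerr ≤ L)
    (hsum : ∑ i ∈ Finset.range k, δ i (L - 2) ≤ δerr / 8)
    (hcomp : composedCurve X Y k (L - 2 - εerr) ≤ δerr / 4) (ε : ℝ) :
    deltaOf (composePRV Y k L n h) (ε + εerr) - δerr
        ≤ deltaOf (sumLaw (fun i => realLaw (Y i)) k) ε ∧
      deltaOf (sumLaw (fun i => realLaw (Y i)) k) ε
        ≤ deltaOf (composePRV Y k L n h) (ε - εerr) + δerr := by
  obtain ⟨h0, hexp⟩ := hoeffding_mesh hk hε hδ hδ' hh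
  have L0 : 0 < L := by linarith
  have hmass : ∀ i < k, discretizePRV (Y i) L n h Set.univ ≤ 1 := fun i _ =>
    discretizePRV_univ_le h0 L n
  have hcirc : composePRV Y k L n h = (sumLaw (fun i => discretizePRV (Y i) L n h) k).map
      (circMod L) := circSumLaw_eq_map L0 _ k hmass
  have hprobS : IsProbabilityMeasure (sumLaw (fun i => realLaw (Y i)) k) :=
    isProbabilityMeasure_sumLaw _ k fun i _ => inferInstance
  rcases le_or_gt 1 δerr with hbig | hsmall
  -- For `δerr ≥ 1` nothing is to be shown, as both curves take values in `[0, 1]`. Below, `δerr <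
  -- 1` makes the numerical tail bounds available.
  · have u1 : composePRV Y k L n h Set.univ ≤ 1 := by
      rw [hcirc, Measure.map_apply (measurable_circMod L) MeasurableSet.univ]
      exact sumLaw_univ_le _ k hmass
    have u2 : sumLaw (fun i => realLaw (Y i)) k Set.univ ≤ 1 := prob_le_one
    have v1 := deltaOf_mem_unit u1
    have v2 := deltaOf_mem_unit u2 ε
    constructor
    · linarith [(v1 (ε + εerr)).2]
    · linarith [(v1 (ε - εerr)).1]
  set A : Set ℝ := Set.Ioc (-L) L with hA
  have d0 : ∀ i < k, 0 ≤ δ i (L - 2) := fun i hi => by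
    rw [← hc₁ i hi]; exact privacyCurve_nonneg _ _ _
  have dle : ∀ i < k, δ i (L - 2) ≤ 1 / 8 := fun i hi => by
    have := Finset.single_le_sum (f := fun i => δ i (L - 2))
      (fun j hj => d0 j (Finset.mem_range.mp hj)) (Finset.mem_range.mpr hi)
    linarith
  have tb := fun i hi => truncation_bounds (hloss i hi) (htop i hi) (hbot i hi)
    (L := L) (by linarith) (dle i hi) (hc₁ i hi _).le (hc₂ i hi _).le
  -- the conditioned laws and their product
  let ξ : ℕ → Measure ℝ := fun i => if i < k then (realLaw (Y i))[|A] else Measure.dirac 0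
  have hξ : ∀ i < k, ξ i = (realLaw (Y i))[|A] := fun i hi => if_pos hi
  have hξp : ∀ i, IsProbabilityMeasure (ξ i) := by
    intro i
    by_cases hi : i < k
    · rw [hξ i hi]
      refine cond_isProbabilityMeasure fun h0 => ?_
      have := (tb i hi).1
      rw [measureReal_def, h0, ENNReal.toReal_zero] at this
      exact lt_irrefl _ this
    -- Beyond the first `k` factors a filler law makes the infinite product meaningful.
    · have : ξ i = Measure.dirac 0 := if_neg hi
      rw [this]
      infer_instance
  -- The coupling: `ω i` is the truncated loss and `D i (ω i)` its discretization, so the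
  -- displacement `shift - W (ω i)` is bounded and independent in `i`.
  let μ := Measure.infinitePi ξ
  have hev : ∀ i, μ.map (fun ω => ω i) = ξ i := fun i => Measure.infinitePi_map_eval ξ i
  let D : ℕ → ℝ → ℝ := fun i z => roundIdx h z * h + shift (Y i) L n h
  let W : ℝ → ℝ := fun z => z - roundIdx h z * h
  have mR := measurable_roundIdx h
  have mD : ∀ i, Measurable (D i) := fun i => by fun_prop
  have mW : Measurable W := by fun_prop
  have lawU : sumLaw ξ k = μ.map fun ω => ∑ i ∈ Finset.range k, ω i := by
    rw [← sumLaw_eq_map_sum (μ := μ) (Z := fun i ω => ω i) (fun i => measurable_pi_apply i)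
      (iIndepFun_infinitePi fun i => measurable_id)]
    simp_rw [hev]
  have lawV : sumLaw (fun i => discretizePRV (Y i) L n h) k =
      μ.map fun ω => ∑ i ∈ Finset.range k, D i (ω i) := by
    rw [← sumLaw_eq_map_sum (μ := μ) (Z := fun i ω => D i (ω i))
      (fun i => (mD i).comp (measurable_pi_apply i)) (iIndepFun_infinitePi mD)]
    refine sumLaw_congr k fun i hi => ?_
    have e1 : μ.map (fun ω => D i (ω i)) = (ξ i).map (D i) := by
      rw [← hev i, Measure.map_map (mD i) (measurable_pi_apply i)]
      rfl
    have tp := (tb i hi).1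
    rw [hL] at tp
    rw [e1, hξ i hi, hA, hL, discretizePRV,
      sum_weight_dirac_eq_map (htop i hi) (hbot i hi) h0 n tp]
    simp only [D, hL]
  have hTV : TVLE (sumLaw (fun i => realLaw (Y i)) k)
      (μ.map fun ω => ∑ i ∈ Finset.range k, ω i)
      (∑ i ∈ Finset.range k, (1 - (realLaw (Y i)).real A)) := by
    rw [← lawU]
    refine TVLE.sumLaw k (fun i _ => inferInstance) (fun i _ => hξp i) fun i hi => ?_
    rw [hξ i hi]
    exact tvle_cond measurableSet_Ioc (tb i hi).1
  -- the bias of the means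
  let β : ℕ → ℝ := fun i => truncMean (Y i) L - ∫ z, z ∂(ξ i)
  let B := ∑ i ∈ Finset.range k, β i
  have hB : |B| ≤ 0.1 * δerr := by
    calc |B| ≤ ∑ i ∈ Finset.range k, |β i| := Finset.abs_sum_le_sum_abs _ _
      _ ≤ ∑ i ∈ Finset.range k, 0.76 * δ i (L - 2) := Finset.sum_le_sum fun i hi => by
          have hi := Finset.mem_range.mp hi
          have := (tb i hi).2.2
          simp only [β, hξ i hi]
          exact this
      _ = 0.76 * ∑ i ∈ Finset.range k, δ i (L - 2) := (Finset.mul_sum _ _ _).symm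
      _ ≤ _ := by linarith
  -- The shift is the truncated mean minus the mean of the rounded value. It therefore equals the
  -- mean rounding error plus the bias `β i`, and `V - U - B` becomes minus the centred sum of the
  -- errors `W (ω i)`.
  have hEW : ∀ i < k, ∫ ω, W (ω i) ∂μ = shift (Y i) L n h - β i := by
    intro i hi
    have tp := (tb i hi).1
    rw [hL] at tp
    have e1 : ∫ ω, W (ω i) ∂μ = ∫ z, W z ∂(ξ i) := by
      rw [← hev i, integral_map (measurable_pi_apply i).aemeasurable mW.aestronglyMeasurable]
    have iz : Integrable (fun z : ℝ => z) (ξ i) := by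
      refine Integrable.of_bound (by fun_prop) L ?_
      have : ∀ᵐ z ∂(ξ i), z ∈ A := by
        rw [hξ i hi]
        exact ae_cond_mem measurableSet_Ioc
      filter_upwards [this] with z hz
      exact abs_le.mpr ⟨hz.1.le, hz.2⟩
    have iW : Integrable W (ξ i) := Integrable.of_bound mW.aestronglyMeasurable (h / 2)
      (Filter.Eventually.of_forall fun z => abs_le.mpr (sub_roundIdx_mem h0 z))
    have e2 : ∫ z, (roundIdx h z : ℝ) * h ∂(ξ i) = ∫ z, z ∂(ξ i) - ∫ z, W z ∂(ξ i) := by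
      rw [← integral_sub iz iW]
      congr 1
      funext z
      simp only [W]
      ring
    have e3 := integral_roundIdx (htop i hi) (hbot i hi) h0 n tp
    rw [← hL, ← hA, ← hξ i hi, e2] at e3
    rw [e1]
    simp only [β, shift]
    linarith
  have hH : μ.real {ω | εerr ≤ |∑ i ∈ Finset.range k, D i (ω i) - ∑ i ∈ Finset.range k, ω i - B|}
      ≤ δerr / 6 := by
    have := hoeffding_abs (μ := μ) (W := fun i ω => W (ω i))
      (fun i => mW.comp (measurable_pi_apply i)) (iIndepFun_infinitePi fun _ => mW) (k := k) h0
      (fun i _ ω => sub_roundIdx_mem h0 (ω i)) hε.le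
    rw [hexp] at this
    refine le_trans (le_of_eq ?_) this
    congr 1
    ext ω
    have : ∑ i ∈ Finset.range k, D i (ω i) - ∑ i ∈ Finset.range k, ω i - B =
        -∑ i ∈ Finset.range k, (W (ω i) - ∫ ω', W (ω' i) ∂μ) := by
      rw [← Finset.sum_neg_distrib, ← Finset.sum_sub_distrib, ← Finset.sum_sub_distrib]
      refine Finset.sum_congr rfl fun i hi => ?_
      rw [hEW i (Finset.mem_range.mp hi)]
      simp only [D, W]
      ring
    rw [Set.mem_ofPred_eq, Set.mem_ofPred_eq, this, abs_neg]
  -- The curve at `L - 2 - εerr` controls the tail from `L - εerr - 0.1 δerr` on. The gap is nearly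
  -- 2, and `(1 + 0.1505) / (1 - 0.1505) < 1.3545`.
  have hS : (sumLaw (fun i => realLaw (Y i)) k).real {y | L - εerr - 0.1 * δerr ≤ |y|} ≤
      1.3545 * (δerr / 4) := by
    rw [sumLaw_realLaw, map_measureReal_apply (measurable_histSum k)
      (show MeasurableSet {y : ℝ | L - εerr - 0.1 * δerr ≤ |y|} from
        measurableSet_le measurable_const measurable_norm)]
    have hx : Real.exp (0.1 * δerr - 2) ≤ 0.1505 := exp_sub_two_le (by linarith)
    have := (isLoss_prodLaw X Y k hloss).abs_tail (ε := L - 2 - εerr)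
      (t := L - εerr - 0.1 * δerr) (d := δerr / 4) (x := 0.1505) hcomp
      ((composedCurve_comm_le X Y (fun i hi ε => by rw [hc₁ i hi, hc₂ i hi]) _).trans hcomp)
      (by rw [show L - 2 - εerr - (L - εerr - 0.1 * δerr) = 0.1 * δerr - 2 by ring]; exact hx)
      ((Real.exp_le_exp.mpr (by linarith)).trans hx) (by norm_num)
    refine this.trans ?_
    gcongr
    norm_num
  have key := deltaOf_compare (μ := μ) (S := sumLaw (fun i => realLaw (Y i)) k)
    (U := fun ω => ∑ i ∈ Finset.range k, ω i) (V := fun ω => ∑ i ∈ Finset.range k, D i (ω i))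
    (Finset.measurable_sum _ fun i _ => measurable_pi_apply i)
    (Finset.measurable_sum _ fun i _ => (mD i).comp (measurable_pi_apply i))
    hTV hB hH hS ε
  rw [← lawV, ← hcirc] at key
  have hη : ∑ i ∈ Finset.range k, (1 - (realLaw (Y i)).real A) ≤ 1.314 * (δerr / 8) := by
    calc _ ≤ ∑ i ∈ Finset.range k, 1.314 * δ i (L - 2) := Finset.sum_le_sum fun i hi =>
          (tb i (Finset.mem_range.mp hi)).2.1
      _ = 1.314 * ∑ i ∈ Finset.range k, δ i (L - 2) := (Finset.mul_sum _ _ _).symm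
      _ ≤ _ := by linarith
  -- The shares `1.3545 / 4`, `1.314 / 8`, `0.1` and `1 / 6` of `δerr` add up to less than `0.77`.
  constructor
  · linarith [key.1]
  · linarith [key.2]

/-! ## Reasoning about programs -/

section Programs

variable {O : Oracle}

/-- The final memory. -/
def Program.exec (O : Oracle) (p : Program) (s : Memory) : Memory := (p.run O s).1

/-- The number of steps. -/
def Program.steps (O : Oracle) (p : Program) (s : Memory) : ℕ := (p.run O s).2

/-- The memory after `x` rounds of a loop. -/
def loopState (O : Oracle) (a : ℕ) (p : Program) (s : Memory) : ℕ → Memory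
  | 0 => s
  | x + 1 => p.exec O ((loopState O a p s x).putInt a 0 x)

theorem run_loop (a : ℕ) (e : IntExpr) (p : Program) (s : Memory) :
    (Program.loop a e p).run O s = (loopState O a p s (e.eval s).toNat,
      e.cost + 1 + ∑ x ∈ Finset.range (e.eval s).toNat,
        (p.steps O ((loopState O a p s x).putInt a 0 x) + 1)) := by
  rw [Program.run]
  generalize (e.eval s).toNat = m
  induction m with
  | zero => simp [loopState]
  | succ m ih =>
    dsimp only at ih ⊢
    rw [ih, Finset.sum_range_succ]
    refine Prod.ext rfl ?_
    simp only [Program.steps]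
    ring

/-- The integer arrays a program may write to. -/
def Program.intVars : Program → List ℕ
  | setInt a _ _ => [a]
  | setNum _ _ _ => []
  | setFloor a _ _ => [a]
  | seq p q => p.intVars ++ q.intVars
  | ite _ _ p q => p.intVars ++ q.intVars
  | loop a _ p => a :: p.intVars

/-- The numerical arrays a program may write to. -/
def Program.numVars : Program → List ℕ
  | setInt _ _ _ => []
  | setNum a _ _ => [a]
  | setFloor _ _ _ => []
  | seq p q => p.numVars ++ q.numVars
  | ite _ _ p q => p.numVars ++ q.numVars
  | loop _ _ p => p.numVars

/-- The memories agree outside of the listed arrays. -/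
structure Frame (I J : List ℕ) (s s' : Memory) : Prop where
  int : ∀ a ∉ I, s'.int a = s.int a
  num : ∀ a ∉ J, s'.num a = s.num a

/-- Membership in a concrete list of arrays is decided by evaluation in the default argument, so
that in use the number of the array suffices. -/
theorem Frame.intEq {I J : List ℕ} {s s' : Memory} (h : Frame I J s s') (a : ℕ)
    (ha : I.elem a = false := by rfl) : s'.int a = s.int a :=
  h.int a fun h' => by rw [List.elem_eq_true_of_mem h'] at ha; exact Bool.noConfusion ha

theorem Frame.numEq {I J : List ℕ} {s s' : Memory} (h : Frame I J s s') (a : ℕ)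
    (ha : J.elem a = false := by rfl) : s'.num a = s.num a :=
  h.num a fun h' => by rw [List.elem_eq_true_of_mem h'] at ha; exact Bool.noConfusion ha

theorem Frame.refl (I J : List ℕ) (s : Memory) : Frame I J s s := ⟨fun _ _ => rfl, fun _ _ => rfl⟩

theorem Frame.trans {I J : List ℕ} {s s' s'' : Memory} (h : Frame I J s s')
    (h' : Frame I J s' s'') : Frame I J s s'' :=
  ⟨fun a ha => (h'.int a ha).trans (h.int a ha), fun a ha => (h'.num a ha).trans (h.num a ha)⟩

theorem Frame.mono {I J I' J' : List ℕ} {s s' : Memory} (h : Frame I J s s')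
    (hI : I ⊆ I') (hJ : J ⊆ J') : Frame I' J' s s' :=
  ⟨fun a ha => h.int a fun h' => ha (hI h'), fun a ha => h.num a fun h' => ha (hJ h')⟩

theorem Frame.putInt (s : Memory) (a : ℕ) (i x : ℤ) {I J : List ℕ} (h : a ∈ I) :
    Frame I J s (s.putInt a i x) :=
  ⟨fun _ hb => Function.update_of_ne (by rintro rfl; exact hb h) _ _, fun _ _ => rfl⟩

theorem Frame.putNum (s : Memory) (a : ℕ) (i : ℤ) (x : ℂ) {I J : List ℕ} (h : a ∈ J) :
    Frame I J s (s.putNum a i x) :=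
  ⟨fun _ _ => rfl, fun _ hb => Function.update_of_ne (by rintro rfl; exact hb h) _ _⟩

/-- A program only touches the arrays it names syntactically. This spares listing all unchanged data
in every specification. -/
theorem Program.frame (p : Program) (s : Memory) :
    Frame p.intVars p.numVars s (p.exec O s) := by
  induction p generalizing s with
  | setInt a i e => exact Frame.putInt _ _ _ _ (List.mem_singleton.mpr rfl)
  | setNum a i e => exact Frame.putNum _ _ _ _ (List.mem_singleton.mpr rfl)
  | setFloor a i e => exact Frame.putInt _ _ _ _ (List.mem_singleton.mpr rfl)
  | seq p q ihp ihq =>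
    exact ((ihp s).mono (List.subset_append_left _ _) (List.subset_append_left _ _)).trans
      ((ihq _).mono (List.subset_append_right _ _) (List.subset_append_right _ _))
  | ite e f p q ihp ihq =>
    rw [Program.exec, Program.run]
    dsimp only
    split_ifs
    · exact (ihp s).mono (List.subset_append_left _ _) (List.subset_append_left _ _)
    · exact (ihq s).mono (List.subset_append_right _ _) (List.subset_append_right _ _)
  | loop a e p ih =>
    rw [Program.exec, run_loop]
    dsimp only
    generalize (e.eval s).toNat = m
    induction m with
    | zero => exact Frame.refl _ _ _
    | succ m ihm =>
      refine ihm.trans ((Frame.putInt _ a 0 m List.mem_cons_self).trans ?_)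
      exact (ih _).mono (List.subset_cons_self _ _) (List.Subset.refl _)

/-- Running `p` from `s` satisfies `Q` and takes at most `c` steps. -/
def Spec (O : Oracle) (p : Program) (s : Memory) (Q : Memory → Prop) (c : ℕ) : Prop :=
  Q (p.exec O s) ∧ p.steps O s ≤ c

/-- The second program receives the frame of the first along with `Q`; facts about untouched arrays
need not be part of `Q`. -/
theorem Spec.seq {p q : Program} {s : Memory} {Q R : Memory → Prop} {c d : ℕ}
    (h : Spec O p s Q c) (h' : ∀ s', Frame p.intVars p.numVars s s' → Q s' → Spec O q s' R d) :
    Spec O (Program.seq p q) s R (c + d) := by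
  have := h' _ (p.frame s) h.1
  exact ⟨this.1, Nat.add_le_add h.2 this.2⟩

theorem Spec.mono {p : Program} {s : Memory} {Q R : Memory → Prop} {c d : ℕ}
    (h : Spec O p s Q c) (h' : ∀ s', Frame p.intVars p.numVars s s' → Q s' → R s') (hc : c ≤ d) :
    Spec O p s R d :=
  ⟨h' _ (p.frame s) h.1, h.2.trans hc⟩

/-- Invariant rule. The body runs after the counter is written, so the step starts from the updated
memory, and the additional unit per round pays for the counter. -/
theorem Spec.loop {a : ℕ} {e : IntExpr} {p : Program} {s : Memory} (P : ℕ → Memory → Prop) {n : ℕ}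
    (hn : e.eval s = n) (c : ℕ) (h0 : P 0 s)
    (hs : ∀ x < n, ∀ s', Frame (a :: p.intVars) p.numVars s s' → P x s' →
      Spec O p (s'.putInt a 0 x) (P (x + 1)) c) :
    Spec O (Program.loop a e p) s (P n) (e.cost + 1 + n * (c + 1)) := by
  have key : ∀ x ≤ n, Frame (a :: p.intVars) p.numVars s (loopState O a p s x) ∧
      P x (loopState O a p s x) := by
    intro x
    induction x with
    | zero => exact fun _ => ⟨Frame.refl _ _ _, h0⟩
    | succ x ih =>
      intro hx
      obtain ⟨h1, h2⟩ := ih (by omega)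
      refine ⟨h1.trans ((Frame.putInt _ a 0 x List.mem_cons_self).trans
        ((p.frame _).mono (List.subset_cons_self _ _) (List.Subset.refl _))),
        (hs x (by omega) _ h1 h2).1⟩
  have e1 : (Program.loop a e p).run O s = _ := run_loop a e p s
  rw [hn, Int.toNat_natCast] at e1
  refine ⟨?_, ?_⟩
  · rw [Program.exec, e1]
    exact (key n le_rfl).2
  · rw [Program.steps, e1]
    dsimp only
    have : ∑ x ∈ Finset.range n, (p.steps O ((loopState O a p s x).putInt a 0 x) + 1) ≤
        ∑ _x ∈ Finset.range n, (c + 1) := Finset.sum_le_sum fun x hx => by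
      have hx := Finset.mem_range.mp hx
      obtain ⟨h1, h2⟩ := key x hx.le
      exact Nat.add_le_add_right (hs x hx _ h1 h2).2 1
    rw [Finset.sum_const, Finset.card_range, smul_eq_mul] at this
    omega

@[simp] theorem int_putInt_same (s : Memory) (a : ℕ) (i x : ℤ) :
    (s.putInt a i x).int a i = x := by
  simp [Memory.putInt]

@[simp] theorem int_putInt_ne (s : Memory) {a b : ℕ} (h : b ≠ a) (i x : ℤ) :
    (s.putInt a i x).int b = s.int b := by
  simp [Memory.putInt, h]

@[simp] theorem num_putInt (s : Memory) (a : ℕ) (i x : ℤ) : (s.putInt a i x).num = s.num := rfl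

@[simp] theorem num_putNum_same (s : Memory) (a : ℕ) (i : ℤ) (x : ℂ) :
    (s.putNum a i x).num a i = x := by
  simp [Memory.putNum]

theorem num_putNum_idx (s : Memory) (a : ℕ) {i j : ℤ} (h : j ≠ i) (x : ℂ) :
    (s.putNum a i x).num a j = s.num a j := by
  simp [Memory.putNum, h]

@[simp] theorem num_putNum_ne (s : Memory) {a b : ℕ} (h : b ≠ a) (i : ℤ) (x : ℂ) :
    (s.putNum a i x).num b = s.num b := by
  simp [Memory.putNum, h]

theorem Spec.setInt {a : ℕ} {i e : IntExpr} {s : Memory} {Q : Memory → Prop}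
    (h : Q (s.putInt a (i.eval s) (e.eval s))) :
    Spec O (.setInt a i e) s Q (i.cost + e.cost + 1) := ⟨h, le_rfl⟩

theorem Spec.setNum {a : ℕ} {i : IntExpr} {e : NumExpr} {s : Memory} {Q : Memory → Prop}
    (h : Q (s.putNum a (i.eval s) (e.eval O s))) :
    Spec O (.setNum a i e) s Q (i.cost + e.cost + 1) := ⟨h, le_rfl⟩

theorem Spec.setFloor {a : ℕ} {i : IntExpr} {e : NumExpr} {s : Memory} {Q : Memory → Prop}
    (h : Q (s.putInt a (i.eval s) ⌊(e.eval O s).re⌋)) :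
    Spec O (.setFloor a i e) s Q (i.cost + e.cost + 1) := ⟨h, le_rfl⟩

/-- The scalar variable kept in entry `0` of the integer array `a`. -/
abbrev IntExpr.var (a : ℕ) : IntExpr := .get a (.const 0)

/-- For `x < e`, set entry `x` of the numerical array `A` to the value of `f`; the counter is
kept in `v`. -/
abbrev fill (v : ℕ) (e : IntExpr) (A : ℕ) (f : NumExpr) : Program :=
  .loop v e (.setNum A (.var v) f)

/-- In round `x` the entries from `x` on are known to be still the old ones, which permits updating
an array in place. -/
theorem Spec.fill {v : ℕ} {e : IntExpr} {A : ℕ} {f : NumExpr} {s : Memory} {n : ℕ}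
    (hn : e.eval s = n) (g : ℕ → ℂ)
    (h : ∀ x < n, ∀ s', Frame [v] [A] s s' → s'.int v 0 = x →
      (∀ i : ℕ, x ≤ i → s'.num A i = s.num A i) → f.eval O s' = g x) :
    Spec O (DPCompose.fill v e A f) s
      (fun s' => (∀ i < n, s'.num A (i : ℤ) = g i) ∧
        ∀ i : ℕ, n ≤ i → s'.num A (i : ℤ) = s.num A i)
      (e.cost + 1 + n * (f.cost + 4)) := by
  refine (Spec.loop (O := O) (p := .setNum A (.var v) f)
    (fun x s' => (∀ i < x, s'.num A (i : ℤ) = g i) ∧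
      ∀ i : ℕ, x ≤ i → s'.num A (i : ℤ) = s.num A i) hn (f.cost + 3) ?_ ?_).mono
    (fun _ _ h => h) (le_of_eq (by ring))
  · exact ⟨fun i hi => absurd hi (Nat.not_lt_zero i), fun _ _ => rfl⟩
  · rintro x hx s' hF ⟨h1, h2⟩
    have hfr : Frame [v] [A] s (s'.putInt v 0 x) :=
      hF.trans (Frame.putInt _ _ _ _ (List.mem_singleton.mpr rfl))
    have hval := h x hx (s'.putInt v 0 x) hfr (int_putInt_same _ _ _ _)
      (fun i hi => by rw [num_putInt]; exact h2 i hi)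
    refine (Spec.setNum (O := O) (Q := fun s'' => (∀ i < x + 1, s''.num A (i : ℤ) = g i) ∧
      ∀ i : ℕ, x + 1 ≤ i → s''.num A (i : ℤ) = s.num A i) ?_).mono (fun _ _ h => h)
      (le_of_eq ?_)
    · have hidx : (IntExpr.var v).eval (s'.putInt v 0 x) = x := int_putInt_same _ _ _ _
      rw [hidx, hval]
      constructor
      · intro i hi
        rcases Nat.lt_succ_iff_lt_or_eq.mp hi with hi | rfl
        · rw [num_putNum_idx _ _ (by exact_mod_cast hi.ne), num_putInt]
          exact h1 i hi
        · exact num_putNum_same _ _ _ _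
      · intro i hi
        rw [num_putNum_idx _ _ (by exact_mod_cast (show i ≠ x by omega)), num_putInt]
        exact h2 i (by omega)
    · simp [IntExpr.cost]; ring

/-- Add the values of `f` for `x < e` to the scalar kept in entry `0` of the numerical
array `A`. -/
abbrev accum (v : ℕ) (e : IntExpr) (A : ℕ) (f : NumExpr) : Program :=
  .seq (.setNum A (.const 0) (.const 0))
    (.loop v e (.setNum A (.const 0) (.add (.get A (.const 0)) f)))

theorem Spec.accum {v : ℕ} {e : IntExpr} {A : ℕ} {f : NumExpr} {s : Memory} {n : ℕ}
    (hn : ∀ s', Frame [v] [A] s s' → e.eval s' = n) (g : ℕ → ℂ)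
    (h : ∀ x < n, ∀ s', Frame [v] [A] s s' → s'.int v 0 = x → f.eval O s' = g x) :
    Spec O (DPCompose.accum v e A f) s
      (fun s' => s'.num A 0 = ∑ x ∈ Finset.range n, g x)
      (e.cost + 4 + n * (f.cost + 6)) := by
  refine (Spec.seq (O := O) (Q := fun s' => s'.num A 0 = 0) (Spec.setNum ?_) (d := e.cost + 1 +
      n * (f.cost + 5 + 1)) ?_).mono
    (fun _ _ h => h) (le_of_eq (by simp [IntExpr.cost, NumExpr.cost]; ring))
  · simp [NumExpr.eval, IntExpr.eval]
  · intro s₁ hF₁ h₁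
    have hF₁ : Frame [v] [A] s s₁ := hF₁.mono (List.nil_subset _) (List.Subset.refl _)
    refine Spec.loop (fun x s' => s'.num A 0 = ∑ x ∈ Finset.range x, g x) (hn _ hF₁) _
      (by simpa using h₁) ?_
    intro x hx s' hF hs'
    have hfr : Frame [v] [A] s (s'.putInt v 0 x) :=
      hF₁.trans (hF.trans (Frame.putInt _ _ _ _ (List.mem_singleton.mpr rfl)))
    refine (Spec.setNum ?_).mono (fun _ _ h => h) (le_of_eq ?_)
    · rw [IntExpr.eval, num_putNum_same, NumExpr.eval,
        h x hx (s'.putInt v 0 x) hfr (int_putInt_same _ _ _ _), Finset.sum_range_succ, ← hs']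
      rfl
    · simp [IntExpr.cost, NumExpr.cost]; ring

end Programs

/-! ## Discrete Fourier transforms -/

/-- `e^{2πix}`. -/
def ec (x : ℂ) : ℂ := Complex.exp (2 * Real.pi * Complex.I * x)

theorem ec_add (x y : ℂ) : ec (x + y) = ec x * ec y := by
  rw [ec, mul_add, Complex.exp_add]; rfl

theorem ec_int (m : ℤ) : ec m = 1 := by
  rw [ec, mul_comm]
  exact Complex.exp_int_mul_two_pi_mul_I m

theorem ec_zero : ec 0 = 1 := by simp [ec]

theorem ec_add_int (x : ℂ) (m : ℤ) : ec (x + m) = ec x := by rw [ec_add, ec_int, mul_one]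

theorem ec_nat_mul (m : ℕ) (x : ℂ) : ec (m * x) = ec x ^ m := by
  rw [ec, ec, ← Complex.exp_nat_mul]
  congr 1
  ring

theorem ec_eq_one_iff (x : ℂ) : ec x = 1 ↔ ∃ m : ℤ, x = m := by
  rw [ec, Complex.exp_eq_one_iff]
  refine exists_congr fun m => ?_
  rw [mul_comm]
  exact mul_left_inj' Complex.two_pi_I_ne_zero

/-- Orthogonality of characters: a geometric series of an `M`-th root of unity, trivial exactly when
`M` divides `d`. -/
theorem sum_ec {M : ℕ} (hM : 0 < M) (d : ℤ) :
    ∑ p ∈ Finset.range M, ec (d * p / M) = if (M : ℤ) ∣ d then (M : ℂ) else 0 := by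
  have hM' : (M : ℂ) ≠ 0 := by exact_mod_cast hM.ne'
  have e : ∀ p : ℕ, ec (d * p / M) = ec (d / M) ^ p := fun p => by
    rw [← ec_nat_mul]; congr 1; ring
  simp_rw [e]
  split_ifs with h
  · obtain ⟨m, rfl⟩ := h
    have : ec (((M : ℤ) * m : ℤ) / M) = 1 := by
      rw [← ec_int m]
      congr 1
      push_cast
      field_simp
    simp only [this, one_pow, Finset.sum_const, Finset.card_range, nsmul_eq_mul, mul_one]
  · have h1 : ec (d / M) ≠ 1 := by
      rw [Ne, ec_eq_one_iff]
      rintro ⟨m, hm⟩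
      rw [div_eq_iff hM'] at hm
      exact h ⟨m, by rw [mul_comm]; exact_mod_cast hm⟩
    rw [geom_sum_eq h1, ← ec_nat_mul, mul_div_cancel₀ _ hM', ec_int, sub_self, zero_div]

theorem sum_range_two_mul (f : ℕ → ℂ) (n : ℕ) :
    ∑ t ∈ Finset.range (2 * n), f t = ∑ u ∈ Finset.range n, (f (2 * u) + f (2 * u + 1)) := by
  induction n with
  | zero => simp
  | succ n ih =>
    rw [show 2 * (n + 1) = 2 * n + 1 + 1 by ring, Finset.sum_range_succ, Finset.sum_range_succ,
      ih, Finset.sum_range_succ]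
    ring

/-- The discrete Fourier transforms of length `P` of the subsequences of `x` of stride `H`. -/
def partialDFT (x : ℕ → ℂ) (σ : ℤ) (H P i : ℕ) : ℂ :=
  ∑ t ∈ Finset.range P, x (i % H + H * t) * ec (σ * (t * (i / H : ℕ)) / P)

/-- Cooley–Tukey butterfly: even and odd `t` form subsequences of doubled stride. Position `i`
encodes the residue `i % H` of the subsequence and the frequency `i / H`. -/
theorem partialDFT_double (x : ℕ → ℂ) (σ : ℤ) {H P : ℕ} (hH : 0 < H) (hP : 0 < P) (i : ℕ) :
    partialDFT x σ H (2 * P) i =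
      partialDFT x σ (2 * H) P (i % H + 2 * H * (i / H % P)) +
      ec (σ * (i / H : ℕ) / (2 * P)) *
        partialDFT x σ (2 * H) P (i % H + 2 * H * (i / H % P) + H) := by
  have hP' : (P : ℂ) ≠ 0 := by exact_mod_cast hP.ne'
  have ha : i % H < H := Nat.mod_lt _ hH
  set a := i % H
  set p := i / H
  have hp : (p : ℂ) = P * (p / P : ℕ) + (p % P : ℕ) := by exact_mod_cast (Nat.div_add_mod p P).symm
  generalize p / P = q at hp
  have m1 : (a + 2 * H * (p % P)) % (2 * H) = a := by
    rw [Nat.add_mul_mod_self_left, Nat.mod_eq_of_lt (by omega)]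
  have m2 : (a + 2 * H * (p % P) + H) % (2 * H) = a + H := by
    rw [add_right_comm, Nat.add_mul_mod_self_left, Nat.mod_eq_of_lt (by omega)]
  have d1 : (a + 2 * H * (p % P)) / (2 * H) = p % P := by
    rw [Nat.add_mul_div_left _ _ (by omega), Nat.div_eq_of_lt (by omega), zero_add]
  have d2 : (a + 2 * H * (p % P) + H) / (2 * H) = p % P := by
    rw [add_right_comm, Nat.add_mul_div_left _ _ (by omega), Nat.div_eq_of_lt (by omega), zero_add]
  rw [partialDFT, partialDFT, partialDFT, m1, m2, d1, d2, sum_range_two_mul, Finset.mul_sum,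
    ← Finset.sum_add_distrib]
  refine Finset.sum_congr rfl fun u _ => ?_
  -- The half-length transforms are periodic in the frequency, so `p` may be reduced modulo `P`; the
  -- twiddle factor keeps the full `p`.
  have e0 : ec (σ * (u * p) / P) = ec (σ * (u * (p % P : ℕ)) / P) := by
    rw [← ec_add_int (σ * (u * (p % P : ℕ)) / P) (σ * u * q)]
    congr 1
    push_cast
    rw [hp]
    field_simp
    ring
  have e1 : ec (σ * ((2 * u : ℕ) * p) / (2 * P : ℕ)) = ec (σ * (u * (p % P : ℕ)) / P) := by
    rw [← e0]
    congr 1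
    push_cast
    field_simp
  have e2 : ec (σ * ((2 * u + 1 : ℕ) * p) / (2 * P : ℕ)) =
      ec (σ * p / (2 * P)) * ec (σ * (u * (p % P : ℕ)) / P) := by
    rw [← e0, ← ec_add]
    congr 1
    push_cast
    field_simp
    ring
  rw [e1, e2, show a + H * (2 * u) = a + 2 * H * u by ring,
    show a + H * (2 * u + 1) = a + H + 2 * H * u by ring]
  ring

/-- The discrete Fourier transform of length `N`. -/
def dft (x : ℕ → ℂ) (σ : ℤ) (N i : ℕ) : ℂ :=
  ∑ t ∈ Finset.range N, x t * ec (σ * (t * i) / N)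

theorem partialDFT_one (x : ℕ → ℂ) (σ : ℤ) {H i : ℕ} (hi : i < H) : partialDFT x σ H 1 i = x i := by
  simp [partialDFT, Nat.div_eq_of_lt hi, Nat.mod_eq_of_lt hi, ec_zero]

theorem partialDFT_full (x : ℕ → ℂ) (σ : ℤ) (P i : ℕ) : partialDFT x σ 1 P i = dft x σ P i := by
  simp [partialDFT, dft, Nat.mod_one]

/-- Correlation as a product of Fourier transforms. -/
theorem dft_mul_dft {M N : ℕ} (hN : 0 < N) (hMN : 2 * N - 1 ≤ M) (a b : ℕ → ℂ)
    (ha : ∀ t, N ≤ t → t < M → a t = 0) {k : ℕ} (hk : k < N) :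
    dft (fun p => dft b (-1) M p * dft a 1 M p) 1 M k =
      M * ∑ j ∈ Finset.range N, a j * b (j + k) := by
  have hM : 0 < M := by omega
  have e : dft (fun p => dft b (-1) M p * dft a 1 M p) 1 M k =
      ∑ j ∈ Finset.range M, ∑ l ∈ Finset.range M, a j * b l *
        ∑ p ∈ Finset.range M, ec (((j : ℤ) + k - l : ℤ) * p / M) := by
    simp only [dft, Finset.sum_mul, Finset.mul_sum]
    rw [Finset.sum_comm, Finset.sum_congr rfl fun _ _ => Finset.sum_comm]
    refine Finset.sum_congr rfl fun j _ => Finset.sum_congr rfl fun l _ =>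
      Finset.sum_congr rfl fun p _ => ?_
    have : ec (((j : ℤ) + k - l : ℤ) * p / M) = ec ((-1 : ℤ) * (l * p) / M) *
        ec ((1 : ℤ) * (j * p) / M) * ec ((1 : ℤ) * (p * k) / M) := by
      rw [← ec_add, ← ec_add]
      congr 1
      push_cast
      ring
    rw [this]
    ring
  rw [e, Finset.mul_sum, ← Finset.sum_subset (Finset.range_subset_range.mpr (show N ≤ M by omega))]
  · refine Finset.sum_congr rfl fun j hj => ?_
    have hj := Finset.mem_range.mp hj
    -- No wrap-around occurs: `j + k ≤ 2 N - 2 < M`, so `l = j + k` is the only index of its class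
    -- modulo `M`.
    rw [Finset.sum_eq_single_of_mem (j + k) (Finset.mem_range.mpr (by omega))]
    · rw [sum_ec hM, if_pos (by simp)]
      ring
    · intro l hl hne
      have hl := Finset.mem_range.mp hl
      rw [sum_ec hM, if_neg, mul_zero]
      intro hd
      have := Int.eq_zero_of_abs_lt_dvd hd (by rw [abs_lt]; constructor <;> omega)
      omega
  · intro j hj hj'
    have hj := Finset.mem_range.mp hj
    have hj' : N ≤ j := by simpa using hj'
    simp [ha j hj' hj]

/-- The chirp `e^{πiσt²/N}`. -/
def chirp (σ : ℤ) (N : ℕ) (t : ℤ) : ℂ := ec (σ * (t * t) / (2 * N))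

/-- Bluestein's formula. -/
theorem dft_eq_chirp {N : ℕ} (σ : ℤ) (x : ℕ → ℂ) (k : ℕ) :
    dft x σ N k = (∑ j ∈ Finset.range N, (x j * chirp (-σ) N j) * chirp σ N ((j + k : ℕ) : ℤ)) *
      chirp (-σ) N k := by
  rw [dft, Finset.sum_mul]
  refine Finset.sum_congr rfl fun j hj => ?_
  have hN : (N : ℂ) ≠ 0 := by
    have := Finset.mem_range.mp hj
    exact_mod_cast (show N ≠ 0 by omega)
  -- Completing the square: `2 j k = (j + k)² - j² - k²`.
  have : ec (σ * (j * k) / N) = chirp (-σ) N j * chirp σ N ((j + k : ℕ) : ℤ) * chirp (-σ) N k := by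
    rw [chirp, chirp, chirp, ← ec_add, ← ec_add]
    congr 1
    push_cast
    field_simp
    ring
  rw [this]
  ring

/-! ## The fast Fourier transform as a program -/

/-- The expression `e^{2πi f / g}`. -/
def ecExpr (f g : IntExpr) : NumExpr :=
  .exp (.mul (.mul (.mul (.const 2) .pi) .imag) (.div (.ofInt f) (.ofInt g)))

theorem eval_ecExpr (O : Oracle) (s : Memory) (f g : IntExpr) :
    (ecExpr f g).eval O s = ec ((f.eval s : ℂ) / (g.eval s : ℂ)) := by
  simp [ecExpr, NumExpr.eval, ec]

theorem cost_ecExpr (f g : IntExpr) : (ecExpr f g).cost = f.cost + g.cost + 10 := by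
  simp only [ecExpr, NumExpr.cost]
  ring

/-- One entry of a stage of the Fourier transform of the array `5`. -/
def stageExpr (σ : ℤ) : NumExpr :=
  let p : IntExpr := .div (.var 5) (.var 7)
  let base : IntExpr := .add (.mod (.var 5) (.var 7))
    (.mul (.mul (.const 2) (.var 7)) (.mod p (.var 8)))
  .add (.get 5 base) (.mul (ecExpr (.mul (.const σ) p) (.mul (.const 2) (.var 8)))
    (.get 5 (.add base (.var 7))))

/-- Fourier transform of the array `5` of length `2 ^ r`, with `2 ^ r` and `r` in the variables
`2` and `3`. -/
def fftProg (σ : ℤ) : Program :=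
  .seq (.setInt 7 (.const 0) (.var 2)) <|
  .seq (.setInt 8 (.const 0) (.const 1)) <|
  .loop 6 (.var 3) <|
    .seq (.setInt 7 (.const 0) (.div (.var 7) (.const 2))) <|
    .seq (fill 5 (.var 2) 6 (stageExpr σ)) <|
    .seq (fill 5 (.var 2) 5 (.get 6 (.var 5)))
      (.setInt 8 (.const 0) (.mul (.const 2) (.var 8)))

/-- After `y` rounds the array `5` holds the transforms of length `2 ^ y` of the subsequences of
stride `2 ^ (r - y)`. The stride and length are in variables `7` and `8`. This interpolates between
the input (`partialDFT_one`) and the full transform (`partialDFT_full`). The array `6` is scratch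
space, as a butterfly reads entries at other positions. -/
theorem spec_fftProg (O : Oracle) (σ : ℤ) {s : Memory} {r : ℕ} (h2 : s.int 2 0 = 2 ^ r)
    (h3 : s.int 3 0 = r) (x : ℕ → ℂ) (hx : ∀ i < 2 ^ r, s.num 5 (i : ℕ) = x i) :
    Spec O (fftProg σ) s (fun s' => ∀ i < 2 ^ r, s'.num 5 (i : ℕ) = dft x σ (2 ^ r) i)
      (200 * ((r + 1) * 2 ^ r)) := by
  refine Spec.mono (d := 200 * ((r + 1) * 2 ^ r)) (Spec.seq (Q := fun s' => s'.int 7 0 = 2 ^ r)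
    (Spec.setInt ?_) fun s₁ F₁ q₁ => Spec.seq (Q := fun s' => s'.int 8 0 = 1)
    (Spec.setInt ?_) fun s₂ F₂ q₂ => Spec.loop (n := r) (fun y s' => s'.int 7 0 = 2 ^ (r - y) ∧
      s'.int 8 0 = 2 ^ y ∧ ∀ i < 2 ^ r, s'.num 5 (i : ℕ) = partialDFT x σ (2 ^ (r - y)) (2 ^ y) i)
      ?_ (40 + 80 * 2 ^ r) ?_ ?_) ?_ ?_
  · simp [IntExpr.eval, h2]
  · simp [IntExpr.eval]
  · simp [IntExpr.eval, F₂.intEq 3, F₁.intEq 3, h3]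
  · refine ⟨?_, by simpa using q₂, fun i hi => ?_⟩
    · rw [F₂.intEq 7, q₁, Nat.sub_zero]
    · rw [F₂.numEq 5, F₁.numEq 5, hx i hi, Nat.sub_zero, pow_zero,
        partialDFT_one x σ hi]
  · rintro y hy s₃ F₃ ⟨q7, q8, q5⟩
    obtain ⟨z, rfl⟩ : ∃ z, r = y + z + 1 := ⟨r - y - 1, by omega⟩
    have r1 : y + z + 1 - y = z + 1 := by omega
    have r2 : y + z + 1 - (y + 1) = z := by omega
    rw [r1] at q7 q5
    have hM : s₃.int 2 0 = 2 ^ (y + z + 1) := by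
      rw [F₃.intEq 2, F₂.intEq 2, F₁.intEq 2, h2]
    refine Spec.mono (Spec.seq (Q := fun s' => s'.int 7 0 = 2 ^ z) (Spec.setInt ?_)
      fun s₄ F₄ q₄ => Spec.seq (Spec.fill (n := 2 ^ (y + z + 1)) ?_
        (fun i => partialDFT x σ (2 ^ z) (2 ^ (y + 1)) i) ?_)
      fun s₅ F₅ q₅ => Spec.seq (Spec.fill (n := 2 ^ (y + z + 1)) ?_
        (fun i => partialDFT x σ (2 ^ z) (2 ^ (y + 1)) i) ?_)
      fun s₆ F₆ q₆ => Spec.setInt (Q := fun s' => s'.int 7 0 = 2 ^ (y + z + 1 - (y + 1)) ∧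
        s'.int 8 0 = 2 ^ (y + 1) ∧ ∀ i < 2 ^ (y + z + 1), s'.num 5 (i : ℕ) =
          partialDFT x σ (2 ^ (y + z + 1 - (y + 1))) (2 ^ (y + 1)) i) ?_) (fun _ _ h => h) ?_
    · have : (2 : ℤ) ^ (z + 1) / 2 = 2 ^ z := by rw [pow_succ]; simp
      simp [IntExpr.eval, q7, this]
    · simp [IntExpr.eval, F₄.intEq 2, hM]
    · intro i hi s' F' hc _
      have g7 : s'.int 7 0 = ((2 ^ z : ℕ) : ℤ) := by rw [F'.intEq 7, q₄]; push_cast; rfl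
      have g8 : s'.int 8 0 = ((2 ^ y : ℕ) : ℤ) := by
        rw [F'.intEq 8, F₄.intEq 8, int_putInt_ne _ (by decide), q8]
        push_cast; rfl
      have g5 : ∀ j < 2 ^ (y + z + 1), s'.num 5 (j : ℕ) =
          partialDFT x σ (2 * 2 ^ z) (2 ^ y) j := by
        intro j hj
        rw [F'.numEq 5, F₄.numEq 5, num_putInt, q5 j hj, pow_succ, mul_comm]
      have hi' : i / 2 ^ z % 2 ^ y < 2 ^ y := Nat.mod_lt _ (by positivity)
      have hm : i % 2 ^ z < 2 ^ z := Nat.mod_lt _ (by positivity)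
      have hb : i % 2 ^ z + 2 * 2 ^ z * (i / 2 ^ z % 2 ^ y) + 2 ^ z < 2 ^ (y + z + 1) := by
        have : 2 * 2 ^ z * (i / 2 ^ z % 2 ^ y + 1) ≤ 2 * 2 ^ z * 2 ^ y :=
          Nat.mul_le_mul_left _ hi'
        have e : (2 : ℕ) ^ (y + z + 1) = 2 * 2 ^ z * 2 ^ y := by ring
        rw [e]
        nlinarith
      rw [show (2 : ℕ) ^ (y + 1) = 2 * 2 ^ y by ring,
        partialDFT_double x σ (by positivity) (by positivity) i, ← g5 _ (by omega), ← g5 _ hb]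
      simp only [stageExpr, NumExpr.eval, eval_ecExpr, IntExpr.eval, hc, g7, g8]
      rw [← Int.natCast_div, Int.cast_mul, Int.cast_mul, Int.cast_natCast, Int.cast_natCast,
        Int.cast_ofNat]
      generalize ec _ = w
      norm_cast
    · simp [IntExpr.eval, F₅.intEq 2, F₄.intEq 2, hM]
    · intro i hi s' F' hc _
      simp only [NumExpr.eval, IntExpr.eval, hc]
      rw [F'.numEq 6]
      exact q₅.1 i hi
    · rw [r2]
      refine ⟨?_, ?_, ?_⟩
      · rw [int_putInt_ne _ (by decide), F₆.intEq 7, F₅.intEq 7, q₄]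
      · simp only [IntExpr.eval, int_putInt_same]
        rw [F₆.intEq 8, F₅.intEq 8, F₄.intEq 8,
          int_putInt_ne _ (by decide), q8]
        ring
      · intro i hi
        rw [num_putInt]
        exact q₆.1 i hi
    · simp only [stageExpr, cost_ecExpr, NumExpr.cost, IntExpr.cost]
      omega
  · intro s' _ h i hi
    rw [h.2.2 i hi, Nat.sub_self, pow_zero, partialDFT_full]
  · simp only [IntExpr.cost]
    have : 1 ≤ 2 ^ r := Nat.one_le_two_pow
    have := Nat.mul_le_mul_left r this
    nlinarith

/-! ## Fourier transforms of odd length -/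

/-- The number `2n + 1` of grid points, with `n` in the variable `0`. -/
def sizeExpr : IntExpr := .add (.mul (.const 2) (.var 0)) (.const 1)

theorem eval_sizeExpr {s : Memory} {n : ℕ} (h : s.int 0 0 = n) :
    sizeExpr.eval s = (2 * n + 1 : ℕ) := by
  simp [sizeExpr, IntExpr.eval, h]

/-- The chirp at the counter `5`. -/
def chirpExpr (σ : ℤ) : NumExpr :=
  ecExpr (.mul (.const σ) (.mul (.var 5) (.var 5))) (.mul (.const 2) sizeExpr)

theorem eval_chirpExpr (O : Oracle) (σ : ℤ) {s : Memory} {n : ℕ} (h : s.int 0 0 = n) :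
    (chirpExpr σ).eval O s = chirp σ (2 * n + 1) (s.int 5 0) := by
  simp [chirpExpr, eval_ecExpr, chirp, IntExpr.eval, eval_sizeExpr h]

theorem cost_chirpExpr (σ : ℤ) : (chirpExpr σ).cost = 25 := by
  simp only [chirpExpr, cost_ecExpr, sizeExpr, IntExpr.cost]

/-- Fourier transform of length `2n + 1` of the array `8`. -/
def oddFFTProg (σ : ℤ) : Program :=
  .seq (fill 5 (.var 2) 5 (.const 0)) <|
  .seq (fill 5 sizeExpr 5 (.mul (.get 8 (.var 5)) (chirpExpr (-σ)))) <|
  .seq (fftProg 1) <|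
  .seq (fill 5 (.var 2) 7 (.get 5 (.var 5))) <|
  .seq (fill 5 (.var 2) 5 (chirpExpr σ)) <|
  .seq (fftProg (-1)) <|
  .seq (fill 5 (.var 2) 5 (.mul (.get 5 (.var 5)) (.get 7 (.var 5)))) <|
  .seq (fftProg 1) <|
  fill 5 sizeExpr 8 (.div (.mul (.get 5 (.var 5)) (chirpExpr (-σ))) (.ofInt (.var 2)))

/-- The variables `0`, `2`, `3` hold `n`, `2 ^ r`, `r`. -/
structure Sizes (s : Memory) (n r : ℕ) : Prop where
  h0 : s.int 0 0 = n
  h2 : s.int 2 0 = (2 ^ r : ℕ)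
  h3 : s.int 3 0 = r

theorem Sizes.frame {s s' : Memory} {n r : ℕ} (h : Sizes s n r) {I J : List ℕ}
    (hF : Frame I J s s') (h0 : I.elem 0 = false := by rfl) (h2 : I.elem 2 = false := by rfl)
    (h3 : I.elem 3 = false := by rfl) : Sizes s' n r :=
  ⟨by rw [hF.intEq 0 h0, h.h0], by rw [hF.intEq 2 h2, h.h2], by rw [hF.intEq 3 h3, h.h3]⟩

theorem Sizes.eval_two {s : Memory} {n r : ℕ} (h : Sizes s n r) :
    (IntExpr.var 2).eval s = (2 ^ r : ℕ) := h.h2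

/-- Bluestein's formula makes the transform a correlation with a chirp. The condition `2 ^ r ≥ 4 n +
1 = 2 (2 n + 1) - 1` prevents wrap-around after zero padding. The transforms of `a` and `b` have
opposite signs because a correlation, not a convolution, is wanted; the final division removes the
factor `2 ^ r`. -/
theorem spec_oddFFTProg (O : Oracle) (σ : ℤ) {s : Memory} {n r : ℕ} (hs : Sizes s n r)
    (hr : 4 * n + 1 ≤ 2 ^ r) (x : ℕ → ℂ) (hx : ∀ i < 2 * n + 1, s.num 8 (i : ℕ) = x i) :
    Spec O (oddFFTProg σ) s
      (fun s' => ∀ i < 2 * n + 1, s'.num 8 (i : ℕ) = dft x σ (2 * n + 1) i)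
      (1000 * ((r + 1) * 2 ^ r)) := by
  let a : ℕ → ℂ := fun t => if t < 2 * n + 1 then x t * chirp (-σ) (2 * n + 1) t else 0
  let b : ℕ → ℂ := fun t => chirp σ (2 * n + 1) t
  let M : ℕ := 2 ^ r
  refine Spec.mono (Spec.seq (d := 10 + (2 * n + 1) * 50 + (200 * ((r + 1) * 2 ^ r) + (10 + 2 ^ r * 20 +
    (10 + 2 ^ r * 50 + (200 * ((r + 1) * 2 ^ r) + (10 + 2 ^ r * 50 +
    (200 * ((r + 1) * 2 ^ r) + (10 + (2 * n + 1) * 50))))))))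
    (Spec.fill (n := 2 ^ r) hs.eval_two (fun _ => 0) ?_) fun s₁ F₁ q₁ => ?_)
    (fun _ _ h => h) ?_
  · intro i hi s' F' hc _
    simp [NumExpr.eval]
  rotate_left
  · have h1 : 2 * n + 1 ≤ 2 ^ r := by omega
    have h2 : 1 ≤ 2 ^ r := Nat.one_le_two_pow
    have h3 := Nat.mul_le_mul_left r h2
    simp only [IntExpr.cost, NumExpr.cost]
    nlinarith
  have g₁ := hs.frame F₁
  have hx₁ : ∀ i < 2 * n + 1, s₁.num 8 (i : ℕ) = x i := fun i hi => by
    rw [F₁.numEq 8, hx i hi]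
  refine Spec.seq ((Spec.fill (n := 2 * n + 1) (eval_sizeExpr g₁.h0) a ?_).mono
    (R := fun s' => ∀ i < 2 ^ r, s'.num 5 (i : ℕ) = a i) ?_ ?_) fun s₂ F₂ q₂ => ?_
  · intro i hi s' F' hc _
    have e0 : s'.int 0 0 = n := (g₁.frame F').h0
    simp only [NumExpr.eval, IntExpr.eval, eval_chirpExpr O _ e0, hc]
    rw [F'.numEq 8, hx₁ i hi]
    simp only [a, if_pos hi]
  · rintro s' _ ⟨h1, h2⟩ i hi
    by_cases hn : i < 2 * n + 1
    · exact h1 i hn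
    · rw [h2 i (by omega), q₁.1 i hi]
      simp only [a, if_neg hn]
  · simp only [IntExpr.cost, NumExpr.cost, cost_chirpExpr, sizeExpr]
    omega
  have g₂ := g₁.frame F₂
  refine Spec.seq (spec_fftProg O 1 (by rw [g₂.h2]; push_cast; rfl) g₂.h3 a q₂) fun s₃ F₃ q₃ => ?_
  have g₃ := g₂.frame F₃
  refine Spec.seq ((Spec.fill (n := 2 ^ r) g₃.eval_two (dft a 1 M) ?_).mono
    (fun _ _ h => h.1) ?_) fun s₄ F₄ q₄ => ?_
  · intro i hi s' F' hc _
    simp only [NumExpr.eval, IntExpr.eval, hc]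
    rw [F'.numEq 5, q₃ i hi]
  · simp only [IntExpr.cost, NumExpr.cost]
    omega
  have g₄ := g₃.frame F₄
  refine Spec.seq ((Spec.fill (n := 2 ^ r) g₄.eval_two b ?_).mono
    (fun _ _ h => h.1) ?_) fun s₅ F₅ q₅ => ?_
  · intro i hi s' F' hc _
    rw [eval_chirpExpr O _ (g₄.frame F').h0, hc]
  · simp only [IntExpr.cost, cost_chirpExpr]
    omega
  have g₅ := g₄.frame F₅
  refine Spec.seq (spec_fftProg O (-1) (by rw [g₅.h2]; push_cast; rfl) g₅.h3 b q₅)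
    fun s₆ F₆ q₆ => ?_
  have g₆ := g₅.frame F₆
  refine Spec.seq ((Spec.fill (n := 2 ^ r) g₆.eval_two (fun p => dft b (-1) M p * dft a 1 M p) ?_).mono
    (fun _ _ h => h.1) ?_) fun s₇ F₇ q₇ => ?_
  · intro i hi s' F' hc h5
    simp only [NumExpr.eval, IntExpr.eval, hc]
    rw [F'.numEq 7, F₆.numEq 7, F₅.numEq 7, q₄ i hi, h5 i le_rfl, q₆ i hi]
  · simp only [IntExpr.cost, NumExpr.cost]
    omega
  have g₇ := g₆.frame F₇
  refine Spec.seq (spec_fftProg O 1 (by rw [g₇.h2]; push_cast; rfl) g₇.h3 _ q₇) fun s₈ F₈ q₈ => ?_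
  have g₈ := g₇.frame F₈
  refine (Spec.fill (n := 2 * n + 1) (eval_sizeExpr g₈.h0) (dft x σ (2 * n + 1)) ?_).mono
    (fun _ _ h => h.1) ?_
  · intro i hi s' F' hc _
    have e0 := g₈.frame F'
    simp only [NumExpr.eval, IntExpr.eval, eval_chirpExpr O _ e0.h0, hc, e0.h2]
    rw [F'.numEq 5, q₈ i (by omega), dft_mul_dft (N := 2 * n + 1) (by omega) (by omega) a b
      (fun t ht _ => if_neg (by omega)) hi, dft_eq_chirp]
    have hM : (((2 ^ r : ℕ) : ℤ) : ℂ) ≠ 0 := by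
      push_cast
      exact pow_ne_zero _ two_ne_zero
    have hMM : (((2 ^ r : ℕ) : ℤ) : ℂ) = ((2 ^ r : ℕ) : ℂ) := by push_cast; rfl
    rw [hMM] at hM ⊢
    rw [mul_assoc, mul_div_assoc, mul_comm, div_mul_cancel₀ _ hM]
    congr 1
    refine Finset.sum_congr rfl fun j hj => ?_
    simp only [a, b, if_pos (Finset.mem_range.mp hj)]
  · simp only [IntExpr.cost, NumExpr.cost, cost_chirpExpr, sizeExpr]
    omega

/-! ## The length of the transform and powers -/

theorem Spec.ite {O : Oracle} {e f : IntExpr} {p q : Program} {s : Memory} {Q : Memory → Prop}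
    {c : ℕ} (h : e.eval s ≤ f.eval s → Spec O p s Q c) (h' : f.eval s < e.eval s → Spec O q s Q c) :
    Spec O (.ite e f p q) s Q (c + e.cost + f.cost + 1) := by
  by_cases hc : e.eval s ≤ f.eval s
  · obtain ⟨h1, h2⟩ := h hc
    simp only [Spec, Program.exec, Program.steps, Program.run, if_pos hc] at *
    exact ⟨h1, by omega⟩
  · obtain ⟨h1, h2⟩ := h' (not_le.mp hc)
    simp only [Spec, Program.exec, Program.steps, Program.run, if_neg hc] at *
    exact ⟨h1, by omega⟩

/-- Find a power of two which is at least `4n + 1`. -/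
def lengthProg : Program :=
  let bound : IntExpr := .add (.mul (.const 4) (.var 0)) (.const 1)
  .seq (.setInt 2 (.const 0) (.const 1)) <|
  .seq (.setInt 3 (.const 0) (.const 0)) <|
  .loop 12 bound <|
    .ite (.add (.var 2) (.const 1)) bound
      (.seq (.setInt 2 (.const 0) (.mul (.const 2) (.var 2)))
        (.setInt 3 (.const 0) (.add (.var 3) (.const 1))))
      (.setInt 3 (.const 0) (.var 3))

/-- Doubling happens only while `2 ^ r ≤ 4 n`, which gives the upper bound. If it never stopped,
then `r = 4 n + 1` after all rounds, and `2 ^ r > r` suffices. -/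
theorem spec_lengthProg (O : Oracle) {s : Memory} {n : ℕ} (h0 : s.int 0 0 = n) :
    Spec O lengthProg s (fun s' => ∃ r, Sizes s' n r ∧ 4 * n + 1 ≤ 2 ^ r ∧ 2 ^ r ≤ 8 * n + 2)
      (200 * (n + 1)) := by
  refine Spec.mono (Spec.seq (Q := fun s' => s'.int 2 0 = 1) (Spec.setInt (by simp [IntExpr.eval]))
    fun s₁ F₁ q₁ => Spec.seq (Q := fun s' => s'.int 3 0 = 0) (Spec.setInt (by simp [IntExpr.eval]))
    fun s₂ F₂ q₂ => Spec.loop (n := 4 * n + 1) (fun x s' => ∃ r, Sizes s' n r ∧ 2 ^ r ≤ 8 * n + 2 ∧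
      (4 * n + 1 ≤ 2 ^ r ∨ r = x)) ?_ 40 ?_ ?_) ?_ ?_
  · simp [IntExpr.eval, F₂.intEq 0, F₁.intEq 0, h0]
  · refine ⟨0, ⟨?_, ?_, ?_⟩, by omega, Or.inr rfl⟩
    · rw [F₂.intEq 0, F₁.intEq 0, h0]
    · rw [F₂.intEq 2, q₁]; rfl
    · rw [q₂]; rfl
  · rintro x hx s₃ F₃ ⟨r, hr, hle, hor⟩
    have e0 : (s₃.putInt 12 0 x).int 0 0 = n := by rw [int_putInt_ne _ (by decide), hr.h0]
    have e2 : (s₃.putInt 12 0 x).int 2 0 = (2 ^ r : ℕ) := by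
      rw [int_putInt_ne _ (by decide), hr.h2]
    have e3 : (s₃.putInt 12 0 x).int 3 0 = r := by rw [int_putInt_ne _ (by decide), hr.h3]
    refine (Spec.ite (c := 15) (fun hc => ?_) fun hc => ?_).mono (fun _ _ h => h) ?_
    · simp only [IntExpr.eval, e0, e2] at hc
      have hc' : 2 ^ r + 1 ≤ 4 * n + 1 := by exact_mod_cast hc
      refine (Spec.seq (Q := fun s' => s'.int 2 0 = (2 ^ (r + 1) : ℕ)) (Spec.setInt ?_)
        fun s₄ F₄ q₄ => Spec.setInt ?_).mono (fun _ _ h => h) ?_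
      · simp only [IntExpr.eval, e2, int_putInt_same]
        push_cast
        ring
      · refine ⟨r + 1, ⟨?_, ?_, ?_⟩, ?_, ?_⟩
        · rw [int_putInt_ne _ (by decide), F₄.intEq 0, e0]
        · rw [int_putInt_ne _ (by decide), q₄]
        · simp only [IntExpr.eval, int_putInt_same]
          rw [F₄.intEq 3, e3]
          push_cast
          rfl
        · rw [pow_succ]; omega
        · rcases hor with h | h
          · omega
          · exact Or.inr (by omega)
      · simp only [IntExpr.cost]; omega
    · simp only [IntExpr.eval, e0, e2] at hc
      have hc' : 4 * n + 1 < 2 ^ r + 1 := by exact_mod_cast hc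
      refine (Spec.setInt ?_).mono (fun _ _ h => h) ?_
      · refine ⟨r, ⟨?_, ?_, ?_⟩, hle, Or.inl (by omega)⟩
        · rw [int_putInt_ne _ (by decide), e0]
        · rw [int_putInt_ne _ (by decide), e2]
        · simp only [IntExpr.eval, int_putInt_same, e3]
      · simp only [IntExpr.cost]; omega
    · simp only [IntExpr.cost]; omega
  · rintro s' _ ⟨r, hr, hle, hor⟩
    refine ⟨r, hr, ?_, hle⟩
    rcases hor with h | h
    · exact h
    · rw [← h]; exact Nat.lt_two_pow_self.le
  · simp only [IntExpr.cost]
    omega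

/-- Multiply the entries of the array `9` by the powers of the entries of the array `8`; the
exponent is entry `j` of the integer array `1`, with `j` in the variable `4`. -/
def powProg : Program :=
  .seq (.setInt 9 (.const 0) (.get 1 (.var 4))) <|
  .loop 10 (.mul (.const 2) (.var 3)) <|
    .seq (fill 5 sizeExpr 9 (.mul (.get 9 (.var 5)) (.add (.const 1)
      (.mul (.ofInt (.mod (.var 9) (.const 2))) (.sub (.get 8 (.var 5)) (.const 1)))))) <|
    .seq (fill 5 sizeExpr 8 (.mul (.get 8 (.var 5)) (.get 8 (.var 5))))
      (.setInt 9 (.const 0) (.div (.var 9) (.const 2)))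

/-- One step of square-and-multiply: the first factor is `z` or `1` according to the lowest binary
digit, without a branch. -/
theorem pow_bit_mul (z : ℂ) (m : ℕ) :
    (1 + (((m : ℤ) % 2 : ℤ) : ℂ) * (z - 1)) * (z * z) ^ (m / 2) = z ^ m := by
  obtain ⟨q, rfl | rfl⟩ := Nat.even_or_odd' m
  · have e1 : ((2 * q : ℕ) : ℤ) % 2 = 0 := by omega
    have e2 : 2 * q / 2 = q := by omega
    rw [e1, e2, ← pow_two, ← pow_mul]
    simp
  · have e1 : ((2 * q + 1 : ℕ) : ℤ) % 2 = 1 := by omega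
    have e2 : (2 * q + 1) / 2 = q := by omega
    rw [e1, e2, ← pow_two, ← pow_mul]
    push_cast
    ring

/-- The product of the accumulator with `base ^ (m / 2 ^ u)` is invariant. After `2 r` rounds the
remaining exponent is zero, so the cost does not depend on `m`. -/
theorem spec_powProg (O : Oracle) {s : Memory} {n r j m : ℕ} (hs : Sizes s n r)
    (h4 : s.int 4 0 = j) (h1 : s.int 1 j = m) (hm : m < 2 ^ (2 * r)) (x y : ℕ → ℂ)
    (hx : ∀ i < 2 * n + 1, s.num 8 (i : ℕ) = x i) (hy : ∀ i < 2 * n + 1, s.num 9 (i : ℕ) = y i) :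
    Spec O powProg s (fun s' => ∀ i < 2 * n + 1, s'.num 9 (i : ℕ) = y i * x i ^ m)
      (200 * ((r + 1) * (2 * n + 1))) := by
  refine Spec.mono (Spec.seq (Q := fun s' => s'.int 9 0 = m) (Spec.setInt ?_) fun s₁ F₁ q₁ =>
    Spec.loop (n := 2 * r) (fun u s' => s'.int 9 0 = (m / 2 ^ u : ℕ) ∧ ∀ i < 2 * n + 1,
      s'.num 9 (i : ℕ) * s'.num 8 (i : ℕ) ^ (m / 2 ^ u) = y i * x i ^ m) ?_
      (24 + (2 * n + 1) * 40) ?_ ?_) ?_ ?_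
  · simp [IntExpr.eval, h4, h1]
  · simp [IntExpr.eval, (hs.frame F₁).h3]
  · refine ⟨by simpa using q₁, fun i hi => ?_⟩
    rw [F₁.numEq 8, F₁.numEq 9, hx i hi, hy i hi, pow_zero, Nat.div_one]
  · rintro u _ s₂ F₂ ⟨q9, q⟩
    have g₂ : Sizes (s₂.putInt 10 0 u) n r :=
      ((hs.frame F₁).frame F₂).frame (Frame.putInt (I := [10]) (J := []) _ _ _ _ (by simp))
    have e9 : (s₂.putInt 10 0 u).int 9 0 = (m / 2 ^ u : ℕ) := by
      rw [int_putInt_ne _ (by decide), q9]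
    refine Spec.mono (Spec.seq (Spec.fill (n := 2 * n + 1) (eval_sizeExpr g₂.h0)
      (fun i => s₂.num 9 (i : ℕ) * (1 + ((((m / 2 ^ u : ℕ) : ℤ) % 2 : ℤ) : ℂ) *
        (s₂.num 8 (i : ℕ) - 1))) ?_) fun s₃ F₃ q₃ =>
      Spec.seq (Spec.fill (n := 2 * n + 1) (eval_sizeExpr (g₂.frame F₃).h0)
      (fun i => s₂.num 8 (i : ℕ) * s₂.num 8 (i : ℕ)) ?_) fun s₄ F₄ q₄ =>
      Spec.setInt (Q := fun s' => s'.int 9 0 = (m / 2 ^ (u + 1) : ℕ) ∧ ∀ i < 2 * n + 1,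
        s'.num 9 (i : ℕ) * s'.num 8 (i : ℕ) ^ (m / 2 ^ (u + 1)) = y i * x i ^ m) ?_)
      (fun _ _ h => h) ?_
    · intro i hi s' F' hc h9
      simp only [NumExpr.eval, IntExpr.eval, hc]
      rw [h9 i le_rfl, F'.numEq 8, F'.intEq 9, e9, num_putInt]
      simp
    · intro i hi s' F' hc h8
      simp only [NumExpr.eval, IntExpr.eval, hc]
      rw [h8 i le_rfl, F₃.numEq 8, num_putInt]
    · have ediv : m / 2 ^ (u + 1) = m / 2 ^ u / 2 := by rw [pow_succ, Nat.div_div_eq_div_mul]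
      refine ⟨?_, fun i hi => ?_⟩
      · simp only [IntExpr.eval, int_putInt_same]
        rw [F₄.intEq 9, F₃.intEq 9, e9, ediv]
        push_cast
        rfl
      · rw [num_putInt, F₄.numEq 9, q₃.1 i hi, q₄.1 i hi, ediv, mul_assoc, pow_bit_mul, q i hi]
    · simp only [IntExpr.cost, NumExpr.cost, sizeExpr]
      omega
  · rintro s' _ ⟨_, h⟩ i hi
    have := h i hi
    rwa [Nat.div_eq_of_lt hm, pow_zero, mul_one] at this
  · simp only [IntExpr.cost]
    nlinarith

/-! ## The program -/

theorem sum_Icc_eq_sum_range {E : Type*} [AddCommMonoid E] (n : ℕ) (f : ℤ → E) :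
    ∑ i ∈ Finset.Icc (-(n : ℤ)) n, f i = ∑ t ∈ Finset.range (2 * n + 1), f ((t : ℤ) - n) := by
  refine Finset.sum_nbij' (fun i => (i + n).toNat) (fun t => (t : ℤ) - n) ?_ ?_ ?_ ?_ ?_
  · intro i hi; rw [Finset.mem_Icc] at hi; rw [Finset.mem_range]; omega
  · intro t ht; rw [Finset.mem_range] at ht; rw [Finset.mem_Icc]; omega
  · intro i hi; rw [Finset.mem_Icc] at hi; omega
  · intro t ht; omega
  · intro i hi; rw [Finset.mem_Icc] at hi; congr 1; omega

/-- The mesh size. -/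
def meshExpr : NumExpr := .get 0 (.const 0)

/-- The index `t - n` of the grid point at the counter `t`. -/
def gridExpr : IntExpr := .sub (.var 5) (.var 0)

/-- The increment of the CDF at the counter. -/
def rawExpr : NumExpr :=
  .sub
    (.cdf (.var 4) (.add (.mul (.ofInt gridExpr) meshExpr) (.div meshExpr (.const 2))))
    (.cdf (.var 4) (.sub (.mul (.ofInt gridExpr) meshExpr) (.div meshExpr (.const 2))))

/-- The contribution of one distribution to the offset of the grid. -/
def offsetExpr : NumExpr :=
  .sub (.sub (.mean (.var 4) (.add (.div meshExpr (.const 2)) (.mul (.ofInt (.var 0)) meshExpr)))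
    (.get 11 (.const 0))) (.mul (.ofInt (.var 0)) meshExpr)

/-- The weights of the grid points, from the left to the right. -/
def weightSeq (Y : Measure EReal) (n : ℕ) (h : ℝ) (t : ℕ) : ℂ := (weight Y n h ((t : ℤ) - n) : ℂ)

/-- The leftmost possible value of the discretized variable. -/
def offset (Y : Measure EReal) (n : ℕ) (h : ℝ) : ℝ := shift Y (h / 2 + n * h) n h - n * h

/-- Discretize the distribution with the index in the variable `4`, and multiply the transform in
the array `9` by the power of its transform. -/
def distProg : Program :=
  .seq (fill 5 sizeExpr 8 rawExpr) <|
  .seq (accum 5 sizeExpr 10 (.get 8 (.var 5))) <|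
  .seq (fill 5 sizeExpr 8 (.div (.get 8 (.var 5)) (.get 10 (.const 0)))) <|
  .seq (accum 5 sizeExpr 11 (.mul (.mul (.ofInt gridExpr) meshExpr) (.get 8 (.var 5)))) <|
  .seq (.setNum 12 (.const 0)
    (.add (.get 12 (.const 0)) (.mul (.ofInt (.get 1 (.var 4))) offsetExpr))) <|
  .seq (oddFFTProg 1) powProg

/-- The array `9` collects products of transforms of the unshifted weight sequences; the offsets are
summed separately in entry `0` of the array `12`. The multiplicity is an exponent for the former and
a factor for the latter. -/
theorem spec_distProg (Z : ℕ → Measure EReal) {s : Memory} {n r j m : ℕ} {h : ℝ} {v : ℂ}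
    (hs : Sizes s n r) (hr : 4 * n + 1 ≤ 2 ^ r) (hh : s.num 0 0 = (h : ℂ))
    (h4 : s.int 4 0 = j) (h1 : s.int 1 j = m) (hm : m < 2 ^ (2 * r)) (hv : s.num 12 0 = v)
    (y : ℕ → ℂ) (hy : ∀ i < 2 * n + 1, s.num 9 (i : ℕ) = y i) :
    Spec (oracleOf Z) distProg s (fun s' => s'.num 12 0 = v + m * (offset (Z j) n h : ℂ) ∧
      ∀ i < 2 * n + 1, s'.num 9 (i : ℕ) =
        y i * dft (weightSeq (Z j) n h) 1 (2 * n + 1) i ^ m)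
      (2000 * ((r + 1) * 2 ^ r)) := by
  have emesh : ∀ s' : Memory, s'.num 0 = s.num 0 →
      meshExpr.eval (oracleOf Z) s' = (h : ℂ) := fun s' e => by
    simp only [meshExpr, NumExpr.eval, IntExpr.eval, e, hh]
  refine Spec.mono (Spec.seq (d := (sizeExpr.cost + 4 + (2 * n + 1) * 10) +
      ((sizeExpr.cost + 1 + (2 * n + 1) * 10) + ((sizeExpr.cost + 4 + (2 * n + 1) * 30) +
      (50 + (1000 * ((r + 1) * 2 ^ r) + 200 * ((r + 1) * (2 * n + 1)))))))
    (Spec.fill (n := 2 * n + 1) (eval_sizeExpr hs.h0)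
      (fun t => (rawWeight (Z j) h ((t : ℤ) - n) : ℂ)) ?_) fun s₁ F₁ q₁ => ?_)
    (fun _ _ h => h) ?_
  · intro t ht s' F' hc _
    simp only [rawExpr, NumExpr.eval, IntExpr.eval, emesh _ (F'.numEq 0), F'.intEq 4, h4, gridExpr,
      hc, F'.intEq 0, hs.h0, rawWeight]
    simp only [oracleOf]
    have e : ((t : ℂ) - n) * h + h / 2 = (((t - n) * h + h / 2 : ℝ) : ℂ) := by push_cast; ring
    have e' : ((t : ℂ) - n) * h - h / 2 = (((t - n) * h - h / 2 : ℝ) : ℂ) := by push_cast; ring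
    push_cast
    rw [e, e', Complex.ofReal_re, Complex.ofReal_re, Int.toNat_natCast]
  rotate_left
  · have h1 : 2 * n + 1 ≤ 2 ^ r := by omega
    have h2 := Nat.mul_le_mul_left (r + 1) h1
    have h3 : 1 ≤ r + 1 := by omega
    have h4 := Nat.mul_le_mul_right (2 ^ r) h3
    simp only [sizeExpr, rawExpr, gridExpr, meshExpr, IntExpr.cost, NumExpr.cost]
    omega
  have g₁ := hs.frame F₁
  refine Spec.seq ((Spec.accum (n := 2 * n + 1) (fun s' F' => eval_sizeExpr (g₁.frame F').h0)
    (fun t => (rawWeight (Z j) h ((t : ℤ) - n) : ℂ)) ?_).mono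
    (R := fun s' => s'.num 10 0 = ((∑ i ∈ Finset.Icc (-(n : ℤ)) n, rawWeight (Z j) h i : ℝ) : ℂ))
      ?_ (by simp [NumExpr.cost, IntExpr.cost])) fun s₂ F₂ q₂ => ?_
  · intro t ht s' F' hc
    simp only [NumExpr.eval, IntExpr.eval, hc]
    rw [F'.numEq 8, q₁.1 t ht]
  · intro s' _ h
    rw [h, sum_Icc_eq_sum_range]
    push_cast
    rfl
  have g₂ := g₁.frame F₂
  refine Spec.seq ((Spec.fill (n := 2 * n + 1) (eval_sizeExpr g₂.h0)
    (weightSeq (Z j) n h) ?_).mono (fun _ _ h => h.1)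
    (by simp [NumExpr.cost, IntExpr.cost])) fun s₃ F₃ q₃ => ?_
  · intro t ht s' F' hc h8
    simp only [NumExpr.eval, IntExpr.eval, hc]
    rw [h8 t le_rfl, F'.numEq 10, F₂.numEq 8, q₁.1 t ht, q₂, weightSeq, weight]
    push_cast
    rfl
  have g₃ := g₂.frame F₃
  have n₃ : s₃.num 0 = s.num 0 := by rw [F₃.numEq 0, F₂.numEq 0, F₁.numEq 0]
  refine Spec.seq ((Spec.accum (n := 2 * n + 1) (fun s' F' => eval_sizeExpr (g₃.frame F').h0)
    (fun t => ((((t : ℤ) - n : ℤ) : ℝ) * h * weight (Z j) n h ((t : ℤ) - n) : ℝ)) ?_).mono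
    (R := fun s' => s'.num 11 0 =
      ((∑ i ∈ Finset.Icc (-(n : ℤ)) n, (i * h) * weight (Z j) n h i : ℝ) : ℂ))
      ?_ ?_) fun s₄ F₄ q₄ => ?_
  · intro t ht s' F' hc
    simp only [NumExpr.eval, IntExpr.eval, hc, gridExpr, (g₃.frame F').h0]
    rw [emesh _ (by rw [F'.numEq 0, n₃]), F'.numEq 8, q₃ t ht, weightSeq]
    push_cast
    rfl
  · intro s' _ h
    rw [h, sum_Icc_eq_sum_range]
    push_cast
    rfl
  · simp only [NumExpr.cost, IntExpr.cost, gridExpr, meshExpr]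
    omega
  have g₄ := g₃.frame F₄
  refine Spec.seq ((Spec.setNum (Q := fun s' => s'.num 12 0 = v + m * (offset (Z j) n h : ℂ)) ?_).mono
    (fun _ _ h => h) ?_) fun s₅ F₅ q₅ => ?_
  · have e1 : s₄.int 1 = s.int 1 := by rw [F₄.intEq 1, F₃.intEq 1, F₂.intEq 1, F₁.intEq 1]
    have e4 : s₄.int 4 = s.int 4 := by rw [F₄.intEq 4, F₃.intEq 4, F₂.intEq 4, F₁.intEq 4]
    have e12 : s₄.num 12 = s.num 12 := by
      rw [F₄.numEq 12, F₃.numEq 12, F₂.numEq 12, F₁.numEq 12]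
    simp only [NumExpr.eval, IntExpr.eval, offsetExpr, emesh _ ((F₄.numEq 0).trans n₃), e1, e4, e12,
      h4, h1, hv, g₄.h0, q₄, num_putNum_same]
    simp only [oracleOf]
    have e : (h : ℂ) / ((2 : ℚ) : ℂ) + ((n : ℤ) : ℂ) * h = ((h / 2 + n * h : ℝ) : ℂ) := by
      push_cast; ring
    rw [e, Complex.ofReal_re, Int.toNat_natCast, offset, shift]
    push_cast
    ring
  · simp only [NumExpr.cost, IntExpr.cost, offsetExpr, meshExpr]
    omega
  have g₅ := g₄.frame F₅
  refine Spec.seq (spec_oddFFTProg _ 1 g₅ hr (weightSeq (Z j) n h) ?_) fun s₆ F₆ q₆ => ?_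
  · intro i hi
    rw [F₅.numEq 8, F₄.numEq 8, q₃ i hi]
  refine (spec_powProg _ (g₅.frame F₆) (j := j) (m := m) ?_ ?_ hm _ y q₆ ?_).mono
    (fun s' F' q => ⟨?_, q⟩) le_rfl
  · rw [F₆.intEq 4, F₅.intEq 4, F₄.intEq 4, F₃.intEq 4, F₂.intEq 4, F₁.intEq 4, h4]
  · rw [F₆.intEq 1, F₅.intEq 1, F₄.intEq 1, F₃.intEq 1, F₂.intEq 1, F₁.intEq 1, h1]
  · intro i hi
    rw [F₆.numEq 9, F₅.numEq 9, F₄.numEq 9, F₃.numEq 9, F₂.numEq 9, F₁.numEq 9, hy i hi]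
  · rw [F'.numEq 12, F₆.numEq 12, q₅]

/-- Suffix sums of the probabilities in the array `2`, without and with exponential weights. -/
def tableProg : Program :=
  let idx : IntExpr := .sub (.mul (.const 2) (.var 0)) (.var 5)
  .seq (.setNum 3 sizeExpr (.const 0)) <|
  .seq (.setNum 4 sizeExpr (.const 0)) <|
  .loop 5 sizeExpr <|
    .seq (.setNum 3 idx (.add (.get 3 (.add idx (.const 1))) (.get 2 idx)))
      (.setNum 4 idx (.add (.get 4 (.add idx (.const 1)))
        (.mul (.get 2 idx) (.exp (.sub (.const 0) (.get 1 idx))))))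

theorem spec_tableProg (O : Oracle) {s : Memory} {n : ℕ} (h0 : s.int 0 0 = n) (y p : ℕ → ℂ)
    (hy : ∀ i < 2 * n + 1, s.num 1 (i : ℕ) = y i) (hp : ∀ i < 2 * n + 1, s.num 2 (i : ℕ) = p i) :
    Spec O tableProg s (fun s' => ∀ j ≤ 2 * n + 1,
      s'.num 3 (j : ℕ) = ∑ l ∈ Finset.Ico j (2 * n + 1), p l ∧
      s'.num 4 (j : ℕ) = ∑ l ∈ Finset.Ico j (2 * n + 1), p l * Complex.exp (-(y l)))
      (100 * (2 * n + 1)) := by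
  refine Spec.mono (Spec.seq (Q := fun s' => s'.num 3 (2 * n + 1 : ℕ) = 0) (Spec.setNum ?_)
    fun s₁ F₁ q₁ => Spec.seq (Q := fun s' => s'.num 4 (2 * n + 1 : ℕ) = 0) (Spec.setNum ?_)
    -- The loop fills the tables from index `2 n` downwards; the entry `2 n + 1`, the empty sum, was
    -- set beforehand.
    fun s₂ F₂ q₂ => Spec.loop (n := 2 * n + 1) (fun x s' => ∀ j ≤ 2 * n + 1, 2 * n + 1 ≤ j + x →
      s'.num 3 (j : ℕ) = ∑ l ∈ Finset.Ico j (2 * n + 1), p l ∧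
      s'.num 4 (j : ℕ) = ∑ l ∈ Finset.Ico j (2 * n + 1), p l * Complex.exp (-(y l)))
    ?_ 70 ?_ ?_) (fun s' _ h j hj => h j hj (by omega)) ?_
  · rw [eval_sizeExpr h0, num_putNum_same]
    simp [NumExpr.eval]
  · rw [eval_sizeExpr (by rw [F₁.intEq 0, h0]), num_putNum_same]
    simp [NumExpr.eval]
  · exact eval_sizeExpr (by rw [F₂.intEq 0, F₁.intEq 0, h0])
  · intro j hj hj'
    obtain rfl : j = 2 * n + 1 := by omega
    rw [F₂.numEq 3, q₁, q₂]
    simp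
  · intro x hx s₃ F₃ q₃
    have hidx : ∀ s' : Memory, s'.int 0 0 = n → s'.int 5 0 = x →
        (IntExpr.sub (.mul (.const 2) (.var 0)) (.var 5)).eval s' = (2 * n - x : ℕ) := by
      intro s' e e'
      simp only [IntExpr.eval, e, e']
      push_cast [Nat.cast_sub (show x ≤ 2 * n by omega)]
      rfl
    have e0 : s₃.int 0 0 = n := by rw [F₃.intEq 0, F₂.intEq 0, F₁.intEq 0, h0]
    have e0' : (s₃.putInt 5 0 x).int 0 0 = n := by rw [int_putInt_ne _ (by decide), e0]
    have i₃ := hidx _ e0' (int_putInt_same _ _ _ _)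
    have hnext : 2 * n - x + 1 ≤ 2 * n + 1 := by omega
    obtain ⟨a3, a4⟩ := q₃ (2 * n - x + 1) hnext (by omega)
    have b1 : s₃.num 1 (2 * n - x : ℕ) = y (2 * n - x) := by
      rw [F₃.numEq 1, F₂.numEq 1, F₁.numEq 1, hy _ (by omega)]
    have b2 : s₃.num 2 (2 * n - x : ℕ) = p (2 * n - x) := by
      rw [F₃.numEq 2, F₂.numEq 2, F₁.numEq 2, hp _ (by omega)]
    have hne : ∀ j : ℕ, 2 * n + 1 ≤ j + x → (j : ℤ) ≠ (2 * n - x : ℕ) := fun j hj => by omega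
    refine (Spec.seq (Q := fun s' => ∀ j ≤ 2 * n + 1, 2 * n + 1 ≤ j + (x + 1) →
      s'.num 3 (j : ℕ) = ∑ l ∈ Finset.Ico j (2 * n + 1), p l) (Spec.setNum ?_)
      fun s₄ F₄ q₄ => Spec.setNum ?_).mono (fun _ _ h => h) ?_
    · intro j hj hj'
      rw [i₃]
      by_cases hjx : j = 2 * n - x
      · subst hjx
        rw [num_putNum_same, NumExpr.eval, NumExpr.eval, NumExpr.eval, IntExpr.eval, i₃,
          Finset.sum_eq_sum_Ico_succ_bot (by omega), ← a3, num_putInt, b2, add_comm]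
        simp [IntExpr.eval]
      · rw [num_putNum_idx _ _ (hne j (by omega)), num_putInt]
        exact (q₃ j hj (by omega)).1
    · intro j hj hj'
      rw [num_putNum_ne _ (by decide)]
      refine ⟨q₄ j hj hj', ?_⟩
      have i₄ := hidx s₄ (by rw [F₄.intEq 0, e0']) (by rw [F₄.intEq 5, int_putInt_same])
      rw [i₄]
      by_cases hjx : j = 2 * n - x
      · subst hjx
        simp only [num_putNum_same, NumExpr.eval]
        rw [IntExpr.eval, i₄,
          Finset.sum_eq_sum_Ico_succ_bot (by omega), ← a4, F₄.numEq 4, F₄.numEq 1, F₄.numEq 2,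
          num_putInt, b1, b2, add_comm]
        simp [IntExpr.eval]
      · rw [num_putNum_idx _ _ (hne j (by omega)), F₄.numEq 4, num_putInt]
        exact (q₃ j hj (by omega)).2
    · simp only [NumExpr.cost, IntExpr.cost]
      omega
  · simp only [NumExpr.cost, IntExpr.cost, sizeExpr]
    omega

/-- Read off the output from the transform in the array `9` and the offset. -/
def outputProg : Program :=
  let idx : IntExpr := .add gridExpr (.var 11)
  .seq (.setFloor 11 (.const 0)
    (.sub (.div (.const 1) (.const 2)) (.div (.get 12 (.const 0)) meshExpr))) <|
  .seq (fill 5 sizeExpr 8 (.get 9 (.var 5))) <|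
  .seq (oddFFTProg (-1)) <|
  .seq (fill 5 sizeExpr 1 (.add (.get 12 (.const 0)) (.mul (.ofInt idx) meshExpr))) <|
  .seq (fill 5 sizeExpr 2 (.div (.get 8 (.mod idx sizeExpr)) (.ofInt sizeExpr)))
  tableProg

/-- The `l`-th point of the output grid, for the total offset `v`. -/
def outputPoint (n : ℕ) (h v : ℝ) (l : ℕ) : ℝ := v + (((l : ℤ) - n + ⌊1 / 2 - v / h⌋ : ℤ) : ℝ) * h

/-- The probability of the `l`-th point of the output grid, for the total offset `v` and the
Fourier transform `P`. -/
def outputProb (n : ℕ) (h v : ℝ) (P : ℕ → ℂ) (l : ℕ) : ℂ :=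
  dft P (-1) (2 * n + 1) (((l : ℤ) - n + ⌊1 / 2 - v / h⌋) % (2 * n + 1 : ℕ)).toNat / (2 * n + 1 : ℕ)

/-- `⌊1 / 2 - v / h⌋` mesh steps bring the total offset into `(-h / 2, h / 2]`. Reading the inverse
transform at indices moved by this number, modulo `2 n + 1`, lists the cyclic law in increasing
order of the points. -/
theorem spec_outputProg (O : Oracle) {s : Memory} {n r : ℕ} {h v : ℝ} (hs : Sizes s n r)
    (hr : 4 * n + 1 ≤ 2 ^ r) (hh : s.num 0 0 = (h : ℂ)) (hv : s.num 12 0 = (v : ℂ)) (P : ℕ → ℂ)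
    (hP : ∀ i < 2 * n + 1, s.num 9 (i : ℕ) = P i) :
    Spec O outputProg s (fun s' =>
      (∀ l < 2 * n + 1, s'.num 1 (l : ℕ) = (outputPoint n h v l : ℂ) ∧
        s'.num 2 (l : ℕ) = outputProb n h v P l) ∧
      ∀ j ≤ 2 * n + 1,
        s'.num 3 (j : ℕ) = ∑ l ∈ Finset.Ico j (2 * n + 1), outputProb n h v P l ∧
        s'.num 4 (j : ℕ) = ∑ l ∈ Finset.Ico j (2 * n + 1),
          outputProb n h v P l * Complex.exp (-(outputPoint n h v l : ℂ)))
      (2000 * ((r + 1) * 2 ^ r)) := by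
  have emesh : ∀ s' : Memory, s'.num 0 = s.num 0 →
      meshExpr.eval O s' = (h : ℂ) := fun s' e => by
    simp only [meshExpr, NumExpr.eval, IntExpr.eval, e, hh]
  refine Spec.mono (Spec.seq (Q := fun s' => s'.int 11 0 = ⌊1 / 2 - v / h⌋)
    (d := (sizeExpr.cost + 1 + (2 * n + 1) * 10) + (1000 * ((r + 1) * 2 ^ r) +
      ((sizeExpr.cost + 1 + (2 * n + 1) * 30) + ((sizeExpr.cost + 1 + (2 * n + 1) * 50) +
        100 * (2 * n + 1)))))
    (Spec.setFloor ?_) fun s₁ F₁ q₁ => ?_)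
    (fun _ _ h => h) ?_
  · simp only [NumExpr.eval, IntExpr.eval, emesh _ rfl, hv, int_putInt_same]
    have e : (((1 : ℚ) : ℂ) / ((2 : ℚ) : ℂ) - (v : ℂ) / h) = ((1 / 2 - v / h : ℝ) : ℂ) := by
      push_cast; ring
    rw [e, Complex.ofReal_re]
  rotate_left
  · have h1 : 2 * n + 1 ≤ 2 ^ r := by omega
    have h3 : 1 ≤ r + 1 := by omega
    have h4 := Nat.mul_le_mul_right (2 ^ r) h3
    simp only [sizeExpr, meshExpr, IntExpr.cost, NumExpr.cost]
    omega
  have g₁ := hs.frame F₁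
  refine Spec.seq ((Spec.fill (n := 2 * n + 1) (eval_sizeExpr g₁.h0) P ?_).mono
    (fun _ _ h => h.1) ?_) fun s₂ F₂ q₂ => ?_
  · intro i hi s' F' hc _
    simp only [NumExpr.eval, IntExpr.eval, hc]
    rw [F'.numEq 9, F₁.numEq 9, hP i hi]
  · simp only [NumExpr.cost, IntExpr.cost]
    omega
  have g₂ := g₁.frame F₂
  refine Spec.seq (spec_oddFFTProg _ (-1) g₂ hr P q₂) fun s₃ F₃ q₃ => ?_
  have g₃ := g₂.frame F₃
  refine Spec.seq ((Spec.fill (n := 2 * n + 1) (eval_sizeExpr g₃.h0)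
    (fun l => (outputPoint n h v l : ℂ)) ?_).mono
    (fun _ _ h => h.1) ?_) fun s₄ F₄ q₄ => ?_
  · intro i hi s' F' hc _
    simp only [NumExpr.eval, IntExpr.eval, hc, gridExpr, (g₃.frame F').h0]
    rw [emesh _ (by rw [F'.numEq 0, F₃.numEq 0, F₂.numEq 0, F₁.numEq 0]), F'.numEq 12, F₃.numEq 12,
      F₂.numEq 12, F₁.numEq 12, hv, F'.intEq 11, F₃.intEq 11, F₂.intEq 11, q₁, outputPoint]
    push_cast
    rfl
  · simp only [NumExpr.cost, IntExpr.cost, gridExpr, meshExpr]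
    omega
  have g₄ := g₃.frame F₄
  refine Spec.seq ((Spec.fill (n := 2 * n + 1) (eval_sizeExpr g₄.h0)
    (outputProb n h v P) ?_).mono
    (fun _ _ h => h.1) ?_) fun s₅ F₅ q₅ => ?_
  · intro i hi s' F' hc _
    have e0 := (g₄.frame F').h0
    simp only [NumExpr.eval, IntExpr.eval, eval_sizeExpr e0]
    simp only [gridExpr, IntExpr.eval, hc, e0]
    rw [F'.numEq 8, F₄.numEq 8, F'.intEq 11, F₄.intEq 11, F₃.intEq 11, F₂.intEq 11, q₁, outputProb]
    have h1 : 0 ≤ ((i : ℤ) - n + ⌊1 / 2 - v / h⌋) % (2 * n + 1 : ℕ) := Int.emod_nonneg _ (by omega)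
    have h2 : ((i : ℤ) - n + ⌊1 / 2 - v / h⌋) % (2 * n + 1 : ℕ) < (2 * n + 1 : ℕ) :=
      Int.emod_lt_of_pos _ (by omega)
    rw [← q₃ _ (by omega), Int.toNat_of_nonneg h1]
    push_cast
    rfl
  · simp only [NumExpr.cost, IntExpr.cost, gridExpr, sizeExpr]
    omega
  refine (spec_tableProg O (g₄.frame F₅).h0 (fun l => (outputPoint n h v l : ℂ))
    (outputProb n h v P) (fun i hi => ?_) q₅).mono (fun s' F' q => ⟨fun l hl => ⟨?_, ?_⟩, q⟩) le_rfl
  · rw [F₅.numEq 1, q₄ i hi]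
  · rw [F'.numEq 1, F₅.numEq 1, q₄ l hl]
  · rw [F'.numEq 2, q₅ l hl]

/-- The algorithm `ComposePRV`, by means of fast Fourier transforms. -/
def composeProg : Program :=
  .seq lengthProg <|
  .seq (fill 5 sizeExpr 9 (.const 1)) <|
  .seq (.setNum 12 (.const 0) (.const 0)) <|
  .seq (.loop 4 (.get 0 (.const 1)) distProg)
  outputProg

/-- The exponent `r` found by the program is exposed because the cost depends on it. The bound on `m
j` guarantees that `2 r` binary digits suffice for every multiplicity. -/
theorem spec_composeProg (Z : ℕ → Measure EReal) (n b : ℕ) (m : ℕ → ℕ) (h : ℝ)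
    (hn : 0 < n) (hm : ∀ j < b, m j ≤ (n + 1) ^ 2) :
    ∃ r, 2 ^ r ≤ 8 * n + 2 ∧ Spec (oracleOf Z) composeProg (inputMemory n b m h) (fun s' =>
      let v := ∑ j ∈ Finset.range b, m j * offset (Z j) n h
      let P := fun i => ∏ j ∈ Finset.range b, dft (weightSeq (Z j) n h) 1 (2 * n + 1) i ^ m j
      (∀ l < 2 * n + 1, s'.num 1 (l : ℕ) = (outputPoint n h v l : ℂ) ∧
        s'.num 2 (l : ℕ) = outputProb n h v P l) ∧
      ∀ j ≤ 2 * n + 1,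
        s'.num 3 (j : ℕ) = ∑ l ∈ Finset.Ico j (2 * n + 1), outputProb n h v P l ∧
        s'.num 4 (j : ℕ) = ∑ l ∈ Finset.Ico j (2 * n + 1),
          outputProb n h v P l * Complex.exp (-(outputPoint n h v l : ℂ)))
      (5000 * ((b + 1) * ((r + 1) * 2 ^ r))) := by
  set s := inputMemory n b m h
  have h0 : s.int 0 0 = n := by simp [s, inputMemory]
  have hb : s.int 0 1 = b := by simp [s, inputMemory]
  have hh : s.num 0 0 = (h : ℂ) := by simp [s, inputMemory]
  have h1 : ∀ j < b, s.int 1 j = m j := fun j hj => by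
    simp [s, inputMemory]
    omega
  have key := spec_lengthProg (oracleOf Z) h0
  obtain ⟨⟨r, g₁, hr, hr'⟩, hcost⟩ := key
  refine ⟨r, hr', ?_⟩
  have key : Spec (oracleOf Z) lengthProg s (fun s' => Sizes s' n r) (200 * (n + 1)) := ⟨g₁, hcost⟩
  refine Spec.mono (Spec.seq key
    (d := (20 + (2 * n + 1) * 5) + (10 + ((3 + b * (2000 * ((r + 1) * 2 ^ r) + 1)) +
      2000 * ((r + 1) * 2 ^ r)))) fun s₁ F₁ g₁ => ?_)
    (fun _ _ h => h) ?_
  rotate_left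
  · have h1 : 2 * n + 1 ≤ 2 ^ r := by omega
    have h3 : 1 ≤ r + 1 := by omega
    have h4 := Nat.mul_le_mul_right (2 ^ r) h3
    generalize (r + 1) * 2 ^ r = T at *
    have h5 : 1 ≤ T := by omega
    have h6 := Nat.mul_le_mul_left b h5
    have e1 : b * (2000 * T + 1) = 2000 * (b * T) + b := by ring
    have e2 : 5000 * ((b + 1) * T) = 5000 * (b * T) + 5000 * T := by ring
    omega
  refine Spec.seq ((Spec.fill (n := 2 * n + 1) (eval_sizeExpr g₁.h0) (fun _ => 1) ?_).mono
    (fun _ _ h => h.1) ?_) fun s₂ F₂ q₂ => ?_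
  · intro i hi s' F' hc _
    simp [NumExpr.eval]
  · simp only [NumExpr.cost, IntExpr.cost, sizeExpr]
    omega
  have g₂ := g₁.frame F₂
  refine Spec.seq ((Spec.setNum (Q := fun s' => s'.num 12 0 = 0) ?_).mono (fun _ _ h => h) ?_)
    fun s₃ F₃ q₃ => ?_
  · simp [NumExpr.eval, IntExpr.eval]
  · simp [NumExpr.cost, IntExpr.cost]
  have g₃ := g₂.frame F₃
  refine Spec.seq (Spec.loop (n := b)
    (fun x s' => s'.num 12 0 = ((∑ j ∈ Finset.range x, m j * offset (Z j) n h : ℝ) : ℂ) ∧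
      ∀ i < 2 * n + 1, s'.num 9 (i : ℕ) =
        ∏ j ∈ Finset.range x, dft (weightSeq (Z j) n h) 1 (2 * n + 1) i ^ m j)
    ?_ _ ?_ ?_) fun s₄ F₄ q₄ => ?_
  · simp only [IntExpr.eval]
    rw [F₃.intEq 0, F₂.intEq 0, F₁.intEq 0, hb]
  · refine ⟨by simpa using q₃, fun i hi => ?_⟩
    rw [F₃.numEq 9, q₂ i hi]
    simp
  · rintro x hx s' F' ⟨p12, p9⟩
    have F'' := F'.trans (Frame.putInt s' 4 0 x List.mem_cons_self)
    refine (spec_distProg Z (h := h) (g₃.frame F'') hr ?_ (int_putInt_same _ _ _ _) (m := m x) ?_ ?_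
      (v := ((∑ j ∈ Finset.range x, m j * offset (Z j) n h : ℝ) : ℂ)) ?_
      (fun i => ∏ j ∈ Finset.range x, dft (weightSeq (Z j) n h) 1 (2 * n + 1) i ^ m j) ?_).mono
      (fun s'' _ q => ⟨?_, fun i hi => ?_⟩) le_rfl
    · rw [F''.numEq 0, F₃.numEq 0, F₂.numEq 0, F₁.numEq 0, hh]
    · rw [F''.intEq 1, F₃.intEq 1, F₂.intEq 1, F₁.intEq 1, h1 x hx]
    -- Since `n > 0`, `n + 1 < 4 n + 1 ≤ 2 ^ r`, and squaring gives the required bound on the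
    -- exponent.
    · refine (hm x hx).trans_lt ?_
      rw [mul_comm 2 r, pow_mul]

      exact Nat.pow_lt_pow_left (by omega) (by decide)
    · rw [num_putInt, p12]
    · intro i hi
      rw [num_putInt, p9 i hi]
    · rw [q.1, Finset.sum_range_succ]
      push_cast
      rfl
    · rw [q.2 i hi, Finset.prod_range_succ]
  refine (spec_outputProg _ (g₃.frame F₄) hr ?_ q₄.1 _ q₄.2).mono (fun _ _ h => h) le_rfl
  rw [F₄.numEq 0, F₃.numEq 0, F₂.numEq 0, F₁.numEq 0, hh]

/-! ## Correctness of the program -/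

theorem continuous_ec : Continuous ec := by unfold ec; fun_prop

theorem continuous_ec_mul (a : ℝ) : Continuous fun x : ℝ => ec ((a * x : ℝ) : ℂ) :=
  continuous_ec.comp (by fun_prop)

theorem integral_ec_sumLaw (ν : ℕ → Measure ℝ) (k : ℕ) (h : ∀ i < k, ν i Set.univ ≤ 1) (a : ℝ) :
    ∫ x : ℝ, ec ((a * x : ℝ) : ℂ) ∂(sumLaw ν k) =
      ∏ i ∈ Finset.range k, ∫ x : ℝ, ec ((a * x : ℝ) : ℂ) ∂(ν i) := by
  induction k with
  | zero => simp [sumLaw, ec_zero]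
  | succ k ih =>
    have := isFiniteMeasure_of_univ_le_one (sumLaw_univ_le ν k fun i hi => h i (by omega))
    have := isFiniteMeasure_of_univ_le_one (h k (by omega))
    rw [sumLaw, integral_map measurable_fst_add_snd.aemeasurable
      (continuous_ec_mul _).aestronglyMeasurable, Finset.prod_range_succ,
      ← ih fun i hi => h i (by omega), ← integral_prod_mul]
    refine integral_congr_ae (Filter.Eventually.of_forall fun p => ?_)
    dsimp only
    rw [← ec_add]
    congr 1
    push_cast
    ring

/-- At the frequencies `f / (2L)` with integer `f` the character has period `2L`, so it does not
notice the reduction. -/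
theorem ec_circMod {L : ℝ} (hL : L ≠ 0) (f : ℕ) (x : ℝ) :
    ec ((f / (2 * L) * circMod L x : ℝ) : ℂ) = ec ((f / (2 * L) * x : ℝ) : ℂ) := by
  rw [circMod, ← ec_add_int _ (f * ⌈(x - L) / (2 * L)⌉)]
  congr 1
  have hL' : (L : ℂ) ≠ 0 := by exact_mod_cast hL
  push_cast
  field_simp
  ring

theorem integral_ec_circSumLaw {L : ℝ} (hL : 0 < L) (ν : ℕ → Measure ℝ) (k : ℕ)
    (h : ∀ i < k, ν i Set.univ ≤ 1) (f : ℕ) :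
    ∫ x : ℝ, ec ((f / (2 * L) * x : ℝ) : ℂ) ∂(circSumLaw L ν k) =
      ∏ i ∈ Finset.range k, ∫ x : ℝ, ec ((f / (2 * L) * x : ℝ) : ℂ) ∂(ν i) := by
  rw [circSumLaw_eq_map hL ν k h, integral_map (measurable_circMod L).aemeasurable
    (continuous_ec_mul _).aestronglyMeasurable]
  simp_rw [ec_circMod hL.ne']
  exact integral_ec_sumLaw ν k h _

/-- As `2L = (2n + 1) h`, the characteristic function at `f / (2L)` is a phase from the leftmost
point times a discrete Fourier transform of the weights. -/
theorem integral_ec_discretizePRV (Y : Measure EReal) [IsProbabilityMeasure Y] {n : ℕ} {h : ℝ}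
    (hh : 0 < h) (f : ℕ) :
    ∫ x : ℝ, ec ((f / (2 * (h / 2 + n * h)) * x : ℝ) : ℂ) ∂(discretizePRV Y (h / 2 + n * h) n h) =
      ec ((f / (2 * (h / 2 + n * h)) * offset Y n h : ℝ) : ℂ) *
        dft (weightSeq Y n h) 1 (2 * n + 1) f := by
  have hh' : (h : ℂ) ≠ 0 := by exact_mod_cast hh.ne'
  have hN : (2 * (n : ℂ) + 1) ≠ 0 := by exact_mod_cast (show 2 * n + 1 ≠ 0 by omega)
  have hd : (2 : ℂ) * (h / 2 + n * h) = (2 * n + 1) * h := by ring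
  rw [discretizePRV, integral_finsetSum_measure fun i _ =>
    (integrable_dirac (by simp [enorm])).smul_measure ENNReal.ofReal_ne_top,
    sum_Icc_eq_sum_range, dft, Finset.mul_sum]
  refine Finset.sum_congr rfl fun t _ => ?_
  rw [integral_smul_measure, integral_dirac, ENNReal.toReal_ofReal (weight_nonneg hh n _),
    Complex.real_smul, weightSeq, mul_left_comm, ← ec_add]
  congr 2
  rw [offset]
  push_cast
  rw [hd]
  field_simp
  ring

theorem ae_mem_discretizePRV (Y : Measure EReal) (n : ℕ) (h : ℝ) :
    ∀ᵐ x ∂(discretizePRV Y (h / 2 + n * h) n h), ∃ t : ℤ, x = offset Y n h + t * h := by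
  have hm : MeasurableSet {x : ℝ | ∃ t : ℤ, x = offset Y n h + t * h} := by
    have : {x : ℝ | ∃ t : ℤ, x = offset Y n h + t * h} =
        Set.range fun t : ℤ => offset Y n h + t * h := by
      ext x; exact exists_congr fun t => eq_comm
    rw [this]
    exact (Set.countable_range _).measurableSet
  rw [ae_iff, ← Set.compl_ofPred, discretizePRV, Measure.finsetSum_apply]
  refine Finset.sum_eq_zero fun i _ => ?_
  rw [Measure.smul_apply, Measure.dirac_apply' _ hm.compl, Set.indicator_of_notMem, smul_zero]
  rw [Set.notMem_compl_iff]
  refine ⟨i + n, ?_⟩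
  rw [offset]
  push_cast
  ring

theorem ae_mem_sumLaw (ν : ℕ → Measure ℝ) (v : ℕ → ℝ) (h : ℝ) (k : ℕ)
    (hν : ∀ i < k, ν i Set.univ ≤ 1)
    (hv : ∀ i < k, ∀ᵐ x ∂(ν i), ∃ t : ℤ, x = v i + t * h) :
    ∀ᵐ x ∂(sumLaw ν k), ∃ t : ℤ, x = ∑ i ∈ Finset.range k, v i + t * h := by
  induction k with
  | zero =>
    rw [sumLaw, ae_dirac_eq]
    exact ⟨0, by simp⟩
  | succ k ih =>
    have := isFiniteMeasure_of_univ_le_one (sumLaw_univ_le ν k fun i hi => hν i (by omega))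
    have := isFiniteMeasure_of_univ_le_one (hν k (by omega))
    have hm : MeasurableSet {x : ℝ | ∃ t : ℤ, x = ∑ i ∈ Finset.range (k + 1), v i + t * h} := by
      have : {x : ℝ | ∃ t : ℤ, x = ∑ i ∈ Finset.range (k + 1), v i + t * h} =
          Set.range fun t : ℤ => ∑ i ∈ Finset.range (k + 1), v i + t * h := by
        ext x; exact exists_congr fun t => eq_comm
      rw [this]
      exact (Set.countable_range _).measurableSet
    rw [sumLaw, ae_map_iff measurable_fst_add_snd.aemeasurable hm]
    have h1 := Measure.quasiMeasurePreserving_fst (μ := sumLaw ν k) (ν := ν k) |>.ae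
      (ih (fun i hi => hν i (by omega)) fun i hi => hv i (by omega))
    have h2 := Measure.quasiMeasurePreserving_snd (μ := sumLaw ν k) (ν := ν k) |>.ae
      (hv k (by omega))
    filter_upwards [h1, h2] with p h1 h2
    obtain ⟨t, ht⟩ := h1
    obtain ⟨u, hu⟩ := h2
    refine ⟨t + u, ?_⟩
    rw [ht, hu, Finset.sum_range_succ]
    push_cast
    ring

theorem circMod_mem {L : ℝ} (hL : 0 < L) (x : ℝ) : -L < circMod L x ∧ circMod L x ≤ L := by
  have h1 := Int.le_ceil ((x - L) / (2 * L))
  have h2 := Int.ceil_lt_add_one ((x - L) / (2 * L))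
  rw [div_le_iff₀ (by positivity)] at h1
  rw [← sub_lt_iff_lt_add, lt_div_iff₀ (by positivity)] at h2
  unfold circMod
  constructor <;> linarith

/-- A shift by a multiple of the mesh size moves `v` to `(-h / 2, h / 2]`. -/
theorem add_floor_mul_mem {h : ℝ} (hh : 0 < h) (v : ℝ) :
    v + ⌊1 / 2 - v / h⌋ * h ∈ Set.Ioc (-(h / 2)) (h / 2) := by
  have h1 := Int.floor_le (1 / 2 - v / h)
  have h2 := Int.lt_floor_add_one (1 / 2 - v / h)
  have e : v / h * h = v := div_mul_cancel₀ _ hh.ne'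
  have h1' := mul_le_mul_of_nonneg_right h1 hh.le
  have h2' := mul_lt_mul_of_pos_right h2 hh
  constructor <;> nlinarith

theorem outputPoint_eq (n : ℕ) (h v : ℝ) (l : ℕ) :
    outputPoint n h v l = (v + ⌊1 / 2 - v / h⌋ * h) + ((l : ℝ) - n) * h := by
  rw [outputPoint]
  push_cast
  ring

theorem strictMono_outputPoint (n : ℕ) {h : ℝ} (hh : 0 < h) (v : ℝ) :
    StrictMono (outputPoint n h v) := fun i j hij => by
  rw [outputPoint_eq, outputPoint_eq]
  have : (i : ℝ) < j := by exact_mod_cast hij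
  nlinarith

/-- Both `x` and the moved offset lie in windows whose half-open ends are arranged so that their
distance is strictly less than `(n + 1) h`. This leaves `2 n + 1` possible indices. -/
theorem exists_outputPoint {n : ℕ} {h : ℝ} (hh : 0 < h) {v x : ℝ} (t : ℤ) (hx : x = v + t * h)
    (h1 : -(h / 2 + n * h) < x) (h2 : x ≤ h / 2 + n * h) :
    ∃ l < 2 * n + 1, x = outputPoint n h v l := by
  obtain ⟨m1, m2⟩ := add_floor_mul_mem hh v
  set F := ⌊1 / 2 - v / h⌋ with hF
  have d1 : ((t - F : ℤ) : ℝ) * h < (n + 1 : ℤ) * h := by push_cast; nlinarith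
  have d2 : (-(n + 1 : ℤ) : ℤ) * h < ((t - F : ℤ) : ℝ) * h := by push_cast; nlinarith
  have d1' : t - F < n + 1 := by exact_mod_cast lt_of_mul_lt_mul_right d1 hh.le
  have d2' : -(n + 1 : ℤ) < t - F := by exact_mod_cast lt_of_mul_lt_mul_right d2 hh.le
  refine ⟨(t - F + n).toNat, by omega, ?_⟩
  rw [outputPoint, Int.toNat_of_nonneg (by omega), ← hF, hx]
  push_cast
  ring

/-- Reduction subtracts multiples of `2L = (2n + 1) h`, hence keeps the sum on the grid through the
total offset. -/
theorem composePRV_mem_grid (Y : ℕ → Measure EReal) [∀ i, IsProbabilityMeasure (Y i)] (k n : ℕ)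
    {h : ℝ} (hh : 0 < h) :
    ∀ᵐ x ∂(composePRV Y k (h / 2 + n * h) n h), ∃ l < 2 * n + 1,
      x = outputPoint n h (∑ i ∈ Finset.range k, offset (Y i) n h) l := by
  have hL : 0 < h / 2 + n * h := by positivity
  have hm : MeasurableSet {x : ℝ | ∃ l < 2 * n + 1,
      x = outputPoint n h (∑ i ∈ Finset.range k, offset (Y i) n h) l} := by
    refine Set.Countable.measurableSet ((Set.countable_range
      (outputPoint n h (∑ i ∈ Finset.range k, offset (Y i) n h))).mono ?_)
    rintro x ⟨l, -, rfl⟩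
    exact Set.mem_range_self l
  have hu : ∀ i < k, discretizePRV (Y i) (h / 2 + n * h) n h Set.univ ≤ 1 :=
    fun i _ => discretizePRV_univ_le hh _ n
  rw [composePRV, circSumLaw_eq_map hL _ k hu, ae_map_iff (measurable_circMod _).aemeasurable hm]
  filter_upwards [ae_mem_sumLaw _ (fun i => offset (Y i) n h) h k hu
    fun i _ => ae_mem_discretizePRV (Y i) n h] with x ⟨t, ht⟩
  refine exists_outputPoint hh (t - (2 * n + 1) * ⌈(x - (h / 2 + n * h)) / (2 * (h / 2 + n * h))⌉)
    ?_ (circMod_mem hL x).1 (circMod_mem hL x).2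
  rw [circMod]
  push_cast
  rw [ht]
  ring

theorem eq_sum_dirac {ν : Measure ℝ} [IsFiniteMeasure ν] {N : ℕ} {y : ℕ → ℝ}
    (hy : Function.Injective y) (h : ∀ᵐ x ∂ν, ∃ l < N, x = y l) :
    ν = ∑ l ∈ Finset.range N, ENNReal.ofReal (ν.real {y l}) • Measure.dirac (y l) := by
  ext S hS
  have h1 : ν S = ν (⋃ l ∈ Finset.range N, S ∩ {y l}) := by
    refine measure_congr ?_
    filter_upwards [h] with x ⟨l, hl, hx⟩
    refine propext ⟨fun hxS => ?_, fun hxS => ?_⟩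
    · exact Set.mem_biUnion (Finset.mem_range.mpr hl) ⟨hxS, hx⟩
    · obtain ⟨l, _, hxl⟩ := Set.mem_iUnion₂.mp hxS
      exact hxl.1
  rw [h1, measure_biUnion_finset, Measure.finsetSum_apply]
  · refine Finset.sum_congr rfl fun l _ => ?_
    rw [Measure.smul_apply, Measure.dirac_apply' _ hS, ofReal_measureReal]
    by_cases hl : y l ∈ S
    · rw [Set.inter_eq_right.mpr (Set.singleton_subset_iff.mpr hl), Set.indicator_of_mem hl]
      simp
    · rw [Set.inter_singleton_eq_empty.mpr hl, Set.indicator_of_notMem hl]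
      simp
  · intro i _ j _ hij
    refine Set.disjoint_left.mpr ?_
    rintro x ⟨_, hx⟩ ⟨_, hx'⟩
    exact hij (hy ((Set.mem_singleton_iff.mp hx).symm.trans (Set.mem_singleton_iff.mp hx')))
  · exact fun l _ => hS.inter (measurableSet_singleton _)

theorem integral_sum_dirac {E : Type*} [NormedAddCommGroup E] [NormedSpace ℝ E] [CompleteSpace E]
    {N : ℕ} {p y : ℕ → ℝ} (hp : ∀ l < N, 0 ≤ p l) (f : ℝ → E) :
    ∫ x, f x ∂(∑ l ∈ Finset.range N, ENNReal.ofReal (p l) • Measure.dirac (y l)) =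
      ∑ l ∈ Finset.range N, p l • f (y l) := by
  rw [integral_finsetSum_measure fun i _ =>
    (integrable_dirac (by simp [enorm])).smul_measure ENNReal.ofReal_ne_top]
  refine Finset.sum_congr rfl fun l hl => ?_
  rw [integral_smul_measure, integral_dirac,
    ENNReal.toReal_ofReal (hp l (Finset.mem_range.mp hl))]

/-- Fourier inversion on a window of the integers. -/
theorem dft_neg_one_window {N : ℕ} (p : ℕ → ℂ) (g : ℤ) (P : ℕ → ℂ)
    (hP : ∀ f < N, P f = ∑ l ∈ Finset.range N, p l * ec (f * ((l : ℤ) + g : ℤ) / N)) {l : ℕ}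
    (hl : l < N) :
    dft P (-1) N (((l : ℤ) + g) % N).toNat = N * p l := by
  have hN : 0 < N := by omega
  have hN' : (N : ℂ) ≠ 0 := by exact_mod_cast hN.ne'
  set i := (((l : ℤ) + g) % N).toNat with hi
  have hi' : (i : ℤ) = ((l : ℤ) + g) % N := Int.toNat_of_nonneg (Int.emod_nonneg _ (by omega))
  have hdiv : (N : ℤ) ∣ (l + g) - i := by
    rw [hi']; exact Int.dvd_self_sub_emod
  -- Modulo `N` the index `i` represents `l + g`. By orthogonality only `l' ≡ l` survives, and
  -- inside a window of length `N` this means `l' = l`.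
  have key : ∀ l' < N, (∑ f ∈ Finset.range N,
      ec ((((l' : ℤ) + g - i : ℤ) : ℂ) * f / N)) = if l' = l then (N : ℂ) else 0 := by
    intro l' hl'
    rw [sum_ec hN]
    refine if_congr ⟨fun h => ?_, ?_⟩ rfl rfl
    · have h3 : (N : ℤ) ∣ (l' : ℤ) - l := by
        have := dvd_sub h hdiv
        rwa [show (l' : ℤ) + g - i - (l + g - i) = l' - l by ring] at this
      have := Int.eq_zero_of_abs_lt_dvd h3 (by rw [abs_lt]; constructor <;> omega)
      omega
    · rintro rfl
      exact hdiv
  calc dft P (-1) N i = ∑ f ∈ Finset.range N, ∑ l' ∈ Finset.range N,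
        p l' * ec ((((l' : ℤ) + g - i : ℤ) : ℂ) * f / N) := by
        refine Finset.sum_congr rfl fun f hf => ?_
        rw [hP f (Finset.mem_range.mp hf), Finset.sum_mul]
        refine Finset.sum_congr rfl fun l' _ => ?_
        rw [mul_assoc, ← ec_add]
        congr 2
        push_cast
        ring
    _ = ∑ l' ∈ Finset.range N, p l' * if l' = l then (N : ℂ) else 0 := by
        rw [Finset.sum_comm]
        refine Finset.sum_congr rfl fun l' hl' => ?_
        rw [← Finset.mul_sum, key l' (Finset.mem_range.mp hl')]
    _ = N * p l := by
        simp [hl, mul_comm]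

/-- The characteristic function of the output at `f / (2L)` is computed from its atoms and as a
product over the summands. Cancelling the phase of the total offset leaves a discrete transform,
which is then inverted. -/
theorem composePRV_real_singleton (Y : ℕ → Measure EReal) [∀ i, IsProbabilityMeasure (Y i)]
    (k n : ℕ) {h : ℝ} (hh : 0 < h) {l : ℕ} (hl : l < 2 * n + 1) :
    let v := ∑ i ∈ Finset.range k, offset (Y i) n h
    (((composePRV Y k (h / 2 + n * h) n h).real {outputPoint n h v l} : ℝ) : ℂ) =
      outputProb n h v
        (fun f => ∏ i ∈ Finset.range k, dft (weightSeq (Y i) n h) 1 (2 * n + 1) f) l := by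
  intro v
  have hL : 0 < h / 2 + n * h := by positivity
  have hu : ∀ i < k, discretizePRV (Y i) (h / 2 + n * h) n h Set.univ ≤ 1 :=
    fun i _ => discretizePRV_univ_le hh _ n
  have hfin : IsFiniteMeasure (composePRV Y k (h / 2 + n * h) n h) := by
    have := isFiniteMeasure_of_univ_le_one (sumLaw_univ_le _ k hu)
    rw [composePRV, circSumLaw_eq_map hL _ k hu]
    infer_instance
  have hdirac := eq_sum_dirac (strictMono_outputPoint n hh v).injective
    (composePRV_mem_grid Y k n hh)
  set ν := composePRV Y k (h / 2 + n * h) n h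
  have hN : ((2 * n + 1 : ℕ) : ℂ) ≠ 0 := by exact_mod_cast (show 2 * n + 1 ≠ 0 by omega)
  have hN' : (2 * (n : ℂ) + 1) ≠ 0 := by exact_mod_cast (show 2 * n + 1 ≠ 0 by omega)
  have hh' : (h : ℂ) ≠ 0 := by exact_mod_cast hh.ne'
  have hd : (2 : ℂ) * (h / 2 + n * h) = (2 * n + 1) * h := by ring
  have hP : ∀ f < 2 * n + 1,
      ∏ i ∈ Finset.range k, dft (weightSeq (Y i) n h) 1 (2 * n + 1) f =
      ∑ l ∈ Finset.range (2 * n + 1), ((ν.real {outputPoint n h v l} : ℝ) : ℂ) *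
        ec (f * ((l : ℤ) + (⌊1 / 2 - v / h⌋ - n) : ℤ) / (2 * n + 1 : ℕ)) := by
    intro f _
    have e1 := integral_ec_circSumLaw hL _ k hu f
    change ∫ x : ℝ, _ ∂ν = _ at e1
    simp_rw [integral_ec_discretizePRV _ hh] at e1
    rw [Finset.prod_mul_distrib, hdirac,
      integral_sum_dirac fun _ _ => measureReal_nonneg] at e1
    have e2 : ∏ i ∈ Finset.range k, ec ((f / (2 * (h / 2 + n * h)) * offset (Y i) n h : ℝ) : ℂ) =
        ec ((f / (2 * (h / 2 + n * h)) * v : ℝ) : ℂ) := by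
      have : ∀ m, ∏ i ∈ Finset.range m, ec ((f / (2 * (h / 2 + n * h)) * offset (Y i) n h : ℝ) : ℂ)
          = ec ((f / (2 * (h / 2 + n * h)) * ∑ i ∈ Finset.range m, offset (Y i) n h : ℝ) : ℂ) := by
        intro m
        induction m with
        | zero => simp [ec_zero]
        | succ m ih =>
          rw [Finset.prod_range_succ, ih, Finset.sum_range_succ, ← ec_add]
          congr 1
          push_cast
          ring
      exact this k
    rw [e2] at e1
    -- Multiplication by the inverse phase makes all exponents integers over `2 n + 1`.
    have e3 : ec ((-(f / (2 * (h / 2 + n * h)) * v) : ℝ) : ℂ) *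
        ec ((f / (2 * (h / 2 + n * h)) * v : ℝ) : ℂ) = 1 := by
      rw [← ec_add, ← Complex.ofReal_add, neg_add_cancel, Complex.ofReal_zero, ec_zero]
    rw [← one_mul (∏ i ∈ Finset.range k, _), ← e3, mul_assoc, ← e1, Finset.mul_sum]
    refine Finset.sum_congr rfl fun l _ => ?_
    rw [Complex.real_smul, mul_left_comm, ← ec_add]
    congr 2
    rw [outputPoint]
    push_cast
    rw [hd]
    field_simp
    ring
  have := dft_neg_one_window _ _ _ hP hl
  rw [outputProb, eq_div_iff hN, show (l : ℤ) - n + ⌊1 / 2 - v / h⌋ =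
    l + (⌊1 / 2 - v / h⌋ - n) by ring, this, mul_comm]

/-! ### Reading the curve off the tables. -/

theorem setOf_lt_and_le_eq {N : ℕ} {y : ℕ → ℝ} (hy : StrictMono y) (ε : ℝ) :
    ∃ j ≤ N, {l : ℕ | l < N ∧ y l ≤ ε} = {l | l < j} := by
  classical
  have hex : ∃ l, ¬(l < N ∧ y l ≤ ε) := ⟨N, fun h => lt_irrefl _ h.1⟩
  refine ⟨Nat.find hex, Nat.find_le fun h => lt_irrefl _ h.1, Set.ext fun l => ⟨fun h => ?_, fun h => ?_⟩⟩
  · by_contra hl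
    have hle : Nat.find hex ≤ l := not_lt.mp hl
    exact Nat.find_spec hex ⟨hle.trans_lt h.1, (hy.monotone hle).trans h.2⟩
  · exact not_not.mp (Nat.find_min hex h)

/-- The hinge vanishes at points up to `ε`. Since the points increase, the others are exactly those
with index at least `j`, where the hinge is `1 - e^ε e^{-y}`. -/
theorem deltaOf_sum_dirac {N : ℕ} {p y : ℕ → ℝ} (hp : ∀ l < N, 0 ≤ p l) (hy : StrictMono y)
    (ε : ℝ) {j : ℕ} (hj : j = Set.ncard {l : ℕ | l < N ∧ y l ≤ ε}) :
    j ≤ N ∧ deltaOf (∑ l ∈ Finset.range N, ENNReal.ofReal (p l) • Measure.dirac (y l)) ε =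
      ∑ l ∈ Finset.Ico j N, p l - Real.exp ε * ∑ l ∈ Finset.Ico j N, p l * Real.exp (-(y l)) := by
  obtain ⟨i, hi, hset⟩ := setOf_lt_and_le_eq (N := N) hy ε
  have hji : j = i := by
    rw [hj, hset, show {l : ℕ | l < i} = (Finset.range i : Set ℕ) by ext; simp,
      Set.ncard_coe_finset, Finset.card_range]
  subst hji
  refine ⟨hi, ?_⟩
  rw [deltaOf, integral_sum_dirac hp, ← Finset.sum_range_add_sum_Ico _ hi, Finset.sum_eq_zero,
    zero_add, Finset.mul_sum, ← Finset.sum_sub_distrib]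
  · refine Finset.sum_congr rfl fun l hl => ?_
    rw [Finset.mem_Ico] at hl
    have hlt : ε < y l := by
      by_contra h
      have : l ∈ {l : ℕ | l < j} := hset ▸ ⟨hl.2, not_lt.mp h⟩
      exact absurd this (not_lt.mpr hl.1)
    rw [max_eq_left, smul_eq_mul, sub_eq_add_neg ε, Real.exp_add]
    · ring
    · rw [sub_nonneg, Real.exp_le_one_iff]
      linarith
  · intro l hl
    have : l ∈ {l : ℕ | l < N ∧ y l ≤ ε} := hset ▸ Finset.mem_range.mp hl
    rw [max_eq_right, smul_zero]
    rw [sub_nonpos, Real.one_le_exp_iff]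
    linarith [this.2]

/-! ### Multiplicities and the operation count. -/

theorem prod_comp_range {M : Type*} [CommMonoid M] {k b : ℕ} {c : ℕ → ℕ} (hc : ∀ i < k, c i < b)
    (f : ℕ → M) :
    ∏ i ∈ Finset.range k, f (c i) =
      ∏ j ∈ Finset.range b, f j ^ ((Finset.range k).filter fun i => c i = j).card := by
  rw [← Finset.prod_fiberwise_of_maps_to (s := Finset.range k) (t := Finset.range b) (g := c)
    fun i hi => Finset.mem_range.mpr (hc i (Finset.mem_range.mp hi))]
  refine Finset.prod_congr rfl fun j _ => ?_
  rw [← Finset.prod_const]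
  exact Finset.prod_congr rfl fun i hi => by rw [(Finset.mem_filter.mp hi).2]

theorem sum_comp_range {k b : ℕ} {c : ℕ → ℕ} (hc : ∀ i < k, c i < b) (f : ℕ → ℝ) :
    ∑ i ∈ Finset.range k, f (c i) =
      ∑ j ∈ Finset.range b, ((Finset.range k).filter fun i => c i = j).card * f j := by
  rw [← Finset.sum_fiberwise_of_maps_to (s := Finset.range k) (t := Finset.range b) (g := c)
    fun i hi => Finset.mem_range.mpr (hc i (Finset.mem_range.mp hi))]
  refine Finset.sum_congr rfl fun j _ => ?_
  rw [← nsmul_eq_mul, ← Finset.sum_const]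
  exact Finset.sum_congr rfl fun i hi => by rw [(Finset.mem_filter.mp hi).2]

/-- For `δerr ≤ 1` the logarithm is at least 2, so `√k h ≤ εerr ≤ L ≤ (n + 1) h`. The multiplicities
are therefore polynomial in `n`, and repeated squaring stays within the logarithmic factor. -/
theorem le_sq_of_mesh {k n : ℕ} {εerr δerr h L : ℝ} (hk : 0 < k) (hε : 0 < εerr) (hδ : 0 < δerr)
    (hδ1 : δerr ≤ 1) (hh : h = εerr / Real.sqrt ((k : ℝ) / 2 * Real.log (12 / δerr)))
    (hL : L = h / 2 + n * h) (hL2 : 2 + εerr ≤ L) : k ≤ (n + 1) ^ 2 := by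
  have hlog : 2 ≤ Real.log (12 / δerr) := by
    rw [Real.le_log_iff_exp_le (by positivity), le_div_iff₀ hδ]
    have e : Real.exp 2 = Real.exp 1 ^ 2 := by rw [← Real.exp_nat_mul]; norm_num
    have h1 := Real.exp_one_lt_d9
    have h2 : Real.exp 2 ≤ 12 := by
      rw [e]
      nlinarith [Real.exp_pos 1]
    nlinarith [Real.exp_pos 2]
  have hk' : (0 : ℝ) < k := by exact_mod_cast hk
  have hle : (k : ℝ) ≤ (k : ℝ) / 2 * Real.log (12 / δerr) := by nlinarith
  have hs := Real.sqrt_pos.mpr (hk'.trans_le hle)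
  have h0 : 0 < h := by rw [hh]; positivity
  have h1 : Real.sqrt k ≤ n + 1 := by
    refine (Real.sqrt_le_sqrt hle).trans ?_
    have e : Real.sqrt ((k : ℝ) / 2 * Real.log (12 / δerr)) * h = εerr := by
      rw [hh]; field_simp
    have : Real.sqrt ((k : ℝ) / 2 * Real.log (12 / δerr)) * h ≤ (n + 1) * h := by nlinarith
    exact le_of_mul_le_mul_right this h0
  have h2 := (Real.sqrt_le_left (by positivity)).mp h1
  exact_mod_cast h2

theorem cost_le {n b r : ℕ} (hn : 0 < n) (hb : 0 < b) (hr : 2 ^ r ≤ 8 * n + 2) {h : ℝ}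
    (hh : 0 < h) :
    ((5000 * ((b + 1) * ((r + 1) * 2 ^ r)) : ℕ) : ℝ) ≤
      2000000 * (b * ((h / 2 + n * h) / h) * Real.log ((h / 2 + n * h) / h)) := by
  have e : (h / 2 + n * h) / h = n + 1 / 2 := by field_simp; ring
  rw [e]
  have hn' : (1 : ℝ) ≤ n := by exact_mod_cast hn
  have hb' : (1 : ℝ) ≤ b := by exact_mod_cast hb
  have hr' : (2 : ℝ) ^ r ≤ 8 * (n + 1 / 2) := by
    have : (2 : ℝ) ^ r ≤ 8 * n + 2 := by exact_mod_cast hr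
    linarith
  set X : ℝ := n + 1 / 2 with hX
  have hX' : 3 / 2 ≤ X := by linarith
  have l2 := Real.log_two_gt_d9
  have h1 : 1 / 3 ≤ Real.log X := by
    have h1 := Real.one_sub_inv_le_log_of_pos (show (0 : ℝ) < 3 / 2 by norm_num)
    have h2 := Real.log_le_log (by norm_num) hX'
    norm_num at h1
    linarith
  have h2 : r * Real.log 2 ≤ 3 * Real.log 2 + Real.log X := by
    have := Real.log_le_log (by positivity) hr'
    rw [Real.log_pow, Real.log_mul (by norm_num) (by linarith),
      show (8 : ℝ) = 2 ^ 3 by norm_num, Real.log_pow] at this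
    exact_mod_cast this
  -- From `r ≤ 3 + log X / log 2`, with the constant 4 absorbed by `log X ≥ 1 / 3`: `12 + 1 / log 2
  -- < 14`. The final constant then has to exceed `5000 · 2 · 14 · 8`.
  have h3 : (r : ℝ) + 1 ≤ 14 * Real.log X := by nlinarith
  push_cast
  have h4 : ((r : ℝ) + 1) * 2 ^ r ≤ (14 * Real.log X) * (8 * X) :=
    mul_le_mul h3 hr' (by positivity) (by positivity)
  have h5 : ((b : ℝ) + 1) * ((r + 1) * 2 ^ r) ≤ (2 * b) * ((14 * Real.log X) * (8 * X)) :=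
    mul_le_mul (by linarith) h4 (by positivity) (by positivity)
  have h6 : 0 ≤ b * X * Real.log X := by positivity
  nlinarith

/-- The program outputs the law computed by `ComposePRV`. -/
theorem composeProg_correct {k n b : ℕ} {h : ℝ} (hk : 0 < k) (hn : 0 < n) (hh : 0 < h)
    (hkn : k ≤ (n + 1) ^ 2) (Y : ℕ → Measure EReal) [∀ i, IsProbabilityMeasure (Y i)]
    (Z : ℕ → Measure EReal) (c : ℕ → ℕ) (hc : ∀ i < k, c i < b ∧ Y i = Z (c i)) :
    let r := composeProg.run (oracleOf Z)
      (inputMemory n b (fun j => ((Finset.range k).filter (fun i => c i = j)).card) h)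
    HoldsOutput r.1 n h (composePRV Y k (h / 2 + n * h) n h) ∧
      (r.2 : ℝ) ≤ 2000000 * (b * ((h / 2 + n * h) / h) * Real.log ((h / 2 + n * h) / h)) := by
  intro r
  set m := fun j => ((Finset.range k).filter (fun i => c i = j)).card with hm
  have hmle : ∀ j < b, m j ≤ (n + 1) ^ 2 := fun j _ =>
    (Finset.card_filter_le _ _).trans (by rwa [Finset.card_range])
  obtain ⟨ρ, hρ, ⟨hout, htab⟩, hcost⟩ := spec_composeProg Z n b m h hn hmle
  have hb : 0 < b := by have := (hc 0 hk).1; omega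
  refine ⟨?_, le_trans (by exact_mod_cast hcost) (cost_le hn hb hρ hh)⟩
  have hv : ∑ j ∈ Finset.range b, m j * offset (Z j) n h =
      ∑ i ∈ Finset.range k, offset (Y i) n h := by
    rw [hm, ← sum_comp_range (fun i hi => (hc i hi).1) fun j => offset (Z j) n h]
    exact Finset.sum_congr rfl fun i hi => by rw [(hc i (Finset.mem_range.mp hi)).2]
  have hP : (fun f => ∏ j ∈ Finset.range b, dft (weightSeq (Z j) n h) 1 (2 * n + 1) f ^ m j) =
      fun f => ∏ i ∈ Finset.range k, dft (weightSeq (Y i) n h) 1 (2 * n + 1) f := by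
    funext f
    rw [hm, ← prod_comp_range (fun i hi => (hc i hi).1)
      fun j => dft (weightSeq (Z j) n h) 1 (2 * n + 1) f]
    exact Finset.prod_congr rfl fun i hi => by rw [(hc i (Finset.mem_range.mp hi)).2]
  change ∀ l < 2 * n + 1, r.1.num 1 l = _ ∧ r.1.num 2 l = _ at hout
  change ∀ j ≤ 2 * n + 1, r.1.num 3 j = _ ∧ r.1.num 4 j = _ at htab
  rw [hv, hP] at hout htab
  have hL : 0 < h / 2 + n * h := by positivity
  have hu : ∀ i < k, discretizePRV (Y i) (h / 2 + n * h) n h Set.univ ≤ 1 :=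
    fun i _ => discretizePRV_univ_le hh _ n
  have hfin : IsFiniteMeasure (composePRV Y k (h / 2 + n * h) n h) := by
    have := isFiniteMeasure_of_univ_le_one (sumLaw_univ_le _ k hu)
    rw [composePRV, circSumLaw_eq_map hL _ k hu]
    infer_instance
  set v := ∑ i ∈ Finset.range k, offset (Y i) n h with hvdef
  set y := outputPoint n h v
  set p : ℕ → ℝ := fun l => (composePRV Y k (h / 2 + n * h) n h).real {y l}
  have hmono : StrictMono y := strictMono_outputPoint n hh v
  have hdirac := eq_sum_dirac hmono.injective (composePRV_mem_grid Y k n hh)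
  have hprob : ∀ l < 2 * n + 1, (p l : ℂ) = outputProb n h v
      (fun f => ∏ i ∈ Finset.range k, dft (weightSeq (Y i) n h) 1 (2 * n + 1) f) l :=
    fun l hl => composePRV_real_singleton Y k n hh hl
  refine ⟨v + ⌊1 / 2 - v / h⌋ * h, y, p,
    fun j => ∑ l ∈ Finset.Ico j (2 * n + 1), p l,
    fun j => ∑ l ∈ Finset.Ico j (2 * n + 1), p l * Real.exp (-(y l)),
    add_floor_mul_mem hh v, outputPoint_eq n h v, fun j hj => ⟨measureReal_nonneg, (hout j hj).1, ?_⟩,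
    fun j hj => ⟨?_, ?_⟩, hdirac, fun ε j hj => ?_⟩
  · rw [(hout j hj).2, hprob j hj]
  · rw [(htab j hj).1, Complex.ofReal_sum]
    exact Finset.sum_congr rfl fun l hl => (hprob l (Finset.mem_Ico.mp hl).2).symm
  · rw [(htab j hj).2, Complex.ofReal_sum]
    refine Finset.sum_congr rfl fun l hl => ?_
    rw [← hprob l (Finset.mem_Ico.mp hl).2]
    push_cast
    rfl
  · rw [hdirac]
    exact (deltaOf_sum_dirac (fun _ _ => measureReal_nonneg) hmono ε hj).2

end

end DPCompose

/-! ### Assembly of the theorem. -/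

open DPCompose MeasureTheory ProbabilityTheory
theorem mainTheorem1 :
    ∃ (prog : Program) (C : ℝ),
      ∀ (k : ℕ) (εerr δerr : ℝ), 0 < k → 0 < εerr → 0 < δerr → δerr < 12 →
      -- the algorithms `M i`, with the neighbouring relation `Nb` of databases
      ∀ {𝒟 : Type*} (Nb : 𝒟 → 𝒟 → Prop), (∀ D D', Nb D D' → Nb D' D) →
      ∀ {Ω : ℕ → Type*} [∀ i, MeasurableSpace (Ω i)]
        (M : ∀ i, 𝒟 → Kernel (Hist Ω i) (Ω i)) [∀ i D, IsMarkovKernel (M i D)]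
        -- their privacy curves, and the PRVs of these curves
        (δ : ℕ → ℝ → ℝ) (X Y : ℕ → Measure EReal)
        [∀ i, IsProbabilityMeasure (X i)] [∀ i, IsProbabilityMeasure (Y i)],
      HaveCurves Nb M k δ →
      (∀ i < k, IsPRV (X i) (Y i) (δ i)) →
      -- neighbouring is symmetric, so the curve is the same in both orders
      (∀ i < k, ∀ ε, privacyCurve (Y i) (X i) ε = δ i ε) →
      (∀ i < k, Y i {⊤} = 0) →
      ∀ (n : ℕ) (h L : ℝ), 0 < n →
      h = εerr / Real.sqrt ((k : ℝ) / 2 * Real.log (12 / δerr)) →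
      L = h / 2 + n * h →
      2 + εerr ≤ L →
      ∑ i ∈ Finset.range k, δ i (L - 2) ≤ δerr / 8 →
      composedCurve X Y k (L - 2 - εerr) ≤ δerr / 4 →
      -- `composedCurve X Y k` is the privacy curve of the adaptive composition
      (∀ ε, IsDP Nb (fun D => composeLaw (fun i => M i D) k) ε (composedCurve X Y k ε)) ∧
      (∃ (Ω' : ℕ → Type) (_ : ∀ i, MeasurableSpace (Ω' i))
          (N : ∀ i, Bool → Kernel (Hist Ω' i) (Ω' i)),
        (∀ i D, IsMarkovKernel (N i D)) ∧
        HaveCurves (fun D D' => D ≠ D') N k δ ∧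
        ∀ ε, privacyCurve (composeLaw (fun i => N i false) k)
          (composeLaw (fun i => N i true) k) ε = composedCurve X Y k ε) ∧
      -- accuracy
      (∀ ε,
        deltaOf (composePRV Y k L n h) (ε + εerr) - δerr
            ≤ deltaOf (sumLaw (fun i => realLaw (Y i)) k) ε ∧
        deltaOf (sumLaw (fun i => realLaw (Y i)) k) ε = composedCurve X Y k ε ∧
        composedCurve X Y k ε ≤ deltaOf (composePRV Y k L n h) (ε - εerr) + δerr) ∧
      -- running time; `Z 0, …, Z (b - 1)` are the distinct PRVs among the `Y i`
      (δerr ≤ 1 →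
        ∀ (b : ℕ) (Z : ℕ → Measure EReal) (c : ℕ → ℕ),
        (∀ i < k, c i < b ∧ Y i = Z (c i)) →
        ∀ r : Memory × ℕ,
        r = prog.run (oracleOf Z)
          (inputMemory n b (fun j => ((Finset.range k).filter (fun i => c i = j)).card) h) →
        HoldsOutput r.1 n h (composePRV Y k L n h) ∧
        (r.2 : ℝ) ≤ C * (b * (L / h) * Real.log (L / h))) := by
  refine ⟨composeProg, 2000000, ?_⟩
  intro k εerr δerr hk hε hδ hδ' 𝒟 Nb hNb Ω _ M _ δ X Y _ _ hM hprv h₂ htop n h L hn hh hL hL2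
    hsum hcomp
  have h₁ : ∀ i < k, ∀ ε, privacyCurve (X i) (Y i) ε = δ i ε := fun i hi => (hprv i hi).curve
  have hloss : ∀ i < k, IsLoss (X i) (Y i) EReal.toReal :=
    fun i hi => (hprv i hi).isLoss (htop i hi) (h₂ i hi)
  have hcurve := deltaOf_sumLaw_eq_composedCurve X Y k hloss
  refine ⟨isDP_composeLaw hNb M X Y hM h₁ h₂, ?_, fun ε => ?_, fun hδ1 b Z c hc r hr => ?_⟩
  · have hmark : ∀ i, ∀ D : Bool, IsProbabilityMeasure (bif D then Y i else X i) := by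
      rintro i (_ | _)
      exacts [inferInstanceAs (IsProbabilityMeasure (X i)), inferInstanceAs (IsProbabilityMeasure (Y i))]
    -- The extremal mechanisms publish an independent sample of the PRV itself, `X i` on one
    -- database and `Y i` on the other.
    refine ⟨fun _ => EReal, inferInstance,
      fun i D => Kernel.const (Hist (fun _ => EReal) i) (bif D then Y i else X i),
      fun i D => inferInstance, haveCurves_const X Y h₁ h₂, fun ε => ?_⟩
    simp only [cond_false, cond_true]
    rw [composeLaw_const X k, composeLaw_const Y k, composedCurve]
  · have := deltaOf_composePRV hk hε hδ hδ' hloss htop (fun i hi => (hprv i hi).bot) h₁ h₂ hh hL hL2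
      hsum hcomp ε
    refine ⟨this.1, hcurve ε, ?_⟩
    rw [← hcurve ε]
    exact this.2
  · have h0 := (hoeffding_mesh hk hε hδ hδ' hh).1
    have := composeProg_correct hk hn h0 (le_sq_of_mesh hk hε hδ hδ1 hh hL hL2) Y Z c hc
    rw [hr, hL]
    exact this
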